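/- Let $R$ be a principal ideal domain, let $M$ be a nonzero finite-rank free $R$-module, and let $a,b\ge 0$ be integers. A collection of submodules of $M$ has the common basis property if there is a basis of $M$ such that each member of the collection is spanned by a subset of that basis. Let $T(M)$ be the order complex of the poset of proper nonzero direct summands of $M$, ordered by inclusion. Let $ST(M)$ be the order complex of the poset of pairs $(P,Q)$ of proper nonzero submodules with $M=P\oplus Q$, where $(P,Q)\le(P',Q')$ if $P\subseteq P'$ and $Q'\subseteq Q$; its simplices correspond to the splittings $M=M_0\oplus\dots\oplus M_m$ into nonzero submodules with $m\ge 1$, via the pairs $(M_0\oplus\dots\oplus M_k,\,M_{k+1}\oplus\dots\oplus M_m)$, $0\le k<m$. Let $T^{a,b}(M)$ be the subcomplex of the join of simplicial complexes $$\underbrace{T(M)*\dots*T(M)}_{a}*\underbrace{ST(M)*\dots*ST(M)}_{b}$$ consisting of the simplices such that all the submodules occurring in their parts in the factors (the members of the flags in the factors $T(M)$ and the summands of the splittings in the factors $ST(M)$) together have the common basis property. Let $L_\bullet(M)$ be the simplicial set whose $p$-simplices are the flags $V_0\subseteq\dots\subseteq V_p$ of (not necessarily distinct, proper or nonzero) direct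 summands of $M$, with faces forgetting and degeneracies repeating terms. Let $SL_\bullet(M)$ be the simplicial set whose $p$-simplices are the splittings $M=M_0\oplus\dots\oplus M_{p+1}$ into (not necessarily proper or nonzero) submodules, where $d_i$ replaces $M_i,M_{i+1}$ by $M_i\oplus M_{i+1}$ and $s_i$ inserts a zero summand between $M_i$ and $M_{i+1}$. A flag is called not full if $V_0\ne 0$ or $V_p\neq M$; a splitting is called not full if $M_0\neq 0$ or $M_{p+1}\ne 0$. Let $L^{a,b}(M)$ be the $(a+b)$-fold simplicial set of those elements of $$L_{p_1}(M)\times\dots\times L_{p_a}(M)\times SL_{p_{a+1}}(M)\times\dots\times SL_{p_{a+b}}(M)$$ all of whose submodules together have the common basis property, and let $\mathring L^{a,b}(M)\subseteq L^{a,b}(M)$ consist of the elements at least one of whose components is not full. Let $D^{a,b}(M)$ be the geometric realization of the diagonal of the $(a+b)$-fold simplicial set $L^{a,b}(M)/\mathring L^{a,b}(M)$, where a quotient by the empty set means adding a disjoint base point. Then there is a homotopy equivalence $$D^{a,b}(M)\;\simeq\;\Sigma^{a+b+1}\,|T^{a,b}(M)|,$$ where $|T^{a,b}(M)|$ is the geometric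 realization and $\Sigma$ is the unreduced suspension (so that $\Sigma\emptyset=S^0$). -/

import Mathlib

open CategoryTheory

universe v u

namespace HigherTits

section Modules

variable (R : Type v) (M : Type u) [CommRing R] [AddCommGroup M] [Module R M]

variable {R M} in
/-- A collection of submodules of the finite-rank free module `M` has the *common basis property*
if there is a basis of `M` such that each member is spanned by a subset of that basis. -/
def HasCommonBasis (S : Set (Submodule R M)) : Prop :=
  ∃ b : Module.Basis (Fin (Module.finrank R M)) R M,
    ∀ U ∈ S, ∃ t : Set (Fin (Module.finrank R M)), U = Submodule.span R (b '' t)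

/-! ### The simplicial complex `T^{a,b}(M)` -/

/-- Vertices of the Tits building: the proper nonzero split submodules, ordered by inclusion. -/
abbrev TitsVertex : Type u :=
  {V : Submodule R M // V ≠ ⊥ ∧ V ≠ ⊤ ∧ IsComplemented V}

/-- Vertices of the split Tits building: the splittings `M = P ⊕ Q` of `M` into two proper nonzero
submodules. -/
@[ext]
structure SplitTitsVertex : Type u where
  /-- the first summand -/
  P : Submodule R M
  /-- the second summand -/
  Q : Submodule R M
  isCompl : IsCompl P Q
  P_ne_bot : P ≠ ⊥
  Q_ne_bot : Q ≠ ⊥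

/-- `(P, Q) ≤ (P', Q')` if `P ⊆ P'` and `Q' ⊆ Q`. -/
instance : PartialOrder (SplitTitsVertex R M) where
  le x y := x.P ≤ y.P ∧ y.Q ≤ x.Q
  le_refl _ := ⟨le_rfl, le_rfl⟩
  le_trans _ _ _ h h' := ⟨h.1.trans h'.1, h'.2.trans h.2⟩
  le_antisymm _ _ h h' := SplitTitsVertex.ext (le_antisymm h.1 h'.1) (le_antisymm h'.2 h.2)

/-- Vertices of the join `T(M) * ⋯ * T(M) * ST(M) * ⋯ * ST(M)` of `a` copies of `T(M)` and `b`
copies of `ST(M)`: the disjoint union of the vertices of the factors. It carries the ordinal sum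
(lexicographic) order of the posets of vertices of the factors. -/
abbrev JoinVertex (a b : ℕ) : Type u :=
  (Fin a ×ₗ TitsVertex R M) ⊕ₗ (Fin b ×ₗ SplitTitsVertex R M)

variable {R M} in
/-- The vertex `V` of the `i`-th factor `T(M)` of the join. -/
def titsVertex {a b : ℕ} (i : Fin a) (V : TitsVertex R M) : JoinVertex R M a b :=
  toLex (Sum.inl (toLex (i, V)))

variable {R M} in
/-- The vertex `(P, Q)` of the `j`-th factor `ST(M)` of the join. -/
def splitVertex {a b : ℕ} (j : Fin b) (W : SplitTitsVertex R M) : JoinVertex R M a b :=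
  toLex (Sum.inr (toLex (j, W)))

/-- The join `T(M) * ⋯ * T(M) * ST(M) * ⋯ * ST(M)` of `a` copies of the Tits building and `b` copies
of the split Tits building (both order complexes of posets): a nonempty finite set of vertices is a
simplex if its part in each factor is a (possibly empty) chain. -/
def titsJoin (a b : ℕ) : PreAbstractSimplicialComplex (JoinVertex R M a b) where
  faces := {s | s.Nonempty ∧
    (∀ i : Fin a, IsChain (· ≤ ·) {V : TitsVertex R M | titsVertex i V ∈ s}) ∧
    (∀ j : Fin b, IsChain (· ≤ ·) {W : SplitTitsVertex R M | splitVertex j W ∈ s})}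
  isRelLowerSet_faces := fun _ hs => ⟨hs.1, fun _ hts ht =>
    ⟨ht, fun i => (hs.2.1 i).mono fun _ h => hts h, fun j => (hs.2.2 j).mono fun _ h => hts h⟩⟩

variable {R M} in
/-- The submodules of `M` occurring in a set of vertices of the join. (For the splitting
`(M_0, …, M_m)` that corresponds to a chain in a factor `ST(M)`, the members of the chain are the
pairs `(M_0 ⊕ ⋯ ⊕ M_k, M_{k+1} ⊕ ⋯ ⊕ M_m)`; a basis of `M` is adapted to all `M_k` if and only if it
is adapted to all the members of these pairs.) -/
def submodulesOf {a b : ℕ} (s : Set (JoinVertex R M a b)) : Set (Submodule R M) :=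
  {U | ∃ (i : Fin a) (V : TitsVertex R M), titsVertex i V ∈ s ∧ U = V.1} ∪
  {U | ∃ (j : Fin b) (W : SplitTitsVertex R M), splitVertex j W ∈ s ∧ (U = W.P ∨ U = W.Q)}

variable {R M} in
lemma HasCommonBasis.mono {S S' : Set (Submodule R M)} (h : HasCommonBasis S) (hS : S' ⊆ S) :
    HasCommonBasis S' :=
  let ⟨b, hb⟩ := h
  ⟨b, fun U hU => hb U (hS hU)⟩

variable {R M} in
lemma submodulesOf_mono {a b : ℕ} {s t : Set (JoinVertex R M a b)} (h : s ⊆ t) :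
    submodulesOf s ⊆ submodulesOf t := by
  rintro U (⟨i, V, hV, rfl⟩ | ⟨j, W, hW, hU⟩)
  · exact Or.inl ⟨i, V, h hV, rfl⟩
  · exact Or.inr ⟨j, W, h hW, hU⟩

/-- The higher Tits building `T^{a,b}(M)`: the subcomplex of the join of `a` copies of `T(M)` and
`b` copies of `ST(M)` consisting of the simplices with the common basis property. -/
def higherTits (a b : ℕ) : PreAbstractSimplicialComplex (JoinVertex R M a b) where
  faces := {s | s ∈ titsJoin R M a b ∧ HasCommonBasis (submodulesOf (s : Set (JoinVertex R M a b)))}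
  isRelLowerSet_faces := fun _ hs =>
    ⟨((titsJoin R M a b).isRelLowerSet_faces hs.1).1, fun _ hts ht =>
      ⟨((titsJoin R M a b).isRelLowerSet_faces hs.1).2 hts ht,
        hs.2.mono (submodulesOf_mono hts)⟩⟩

end Modules

/-! ### Realization of ordered simplicial complexes, suspension -/

/-- The simplicial set of an abstract simplicial complex whose vertices are partially ordered in
such a way that every simplex is a chain: the `n`-simplices are the weakly monotone sequences
`x_0 ≤ ⋯ ≤ x_n` of vertices whose underlying set is a simplex. Its realization is the realization of
the simplicial complex. -/
def orderedSSet {V : Type u} [PartialOrder V] (K : PreAbstractSimplicialComplex V) : SSet.{u} where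
  obj n := {x : Fin (n.unop.len + 1) →o V // (Set.finite_range x).toFinset ∈ K}
  map f := ↾fun x => ⟨x.1.comp f.unop.toOrderHom,
    (K.isRelLowerSet_faces x.2).2
      (by
        intro y hy
        simp only [Set.Finite.mem_toFinset, Set.mem_range] at hy ⊢
        obtain ⟨i, rfl⟩ := hy
        exact ⟨_, rfl⟩)
      ⟨x.1 (f.unop.toOrderHom 0), by
        simp only [Set.Finite.mem_toFinset, Set.mem_range]
        exact ⟨0, rfl⟩⟩⟩

/-- Every simplex of the join (hence of `T^{a,b}(M)`) is a chain of vertices. -/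
lemma isChain_of_mem_titsJoin {R : Type v} {M : Type u} [CommRing R] [AddCommGroup M] [Module R M]
    {a b : ℕ} {s : Finset (JoinVertex R M a b)} (hs : s ∈ titsJoin R M a b) :
    IsChain (· ≤ ·) (s : Set (JoinVertex R M a b)) := by
  obtain ⟨-, hT, hS⟩ := hs
  rintro (⟨i, V⟩ | ⟨j, W⟩) hx (⟨i', V'⟩ | ⟨j', W'⟩) hy -
  · rcases lt_trichotomy i i' with h | rfl | h
    · exact Or.inl (Sum.Lex.inl_le_inl_iff.2 (Prod.Lex.toLex_le_toLex.2 (Or.inl h)))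
    · rcases (hT i).total hx hy with h | h
      · exact Or.inl (Sum.Lex.inl_le_inl_iff.2 (Prod.Lex.toLex_le_toLex.2 (Or.inr ⟨rfl, h⟩)))
      · exact Or.inr (Sum.Lex.inl_le_inl_iff.2 (Prod.Lex.toLex_le_toLex.2 (Or.inr ⟨rfl, h⟩)))
    · exact Or.inr (Sum.Lex.inl_le_inl_iff.2 (Prod.Lex.toLex_le_toLex.2 (Or.inl h)))
  · exact Or.inl (Sum.Lex.inl_le_inr _ _)
  · exact Or.inr (Sum.Lex.inl_le_inr _ _)
  · rcases lt_trichotomy j j' with h | rfl | h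
    · exact Or.inl (Sum.Lex.inr_le_inr_iff.2 (Prod.Lex.toLex_le_toLex.2 (Or.inl h)))
    · rcases (hS j).total hx hy with h | h
      · exact Or.inl (Sum.Lex.inr_le_inr_iff.2 (Prod.Lex.toLex_le_toLex.2 (Or.inr ⟨rfl, h⟩)))
      · exact Or.inr (Sum.Lex.inr_le_inr_iff.2 (Prod.Lex.toLex_le_toLex.2 (Or.inr ⟨rfl, h⟩)))
    · exact Or.inr (Sum.Lex.inr_le_inr_iff.2 (Prod.Lex.toLex_le_toLex.2 (Or.inl h)))

/-- The end identifications in the unreduced suspension: `(0, x) ∼ south`, `(1, x) ∼ north`. -/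
inductive SuspensionRel (X : Type u) : (unitInterval × X) ⊕ Bool → (unitInterval × X) ⊕ Bool → Prop
  | south (x : X) : SuspensionRel X (Sum.inl (0, x)) (Sum.inr false)
  | north (x : X) : SuspensionRel X (Sum.inl (1, x)) (Sum.inr true)

/-- The unreduced suspension: `[0, 1] × X` together with two points, with `{0} × X` collapsed to the
first and `{1} × X` to the second point. The suspension of the empty space is `S⁰`. -/
def suspension (X : TopCat.{u}) : TopCat.{u} :=
  TopCat.of (Quot (SuspensionRel X))

/-! ### The multisimplicial set `D^{a,b}(M)` -/

section Multisimplicial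

variable (R : Type v) (M : Type u) [CommRing R] [AddCommGroup M] [Module R M]

/-- The simplicial set `L_•(M)`: the `p`-simplices are the flags `V_0 ⊆ ⋯ ⊆ V_p` of (not necessarily
distinct, proper or nonzero) summands of `M`; faces forget and degeneracies repeat summands. -/
def flagSSet : SSet.{u} where
  obj p := {V : Fin (p.unop.len + 1) →o Submodule R M // ∀ k, IsComplemented (V k)}
  map f := ↾fun V => ⟨V.1.comp f.unop.toOrderHom, fun k => V.2 (f.unop.toOrderHom k)⟩

variable {R M} in
/-- A flag is not full if `V_0 ≠ 0` or `V_p ≠ M`. These flags form the simplicial subset `L̊_•(M)`. -/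
def FlagNotFull {p : SimplexCategoryᵒᵖ} (V : (flagSSet R M).obj p) : Prop :=
  V.1 0 ≠ ⊥ ∨ V.1 (Fin.last _) ≠ ⊤

variable {R M} in
/-- Given a family of submodules indexed by `ι` and a map `φ : ι → κ`, the family indexed by `κ`
obtained by summing over the fibres of `φ`. -/
def fibreSum {ι κ : Type*} (φ : ι → κ) (N : ι → Submodule R M) (j : κ) : Submodule R M :=
  ⨆ (i : ι) (_ : φ i = j), N i

variable {R M} in
lemma fibreSum_isInternal {ι κ : Type*} [DecidableEq ι] [DecidableEq κ] (φ : ι → κ)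
    {N : ι → Submodule R M} (h : DirectSum.IsInternal N) :
    DirectSum.IsInternal (fibreSum φ N) := by
  rw [DirectSum.isInternal_submodule_iff_iSupIndep_and_iSup_eq_top] at h ⊢
  refine ⟨fun j => ?_, ?_⟩
  · refine (h.1.disjoint_biSup_biSup (s := {i | φ i = j}) (t := {i | φ i ≠ j}) ?_).mono_right ?_
    · exact Set.disjoint_left.2 fun i hi hi' => hi' hi
    · refine iSup₂_le fun k hk => iSup₂_le fun i hi => ?_
      exact le_iSup₂_of_le i (by simpa [hi] using hk) le_rfl
  · rw [eq_top_iff, ← h.2]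
    exact iSup_le fun i => le_iSup_of_le (φ i) (le_iSup₂_of_le i rfl le_rfl)

variable {R M} in
lemma fibreSum_id {ι : Type*} (N : ι → Submodule R M) : fibreSum id N = N := by
  funext j
  simp [fibreSum]

variable {R M} in
lemma fibreSum_fibreSum {ι κ μ : Type*} (φ : ι → κ) (ψ : κ → μ) (N : ι → Submodule R M) :
    fibreSum ψ (fibreSum φ N) = fibreSum (ψ ∘ φ) N := by
  funext j
  apply le_antisymm
  · refine iSup₂_le fun k hk => iSup₂_le fun i hi => ?_
    exact le_iSup₂_of_le i (by simp [hi, hk]) le_rfl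
  · refine iSup₂_le fun i hi => ?_
    exact le_iSup₂_of_le (φ i) hi (le_iSup₂_of_le i rfl le_rfl)

variable {R M} in
lemma HasCommonBasis.of_sums {S S' : Set (Submodule R M)} (h : HasCommonBasis S)
    (hS : ∀ U ∈ S', ∃ A ⊆ S, U = sSup A) : HasCommonBasis S' := by
  obtain ⟨b, hb⟩ := h
  choose! t ht using hb
  refine ⟨b, fun U hU => ?_⟩
  obtain ⟨A, hA, rfl⟩ := hS U hU
  refine ⟨⋃ V ∈ A, t V, ?_⟩
  rw [Set.image_iUnion₂, Submodule.span_iUnion₂, sSup_eq_iSup]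
  exact iSup_congr fun V => iSup_congr fun hV => ht V (hA hV)

/-- The simplicial set `SL_•(M)`: the `p`-simplices are the splittings
`M = M_0 ⊕ ⋯ ⊕ M_{p+1}` into (not necessarily proper or nonzero) submodules. For a monotone map
`θ : [q] → [p]`, the induced map sends `(M_i)_i` to `(M'_j)_j` with `M'_j` the sum of the `M_i` for
which exactly `j` elements `k` of `[q]` satisfy `θ k < i`. So the face `d_i` replaces
`M_i, M_{i+1}` by `M_i ⊕ M_{i+1}`, and the degeneracy `s_i` inserts a zero summand between `M_i`
and `M_{i+1}`. -/
def splitSSet : SSet.{u} where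
  obj p := {N : Fin (p.unop.len + 2) → Submodule R M // DirectSum.IsInternal N}
  map f := ↾fun N => ⟨fibreSum (SimplexCategory.II.map' f.unop.toOrderHom) N.1,
    fibreSum_isInternal _ N.2⟩
  map_id p := by
    refine ConcreteCategory.hom_ext _ _ fun N => Subtype.ext ?_
    refine Eq.trans ?_ (fibreSum_id N.1)
    exact congrArg (fibreSum · N.1) (funext SimplexCategory.II.map'_id)
  map_comp f g := by
    refine ConcreteCategory.hom_ext _ _ fun N => Subtype.ext ?_
    refine Eq.trans ?_ (fibreSum_fibreSum _ _ N.1).symm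
    exact congrArg (fibreSum · N.1) (funext fun x => (SimplexCategory.II.map'_map' _ _ x).symm)

variable {R M} in
/-- A splitting `(M_0, …, M_{p+1})` is not full if `M_0 ≠ 0` or `M_{p+1} ≠ 0`. These splittings form
the simplicial subset `SL̊_•(M)`. -/
def SplitNotFull {p : SimplexCategoryᵒᵖ} (N : (splitSSet R M).obj p) : Prop :=
  N.1 0 ≠ ⊥ ∨ N.1 (Fin.last _) ≠ ⊥

/-- The index category of `(a+b)`-fold simplicial objects. -/
abbrev MultiIndex (a b : ℕ) : Type := Fin a ⊕ Fin b → SimplexCategoryᵒᵖ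

/-- The `(a+b)`-fold simplicial set
`L_{p_1}(M) × ⋯ × L_{p_a}(M) × SL_{p_{a+1}}(M) × ⋯ × SL_{p_{a+b}}(M)`. -/
def productMulti (a b : ℕ) : MultiIndex a b ⥤ Type u where
  obj p := (∀ i : Fin a, (flagSSet R M).obj (p (Sum.inl i))) ×
    (∀ j : Fin b, (splitSSet R M).obj (p (Sum.inr j)))
  map f := ↾fun x => (fun i => (flagSSet R M).map (f (Sum.inl i)) (x.1 i),
    fun j => (splitSSet R M).map (f (Sum.inr j)) (x.2 j))

variable {R M} in
/-- The submodules occurring in a multisimplex. -/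
def submodulesOfMulti {a b : ℕ} {p : MultiIndex a b} (x : (productMulti R M a b).obj p) :
    Set (Submodule R M) :=
  {U | ∃ (i : Fin a) (k : Fin ((p (Sum.inl i)).unop.len + 1)), U = (x.1 i).1 k} ∪
  {U | ∃ (j : Fin b) (k : Fin ((p (Sum.inr j)).unop.len + 2)), U = (x.2 j).1 k}

/-- The `(a+b)`-fold simplicial set `L^{a,b}(M)`, as a subobject of the product: the multisimplices
all of whose submodules together have a common basis. -/
def latticeMulti (a b : ℕ) : Subfunctor (productMulti R M a b) where
  obj p := {x | HasCommonBasis (submodulesOfMulti x)}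
  map {p q} f x hx := by
    refine HasCommonBasis.of_sums (S := submodulesOfMulti x) hx ?_
    rintro U (⟨i, k, rfl⟩ | ⟨j, k, rfl⟩)
    · exact ⟨{(x.1 i).1 ((f (Sum.inl i)).unop.toOrderHom k)},
        Set.singleton_subset_iff.2 (Or.inl ⟨i, _, rfl⟩), sSup_singleton.symm⟩
    · refine ⟨(x.2 j).1 '' {l | SimplexCategory.II.map' (f (Sum.inr j)).unop.toOrderHom l = k},
        ?_, sSup_image.symm⟩
      rintro _ ⟨l, -, rfl⟩
      exact Or.inr ⟨j, l, rfl⟩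

/-- The `(a+b)`-fold simplicial subset `L̊^{a,b}(M)` of `L^{a,b}(M)`: the multisimplices at least one
of whose components is not full. -/
def notFullMulti (a b : ℕ) : Subfunctor (latticeMulti R M a b).toFunctor where
  obj p := {x | (∃ i : Fin a, FlagNotFull (x.1.1 i)) ∨ (∃ j : Fin b, SplitNotFull (x.1.2 j))}
  map {p q} f x hx := by
    rcases hx with ⟨i, h⟩ | ⟨j, h⟩
    · refine Or.inl ⟨i, h.imp (fun h h' => h (le_bot_iff.1 ?_)) (fun h h' => h (top_le_iff.1 ?_))⟩
      · exact ((x.1.1 i).1.monotone (Fin.zero_le _)).trans h'.le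
      · exact h'.ge.trans ((x.1.1 i).1.monotone (Fin.le_last _))
    · refine Or.inr ⟨j, h.imp (fun h h' => h (le_bot_iff.1 ?_)) (fun h h' => h (le_bot_iff.1 ?_))⟩
      · exact (le_iSup₂_of_le (f := fun l (_ : SimplexCategory.II.map' _ l = 0) => (x.1.2 j).1 l)
          0 (SimplexCategory.II.map'_zero _) le_rfl).trans h'.le
      · exact (le_iSup₂_of_le
          (f := fun l (_ : SimplexCategory.II.map' _ l = Fin.last _) => (x.1.2 j).1 l)
          (Fin.last _) (SimplexCategory.II.map'_last _) le_rfl).trans h'.le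

/-- The quotient `F / G` of a set-valued functor by a subfunctor: the pushout of `G → F` along the
map from `G` to the constant functor at a point. The value at an object where `G` is empty is the
value of `F` with a disjoint base point added. -/
noncomputable def collapse {C : Type*} [Category C] {F : C ⥤ Type u} (G : Subfunctor F) :
    C ⥤ Type u :=
  Limits.pushout G.ι
    ({ app := fun _ => ↾fun _ => PUnit.unit } : G.toFunctor ⟶ (Functor.const C).obj PUnit.{u + 1})

/-- The higher building `D^{a,b}(M) = L^{a,b}(M) / L̊^{a,b}(M)`, an `(a+b)`-fold simplicial set. -/
noncomputable def higherBuilding (a b : ℕ) : MultiIndex a b ⥤ Type u :=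
  collapse (notFullMulti R M a b)

/-- The diagonal simplicial set `X_n = X_{n, …, n}` of an `(a+b)`-fold simplicial set. -/
def diagonal {a b : ℕ} (X : MultiIndex a b ⥤ Type u) : SSet.{u} :=
  Functor.pi' (fun _ : Fin a ⊕ Fin b => 𝟭 SimplexCategoryᵒᵖ) ⋙ X

end Multisimplicial

end HigherTits

/-!
Every factor of the multisimplicial set `L^{a,b}(M)` is the nerve of a bounded poset: that of the
summands of `M`, or, since a splitting is determined by its partial sums (`gap_cut`, `cut_gap`), that
of the complementary pairs of submodules. Hence the diagonal of `L^{a,b}(M)` is the ordered simplicial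
complex `K` of those chains in a product of `a + b` bounded posets whose coordinates have a common
basis (`nonempty_diagonal_latticeMulti_iso`), and the diagonal of the not full part consists of the
chains that do not contain both `⊥` and `⊤` (`nonempty_diagonal_notFullMulti_iso`). The only property
of `K` that matters is that a comparable element may be inserted into a chain if each of its
coordinates is extreme or occurs in the chain (`IsAdmissible`): this does not spoil a common basis. In
particular `K` is a cone with apex `⊥`, so the quotient is the suspension of the complex of chains
that do not contain both `⊥` and `⊤` (`htpyEquiv_higherBuilding`).

The corners are the elements `(⊤, …, ⊤, ⊥, …, ⊥)`, the vertices of a maximal chain of extreme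
elements, `a + b + 1` in number. A chain that contains `⊥` and `⊤`, but misses some corner, jumps past
that corner, and can be refined there by a canonical element that mixes the coordinates of two of its
members. Adding or removing this element is an acyclic matching (`pivotMatching`), so the chains that
do not contain both `⊥` and `⊤` have the homotopy type of the larger complex of the chains that miss
at least one corner. Together with the star of the simplex of all the corners these chains cover `K`.
As the star and `K` are contractible, the suspension of the complex of chains that miss a corner is
the suspension of its intersection with the star. That intersection is the join of the boundary of a
simplex of dimension `a + b` and of the link, the complex of the chains that are compatible with all
the corners and contain none of them; it is an `(a + b)`-fold suspension of the link, by induction on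
the number of corners (`htpyEquiv_suspension_insert`).

An element of the product that is comparable with all the corners, but is not a corner, has exactly
one coordinate that is not extreme, preceded by `⊤` and followed by `⊥` (`exists_eq_step`). Such
elements are the vertices of the join of the buildings, and their order is that of the join. So the
link is the higher Tits building (`nonempty_higherTits_iso`).

The homotopy theory that is needed concerns realizations. The realization of a monomorphism has the
homotopy extension property (`hasHEP_toTop`), and that of an anodyne extension is a homotopy
equivalence (`htpyEquiv_of_anodyne`); by the adjunction with singular simplicial sets, both follow from
lifting boundaries and horns against evaluation maps of path spaces, that is, from the retractions of
the prism over a simplex. The former gives the suspensions (`htpyEquiv_suspension_of_isPushout`), the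
latter the invariance under acyclic matchings (`Matching.htpyEquiv`), since a matching is a regular
pairing of the nondegenerate simplices outside the subcomplex.
-/

namespace HigherTits
open Limits unitInterval

/-! ### Homotopy equivalences and path families -/

/-- Two spaces are homotopy equivalent. -/
def HtpyEquiv (X Y : TopCat.{u}) : Prop := Nonempty (ContinuousMap.HomotopyEquiv X Y)

lemma HtpyEquiv.refl (X : TopCat.{u}) : HtpyEquiv X X := ⟨ContinuousMap.HomotopyEquiv.refl X⟩

lemma HtpyEquiv.symm {X Y : TopCat.{u}} (h : HtpyEquiv X Y) : HtpyEquiv Y X := h.map fun e => e.symm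

lemma HtpyEquiv.trans {X Y Z : TopCat.{u}} (h : HtpyEquiv X Y) (h' : HtpyEquiv Y Z) :
    HtpyEquiv X Z := ⟨h.some.trans h'.some⟩

lemma HtpyEquiv.of_iso {X Y : TopCat.{u}} (e : X ≅ Y) : HtpyEquiv X Y :=
  ⟨(TopCat.homeoOfIso e).toHomotopyEquiv⟩

lemma homotopic_of_pathFamily {X Y : Type*} [TopologicalSpace X] [TopologicalSpace Y]
    {f g : C(X, Y)} (H : C(X, C(I, Y))) (h₀ : ∀ x, H x 0 = f x) (h₁ : ∀ x, H x 1 = g x) :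
    f.Homotopic g :=
  ⟨{ toContinuousMap := H.uncurry.comp ⟨Prod.swap, continuous_swap⟩
     map_zero_left := h₀
     map_one_left := h₁ }⟩

lemma exists_pathFamily {X Y : Type*} [TopologicalSpace X] [TopologicalSpace Y]
    {f g : C(X, Y)} (h : f.Homotopic g) :
    ∃ H : C(X, C(I, Y)), (∀ x, H x 0 = f x) ∧ ∀ x, H x 1 = g x := by
  obtain ⟨F⟩ := h
  exact ⟨(F.toContinuousMap.comp ⟨Prod.swap, continuous_swap⟩).curry,
    fun x => F.map_zero_left x, fun x => F.map_one_left x⟩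

lemma htpyEquiv_of_pathFamilies {X Y : TopCat.{u}} (f : C(X, Y)) (g : C(Y, X))
    (H : C(X, C(I, X))) (h₀ : ∀ x, H x 0 = x) (h₁ : ∀ x, H x 1 = g (f x))
    (K : C(Y, C(I, Y))) (k₀ : ∀ y, K y 0 = y) (k₁ : ∀ y, K y 1 = f (g y)) : HtpyEquiv X Y :=
  ⟨{ toFun := f
     invFun := g
     left_inv := (homotopic_of_pathFamily (f := .id _) (g := g.comp f) H h₀ h₁).symm
     right_inv := (homotopic_of_pathFamily (f := .id _) (g := f.comp g) K k₀ k₁).symm }⟩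

lemma exists_contraction (X : Type*) [TopologicalSpace X] [ContractibleSpace X] :
    ∃ (x₀ : X) (H : C(X, C(I, X))), (∀ x, H x 0 = x) ∧ ∀ x, H x 1 = x₀ := by
  obtain ⟨x₀, h⟩ := id_nullhomotopic X
  obtain ⟨H, h₀, h₁⟩ := exists_pathFamily h
  exact ⟨x₀, H, h₀, h₁⟩

lemma contractibleSpace_of_pathFamily {X : Type*} [TopologicalSpace X] (x₀ : X) (H : C(X, C(I, X)))
    (h₀ : ∀ x, H x 0 = x) (h₁ : ∀ x, H x 1 = x₀) : ContractibleSpace X :=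
  (contractible_iff_id_nullhomotopic X).2
    ⟨x₀, homotopic_of_pathFamily (f := .id _) (g := .const _ x₀) H h₀ h₁⟩

lemma HtpyEquiv.contractibleSpace {X Y : TopCat.{u}} (h : HtpyEquiv X Y) [ContractibleSpace Y] :
    ContractibleSpace X := h.some.contractibleSpace

/-! ### The homotopy extension property -/

/-- The homotopy extension property of a continuous map `i : A ⟶ X`, with homotopies encoded as
maps to spaces of paths. -/
def HasHEP {A X : TopCat.{u}} (i : A ⟶ X) : Prop :=
  ∀ (Y : TopCat.{u}) (f : C(X, Y)) (h : C(A, C(I, Y))), (∀ a, h a 0 = f (i a)) →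
    ∃ H : C(X, C(I, Y)), (∀ x, H x 0 = f x) ∧ ∀ a, H (i a) = h a

lemma congr_app {X Y : TopCat.{u}} {f g : X ⟶ Y} (h : f = g) (x : X) : f x = g x := by rw [h]

/-- To define a continuous map from a pushout, and to know its values. -/
lemma exists_desc {A X B P : TopCat.{u}} {i : A ⟶ X} {k : A ⟶ B} {x : X ⟶ P} {b : B ⟶ P}
    (sq : IsPushout i k x b) {Y : Type u} [TopologicalSpace Y] (f : C(X, Y)) (g : C(B, Y))
    (h : ∀ a, f (i a) = g (k a)) :
    ∃ F : C(P, Y), (∀ z, F (x z) = f z) ∧ ∀ z, F (b z) = g z := by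
  let f' : X ⟶ TopCat.of Y := TopCat.ofHom f
  let g' : B ⟶ TopCat.of Y := TopCat.ofHom g
  have w : i ≫ f' = k ≫ g' := by ext a; exact h a
  exact ⟨(sq.desc f' g' w).hom, fun z => congr_app (sq.inl_desc f' g' w) z,
    fun z => congr_app (sq.inr_desc f' g' w) z⟩

/-- Continuous maps from a pushout that agree on both pieces are equal. -/
lemma pushout_ext {A X B P : TopCat.{u}} {i : A ⟶ X} {k : A ⟶ B} {x : X ⟶ P} {b : B ⟶ P}
    (sq : IsPushout i k x b) {Y : Type u} [TopologicalSpace Y] {f g : C(P, Y)}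
    (h : ∀ z, f (x z) = g (x z)) (h' : ∀ z, f (b z) = g (b z)) (p : P) : f p = g p := by
  have : TopCat.ofHom f = (TopCat.ofHom g : P ⟶ TopCat.of Y) :=
    sq.hom_ext (by ext z; exact h z) (by ext z; exact h' z)
  exact congr_app this p

lemma HasHEP.of_isPushout {A X B P : TopCat.{u}} {i : A ⟶ X} {k : A ⟶ B} {x : X ⟶ P} {b : B ⟶ P}
    (sq : IsPushout i k x b) (hi : HasHEP i) : HasHEP b := by
  intro Y f h hfh
  obtain ⟨H, H₀, H₁⟩ := hi Y (f.comp x.hom) (h.comp k.hom) fun a => by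
    have := congr_app sq.w a
    simpa using (hfh (k a)).trans (congrArg f this.symm)
  obtain ⟨F, F₁, F₂⟩ := exists_desc sq H h fun a => H₁ a
  refine ⟨F, fun p => ?_, F₂⟩
  refine pushout_ext sq (f := (ContinuousMap.mk (fun γ : C(I, Y) => γ 0)).comp F) (g := f)
    (fun z => ?_) (fun z => ?_) p
  · simpa [F₁] using H₀ z
  · simpa [F₂] using hfh z

/-- Collapsing a contractible subspace with the homotopy extension property is a homotopy
equivalence. -/
lemma htpyEquiv_of_collapse {A X T Q : TopCat.{u}} [Unique T] [ContractibleSpace A] {i : A ⟶ X}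
    {k : A ⟶ T} {q : X ⟶ Q} {t : T ⟶ Q} (sq : IsPushout i k q t) (hi : HasHEP i) :
    HtpyEquiv X Q := by
  obtain ⟨a₀, H, H₀, H₁⟩ := exists_contraction A
  obtain ⟨F, F₀, F₁⟩ := hi X (.id _) (⟨fun a => (i.hom : C(A, X)).comp (H a), by fun_prop⟩)
    fun a => by simp [H₀]
  -- the end of the extended homotopy is constant on `A`, so it factors through the quotient
  obtain ⟨g, g₁, g₂⟩ := exists_desc sq ((ContinuousMap.mk (fun γ : C(I, X) => γ 1)).comp F)
    (.const _ (i a₀)) fun a => by simp [F₁, H₁]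
  have hq : ∀ a, q (i a) = t default := fun a =>
    (congr_app sq.w a).trans (congrArg t (Subsingleton.elim _ _))
  obtain ⟨K, K₁, K₂⟩ := exists_desc sq (Y := C(I, Q))
    (⟨fun x => (q.hom : C(X, Q)).comp (F x), by fun_prop⟩) (.const _ (.const _ (t default)))
    fun a => by ext s; simpa [F₁] using hq (H a s)
  refine htpyEquiv_of_pathFamilies q.hom g F F₀ (fun x => (g₁ x).symm) K (fun p => ?_) fun p => ?_
  · refine pushout_ext sq (f := (ContinuousMap.mk (fun γ : C(I, Q) => γ 0)).comp K) (g := .id _)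
      (fun z => ?_) (fun z => ?_) p
    · simpa [K₁] using congrArg q (F₀ z)
    · simp [K₂, Subsingleton.elim z default]
  · refine pushout_ext sq (f := (ContinuousMap.mk (fun γ : C(I, Q) => γ 1)).comp K)
      (g := (q.hom : C(X, Q)).comp g) (fun z => ?_) (fun z => ?_) p
    · simp [K₁, g₁]
    · simpa [K₂, g₂] using (hq a₀).symm

/-- The map to the one-point space. -/
def toPt (A : TopCat.{u}) : A ⟶ TopCat.of PUnit.{u + 1} := TopCat.ofHom (.const _ PUnit.unit)

/-- Gluing a contractible space along a map with the homotopy extension property has the same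
effect, up to homotopy, as collapsing. -/
lemma htpyEquiv_pushout_collapse {A X B P Q : TopCat.{u}} [ContractibleSpace B] {i : A ⟶ X}
    {k : A ⟶ B} {x : X ⟶ P} {b : B ⟶ P} (sq : IsPushout i k x b) {q : X ⟶ Q}
    {t : TopCat.of PUnit.{u + 1} ⟶ Q} (sq' : IsPushout i (toPt A) q t) (hi : HasHEP i) :
    HtpyEquiv P Q := by
  have hw : i ≫ q = k ≫ toPt B ≫ t := by rw [sq'.w]; rfl
  have h := (IsPushout.of_left (h₁₁ := k) (h₁₂ := toPt B) (v₁₁ := i) (v₁₂ := b) (v₁₃ := t)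
    (h₂₁ := x) (h₂₂ := sq.desc q (toPt B ≫ t) hw) (by rw [sq.inl_desc]; exact sq'.flip)
    (sq.inr_desc ..).symm sq.flip).flip
  exact htpyEquiv_of_collapse h (hi.of_isPushout sq)

/-! ### Cones and suspensions -/

/-- The identification in the cone: `(0, x)` is the apex. -/
inductive ConeRel (X : Type u) : (I × X) ⊕ Unit → (I × X) ⊕ Unit → Prop
  | apex (x : X) : ConeRel X (Sum.inl (0, x)) (Sum.inr ())

/-- The cone `[0, 1] × X / {0} × X`; the cone on the empty space is a point. -/
def cone (X : TopCat.{u}) : TopCat.{u} := TopCat.of (Quot (ConeRel X))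

/-- The point `(s, x)` of the cone. -/
def coneMk (X : TopCat.{u}) : C(I × X, cone X) :=
  ⟨fun z => Quot.mk _ (Sum.inl z), continuous_quot_mk.comp continuous_inl⟩

/-- The apex of the cone. -/
def coneApex (X : TopCat.{u}) : cone X := Quot.mk _ (Sum.inr ())

lemma coneMk_zero (X : TopCat.{u}) (x : X) : coneMk X (0, x) = coneApex X :=
  Quot.sound (ConeRel.apex x)

/-- The base of the cone. -/
def coneBase (X : TopCat.{u}) : X ⟶ cone X :=
  TopCat.ofHom ((coneMk X).comp ⟨fun x => (1, x), by fun_prop⟩)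

@[elab_as_elim]
lemma cone_ind {X : TopCat.{u}} {p : cone X → Prop} (h : ∀ s x, p (coneMk X (s, x)))
    (h' : p (coneApex X)) (z : cone X) : p z := by
  obtain ⟨⟨s, x⟩ | ⟨⟩⟩ := z
  · exact h s x
  · exact h'

lemma exists_coneDesc {X : TopCat.{u}} {Y : Type*} [TopologicalSpace Y] (f : C(I × X, Y)) (y : Y)
    (h : ∀ x, f (0, x) = y) :
    ∃ F : C(cone X, Y), (∀ s x, F (coneMk X (s, x)) = f (s, x)) ∧ F (coneApex X) = y := by
  refine ⟨⟨Quot.lift (Sum.elim f fun _ => y) ?_, ?_⟩, fun s x => rfl, rfl⟩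
  · rintro _ _ ⟨x⟩
    exact h x
  · exact continuous_quot_lift _ (by fun_prop)

/-- The point `(s, x)` of the suspension. -/
def suspMk (X : TopCat.{u}) : C(I × X, suspension X) :=
  ⟨fun z => Quot.mk _ (Sum.inl z), continuous_quot_mk.comp continuous_inl⟩

/-- The south pole (for `false`) and the north pole (for `true`) of the suspension. -/
def suspPole (X : TopCat.{u}) (b : Bool) : suspension X := Quot.mk _ (Sum.inr b)

lemma suspMk_zero (X : TopCat.{u}) (x : X) : suspMk X (0, x) = suspPole X false :=
  Quot.sound (SuspensionRel.south x)

lemma suspMk_one (X : TopCat.{u}) (x : X) : suspMk X (1, x) = suspPole X true :=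
  Quot.sound (SuspensionRel.north x)

@[elab_as_elim]
lemma susp_ind {X : TopCat.{u}} {p : suspension X → Prop} (h : ∀ s x, p (suspMk X (s, x)))
    (h' : ∀ b, p (suspPole X b)) (z : suspension X) : p z := by
  obtain ⟨⟨s, x⟩ | b⟩ := z
  · exact h s x
  · exact h' b

lemma exists_suspDesc {X : TopCat.{u}} {Y : Type*} [TopologicalSpace Y] (f : C(I × X, Y))
    (y₀ y₁ : Y) (h₀ : ∀ x, f (0, x) = y₀) (h₁ : ∀ x, f (1, x) = y₁) :
    ∃ F : C(suspension X, Y), (∀ s x, F (suspMk X (s, x)) = f (s, x)) ∧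
      F (suspPole X false) = y₀ ∧ F (suspPole X true) = y₁ := by
  refine ⟨⟨Quot.lift (Sum.elim f fun b => bif b then y₁ else y₀) ?_, ?_⟩, fun s x => rfl, rfl, rfl⟩
  · rintro _ _ (⟨x⟩ | ⟨x⟩)
    · exact h₀ x
    · exact h₁ x
  · exact continuous_quot_lift _ (by fun_prop)

/-- Suspension preserves homotopy equivalences. -/
lemma HtpyEquiv.suspension {X Y : TopCat.{u}} (h : HtpyEquiv X Y) :
    HtpyEquiv (suspension X) (suspension Y) := by
  obtain ⟨e⟩ := h
  have key : ∀ {A B : TopCat.{u}} (f : C(A, B)), ∃ F : C(HigherTits.suspension A,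
      HigherTits.suspension B), (∀ s x, F (suspMk A (s, x)) = suspMk B (s, f x)) ∧
      ∀ b, F (suspPole A b) = suspPole B b := by
    intro A B f
    obtain ⟨F, h, h₀, h₁⟩ := exists_suspDesc ((suspMk B).comp (.prodMap (.id I) f))
      (suspPole B false) (suspPole B true) (fun x => suspMk_zero B _) fun x => suspMk_one B _
    exact ⟨F, h, fun b => by cases b <;> assumption⟩
  have key' : ∀ {A : TopCat.{u}} (H : C(A, C(I, A))), ∃ F : C(HigherTits.suspension A,
      C(I, HigherTits.suspension A)), (∀ s x t, F (suspMk A (s, x)) t = suspMk A (s, H x t)) ∧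
      ∀ b t, F (suspPole A b) t = suspPole A b := by
    intro A H
    obtain ⟨F, h, h₀, h₁⟩ := exists_suspDesc
      ((suspMk A).comp (⟨fun z : (I × A) × I => (z.1.1, H z.1.2 z.2), by fun_prop⟩ :
        C((I × A) × I, I × A))).curry
      (.const _ (suspPole A false)) (.const _ (suspPole A true))
      (fun x => by ext t; exact suspMk_zero A _) fun x => by ext t; exact suspMk_one A _
    refine ⟨F, fun s x t => by rw [h]; rfl, fun b t => ?_⟩
    cases b
    · rw [h₀]; rfl
    · rw [h₁]; rfl
  obtain ⟨F, F₁, F₂⟩ := key e.toFun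
  obtain ⟨G, G₁, G₂⟩ := key e.invFun
  obtain ⟨H, H₀, H₁⟩ := exists_pathFamily e.left_inv.symm
  obtain ⟨K, K₀, K₁⟩ := exists_pathFamily e.right_inv.symm
  obtain ⟨H', H'₁, H'₂⟩ := key' H
  obtain ⟨K', K'₁, K'₂⟩ := key' K
  refine htpyEquiv_of_pathFamilies F G H' ?_ ?_ K' ?_ ?_ <;> intro z <;>
    refine susp_ind (fun s x => ?_) (fun b => ?_) z
  · simp [H'₁, H₀]
  · simp [H'₂]
  · simp [H'₁, H₁, F₁, G₁]
  · simp [H'₂, F₂, G₂]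
  · simp [K'₁, K₀]
  · simp [K'₂]
  · simp [K'₁, K₁, F₁, G₁]
  · simp [K'₂, F₂, G₂]

lemma HtpyEquiv.suspension_iterate {X Y : TopCat.{u}} (h : HtpyEquiv X Y) (n : ℕ) :
    HtpyEquiv (HigherTits.suspension^[n] X) (HigherTits.suspension^[n] Y) := by
  induction n with
  | zero => exact h
  | succ n ih =>
    rw [Function.iterate_succ_apply', Function.iterate_succ_apply']
    exact ih.suspension

lemma hasHEP_coneBase (A : TopCat.{u}) : HasHEP (coneBase A) := by
  intro Y f h hf
  -- the point `(s, a)` at time `t` is sent to `(s * (1 + t), a)`, and beyond the base along `h a`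
  let u : C((I × A) × I, ℝ) := ⟨fun z => z.1.1 * (1 + z.2), by fun_prop⟩
  let Φ : (I × A) × I → Y := fun z => if u z ≤ 1 then
    f (coneMk A (Set.projIcc 0 1 zero_le_one (u z), z.1.2)) else
    h z.1.2 (Set.projIcc 0 1 zero_le_one (u z - 1))
  have hΦ : Continuous Φ := by
    refine Continuous.if_le ?_ ?_ u.continuous continuous_const fun z hz => ?_
    · exact f.continuous.comp ((coneMk A).continuous.comp
        ((continuous_projIcc.comp u.continuous).prodMk (by fun_prop)))
    · have h' : Continuous fun z : (I × A) × I => (Set.projIcc 0 1 zero_le_one (u z - 1) : I) :=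
        continuous_projIcc.comp (by fun_prop)
      fun_prop
    · rw [hz, sub_self, Set.projIcc_left, Set.projIcc_right]
      exact (hf _).symm
  obtain ⟨H, H₁, H₂⟩ := exists_coneDesc (ContinuousMap.mk Φ hΦ).curry
    (.const _ (f (coneApex A))) fun a => by
      ext t
      have : u ((0, a), t) = 0 := by simp [u]
      simp [Φ, this, ← coneMk_zero A a]
  refine ⟨H, fun z => ?_, fun a => ?_⟩
  · refine cone_ind (fun s a => ?_) ?_ z
    · have hu : u ((s, a), 0) = s := by simp [u]
      have : (s : ℝ) ≤ 1 := s.2.2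
      simp [H₁, Φ, hu, this]
    · simp [H₂]
  · ext t
    change H (coneMk A (1, a)) t = _
    have hu : u ((1, a), t) = 1 + t := by simp [u]
    simp only [H₁, Φ, ContinuousMap.curry_apply, ContinuousMap.coe_mk, hu]
    split_ifs with ht
    · have : t = 0 := le_antisymm (Subtype.coe_le_coe.1 (by simpa using ht)) t.2.1
      subst this
      simp only [Set.Icc.coe_zero, add_zero, Set.projIcc_right]
      exact (hf a).symm
    · simp

instance (A : TopCat.{u}) : ContractibleSpace (cone A) := by
  obtain ⟨H, H₁, H₂⟩ := exists_coneDesc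
    ((coneMk A).comp (⟨fun z : (I × A) × I => (z.1.1 * σ z.2, z.1.2), by fun_prop⟩ :
      C((I × A) × I, I × A))).curry
    (.const _ (coneApex A)) fun x => by ext t; simp [coneMk_zero]
  refine contractibleSpace_of_pathFamily (coneApex A) H (fun z => ?_) fun z => ?_ <;>
    refine cone_ind (fun s x => ?_) ?_ z
  · simp [H₁]
  · simp [H₂]
  · simp [H₁, coneMk_zero]
  · simp [H₂]

/-- The suspension is the quotient of the cone by its base. -/
lemma exists_isPushout_suspension (A : TopCat.{u}) :
    ∃ (q : cone A ⟶ suspension A) (t : TopCat.of PUnit.{u + 1} ⟶ suspension A),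
      IsPushout (coneBase A) (toPt A) q t := by
  obtain ⟨q, q₁, q₂⟩ := exists_coneDesc (suspMk A) (suspPole A false) (suspMk_zero A)
  let t : TopCat.of PUnit.{u + 1} ⟶ suspension A := TopCat.ofHom (.const _ (suspPole A true))
  refine ⟨TopCat.ofHom q, t, ⟨⟨?_⟩, ⟨PushoutCocone.IsColimit.mk _ ?_ ?_ ?_ ?_⟩⟩⟩
  · ext a
    exact (q₁ 1 a).trans (suspMk_one A a)
  · intro s
    exact TopCat.ofHom (exists_suspDesc (s.inl.hom.comp (coneMk A)) (s.inl (coneApex A))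
      (s.inr PUnit.unit) (fun x => congrArg s.inl (coneMk_zero A x))
      fun x => congr_app s.condition x).choose
  · intro s
    obtain ⟨h, h₀, -⟩ := (exists_suspDesc (s.inl.hom.comp (coneMk A)) (s.inl (coneApex A))
      (s.inr PUnit.unit) (fun x => congrArg s.inl (coneMk_zero A x))
      fun x => congr_app s.condition x).choose_spec
    ext z
    refine cone_ind (fun r x => ?_) ?_ z
    · exact (congrArg _ (q₁ r x)).trans (h r x)
    · exact (congrArg _ q₂).trans h₀
  · intro s
    obtain ⟨-, -, h₁⟩ := (exists_suspDesc (s.inl.hom.comp (coneMk A)) (s.inl (coneApex A))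
      (s.inr PUnit.unit) (fun x => congrArg s.inl (coneMk_zero A x))
      fun x => congr_app s.condition x).choose_spec
    ext z
    exact h₁
  · intro s m hm hm'
    obtain ⟨h, h₀, h₁⟩ := (exists_suspDesc (s.inl.hom.comp (coneMk A)) (s.inl (coneApex A))
      (s.inr PUnit.unit) (fun x => congrArg s.inl (coneMk_zero A x))
      fun x => congr_app s.condition x).choose_spec
    ext z
    refine susp_ind (fun r x => ?_) (fun b => ?_) z
    · refine Eq.trans ?_ (h r x).symm
      exact (congrArg m (q₁ r x).symm).trans (congr_app hm _)
    · cases b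
      · refine Eq.trans ?_ h₀.symm
        exact (congrArg m q₂.symm).trans (congr_app hm _)
      · refine Eq.trans ?_ h₁.symm
        exact congr_app hm' PUnit.unit

/-- The union of two contractible spaces along a subspace is the suspension of the subspace. -/
lemma htpyEquiv_suspension_of_isPushout {A X B P : TopCat.{u}} [ContractibleSpace X]
    [ContractibleSpace B] {i : A ⟶ X} {k : A ⟶ B} {x : X ⟶ P} {b : B ⟶ P}
    (sq : IsPushout i k x b) (hi : HasHEP i) : HtpyEquiv P (suspension A) := by
  obtain ⟨q, t, sqS⟩ := exists_isPushout_suspension A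
  have sqQ : IsPushout i (toPt A) (pushout.inl i (toPt A)) (pushout.inr i (toPt A)) :=
    IsPushout.of_hasPushout _ _
  have sqC : IsPushout i (coneBase A) (pushout.inl i (coneBase A)) (pushout.inr i (coneBase A)) :=
    IsPushout.of_hasPushout _ _
  -- both `P` and the suspension are compared with the union of `X` and the cone
  exact ((htpyEquiv_pushout_collapse sq sqQ hi).trans
    (htpyEquiv_pushout_collapse sqC sqQ hi).symm).trans
    (htpyEquiv_pushout_collapse sqC.flip sqS (hasHEP_coneBase A))
end HigherTits

namespace HigherTits
open Limits unitInterval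

/-! ### Gluing maps on the facets of a topological simplex -/

section Facets

variable {n : ℕ}

lemma map_succAbove_self (j : Fin (n + 1)) (s : stdSimplex ℝ (Fin n)) :
    stdSimplex.map j.succAbove s j = 0 := by
  rw [stdSimplex.map_coe, FunOnFinite.linearMap_apply_apply]
  exact Finset.sum_eq_zero fun i hi => absurd (Finset.mem_filter.1 hi).2 (Fin.succAbove_ne j i)

lemma map_succAbove_apply (j : Fin (n + 1)) (s : stdSimplex ℝ (Fin n)) (i : Fin n) :
    stdSimplex.map j.succAbove s (j.succAbove i) = s i := by
  rw [stdSimplex.map_coe, FunOnFinite.linearMap_apply_apply,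
    Finset.sum_eq_single_of_mem i (by simp)]
  intro b hb hbi
  exact absurd (Fin.succAbove_right_injective (Finset.mem_filter.1 hb).2) hbi

lemma map_succAbove_injective (j : Fin (n + 1)) :
    Function.Injective (stdSimplex.map j.succAbove : stdSimplex ℝ (Fin n) → _) := by
  intro s t h
  ext i
  rw [← map_succAbove_apply j s, h, map_succAbove_apply]

lemma range_map_succAbove (j : Fin (n + 1)) :
    Set.range (stdSimplex.map j.succAbove : stdSimplex ℝ (Fin n) → _) = {w | w j = 0} := by
  ext w
  constructor
  · rintro ⟨s, rfl⟩
    exact map_succAbove_self j s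
  · intro (hw : w j = 0)
    refine ⟨⟨fun i => w (j.succAbove i), fun i => w.2.1 _, ?_⟩, ?_⟩
    · have := stdSimplex.sum_eq_one w
      rwa [Fin.sum_univ_succAbove _ j, hw, zero_add] at this
    · ext i
      rcases Fin.eq_self_or_eq_succAbove j i with rfl | ⟨i, rfl⟩
      · rw [map_succAbove_self, hw]
      · rw [map_succAbove_apply]; rfl

lemma isClosedEmbedding_map_succAbove (j : Fin (n + 1)) :
    Topology.IsClosedEmbedding (stdSimplex.map j.succAbove : stdSimplex ℝ (Fin n) → _) :=
  (stdSimplex.continuous_map _).isClosedEmbedding (map_succAbove_injective j)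

/-- Continuous maps on some of the facets of a simplex that agree on the intersections of the facets
glue to a continuous map on the union of these facets. -/
lemma exists_glue {E : Type*} [TopologicalSpace E] (J : Set (Fin (n + 2))) (hJ : J.Nonempty)
    (g : Fin (n + 2) → C(stdSimplex ℝ (Fin (n + 1)), E))
    (hg : ∀ j ∈ J, ∀ k ∈ J, ∀ s t, stdSimplex.map j.succAbove s = stdSimplex.map k.succAbove t →
      g j s = g k t) :
    ∃ G : stdSimplex ℝ (Fin (n + 2)) → E, ContinuousOn G {w | ∃ j ∈ J, w j = 0} ∧
      ∀ j ∈ J, ∀ s, G (stdSimplex.map j.succAbove s) = g j s := by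
  classical
  have hE : Nonempty E := ⟨g hJ.some (Classical.arbitrary _)⟩
  let G : stdSimplex ℝ (Fin (n + 2)) → E := fun w =>
    if h : ∃ j ∈ J, ∃ s, stdSimplex.map j.succAbove s = w then g h.choose h.choose_spec.2.choose
    else Classical.arbitrary E
  have hG : ∀ j ∈ J, ∀ s, G (stdSimplex.map j.succAbove s) = g j s := by
    intro j hj s
    have h : ∃ k ∈ J, ∃ t, stdSimplex.map k.succAbove t =
      (stdSimplex.map j.succAbove s : stdSimplex ℝ (Fin (n + 2))) := ⟨j, hj, s, rfl⟩
    simp only [G, dif_pos h]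
    exact hg _ h.choose_spec.1 _ hj _ _ h.choose_spec.2.choose_spec
  refine ⟨G, ?_, hG⟩
  have : {w : stdSimplex ℝ (Fin (n + 2)) | ∃ j ∈ J, w j = 0} =
      ⋃ j : J, Set.range (stdSimplex.map j.1.succAbove : stdSimplex ℝ (Fin (n + 1)) → _) := by
    ext w
    simp only [range_map_succAbove, Set.mem_ofPred_eq, Set.mem_iUnion, Subtype.exists, exists_prop]
  rw [this]
  refine (locallyFinite_of_finite _).continuousOn_iUnion
    (fun j => (isClosedEmbedding_map_succAbove j.1).isClosed_range) fun j => ?_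
  rintro _ ⟨s, rfl⟩
  rw [ContinuousWithinAt, ← (isClosedEmbedding_map_succAbove j.1).isInducing.map_nhds_eq,
    Filter.tendsto_map'_iff, hG j.1 j.2, show G ∘ _ = g j.1 from funext fun s => hG j.1 j.2 s]
  exact (g j.1).continuous.tendsto s

end Facets

open Simplicial

/-! ### Lifting against singular simplicial sets -/

/-- The continuous map on the topological simplex that corresponds to a map from a standard simplex
to a singular simplicial set. -/
noncomputable def toMap {E : TopCat.{u}} {n : ℕ} (g : (Δ[n] : SSet.{u}) ⟶ TopCat.toSSet.obj E) :
    C(stdSimplex ℝ (Fin (n + 1)), E) :=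
  E.toSSetObjEquiv _ (SSet.yonedaEquiv g)

lemma toMap_injective {E : TopCat.{u}} {n : ℕ} :
    Function.Injective (toMap (E := E) (n := n)) :=
  (E.toSSetObjEquiv _).injective.comp SSet.yonedaEquiv.injective

lemma toMap_surjective {E : TopCat.{u}} {n : ℕ} :
    Function.Surjective (toMap (E := E) (n := n)) :=
  (E.toSSetObjEquiv _).surjective.comp SSet.yonedaEquiv.surjective

lemma toMap_comp {E B : TopCat.{u}} (p : E ⟶ B) {n : ℕ}
    (g : (Δ[n] : SSet.{u}) ⟶ TopCat.toSSet.obj E) (s) :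
    toMap (g ≫ TopCat.toSSet.map p) s = p (toMap g s) := rfl

lemma toMap_δ {E : TopCat.{u}} {n : ℕ} (j : Fin (n + 2))
    (g : (Δ[n + 1] : SSet.{u}) ⟶ TopCat.toSSet.obj E) (s) :
    toMap (SSet.stdSimplex.δ j ≫ g) s = toMap g (stdSimplex.map j.succAbove s) := by
  have : SSet.yonedaEquiv (SSet.stdSimplex.δ j ≫ g) =
      (TopCat.toSSet.obj E).δ j (SSet.yonedaEquiv g) := by
    exact SSet.stdSimplex.yonedaEquiv_δ_comp g j
  simp [toMap, this]

/-- A union of facets of a standard simplex lifts against the singular simplicial set of a map if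
this holds for the topological simplex. -/
lemma hasLiftingProperty_of_facets {E B : TopCat.{u}} (p : E ⟶ B) {n : ℕ} {S : SSet.{u}}
    (i : S ⟶ Δ[n + 1]) [Mono i] (J : Set (Fin (n + 2))) (hJ : J.Nonempty)
    (f : ∀ j ∈ J, Δ[n] ⟶ S) (hf : ∀ j hj, f j hj ≫ i = SSet.stdSimplex.δ j)
    (hS : ∀ {Z : SSet.{u}} (g g' : S ⟶ Z), (∀ j hj, f j hj ≫ g = f j hj ≫ g') → g = g')
    (h : ∀ (G : stdSimplex ℝ (Fin (n + 2)) → E) (v : C(stdSimplex ℝ (Fin (n + 2)), B)),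
      ContinuousOn G {w | ∃ j ∈ J, w j = 0} → (∀ w, (∃ j ∈ J, w j = 0) → p (G w) = v w) →
      ∃ H : C(stdSimplex ℝ (Fin (n + 2)), E), (∀ w, p (H w) = v w) ∧
        ∀ w, (∃ j ∈ J, w j = 0) → H w = G w) :
    HasLiftingProperty i (TopCat.toSSet.map p) := by
  classical
  refine ⟨fun {t b} sq => ?_⟩
  let g : Fin (n + 2) → C(stdSimplex ℝ (Fin (n + 1)), E) := fun j =>
    if hj : j ∈ J then toMap (f j hj ≫ t) else toMap (f _ hJ.some_mem ≫ t)
  have hgJ : ∀ j (hj : j ∈ J), g j = toMap (f j hj ≫ t) := fun j hj => dif_pos hj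
  -- by symmetry it suffices to compare two facets with `j < k`
  have key : ∀ j ∈ J, ∀ k ∈ J, j < k → ∀ s t, stdSimplex.map j.succAbove s =
      stdSimplex.map k.succAbove t → g j s = g k t := by
    intro j hj k hk hjk s s' hss
    rw [hgJ j hj, hgJ k hk]
    obtain _ | n := n
    · exfalso
      have h₁ := map_succAbove_self j s
      have h₂ := map_succAbove_self k s'
      rw [← hss] at h₂
      have h₃ := stdSimplex.add_eq_one (stdSimplex.map j.succAbove s)
      obtain rfl : j = 0 := by rw [Fin.lt_def] at hjk; ext; simp; omega
      obtain rfl : k = 1 := by rw [Fin.lt_def] at hjk; ext; simp at hjk ⊢; omega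
      rw [h₁, h₂] at h₃
      norm_num at h₃
    · obtain ⟨i', rfl⟩ : ∃ i' : Fin (n + 2), j = i'.castSucc :=
        ⟨⟨j, by omega⟩, rfl⟩
      obtain ⟨k', rfl⟩ : ∃ k' : Fin (n + 2), k = k'.succ :=
        ⟨⟨k - 1, by omega⟩, by ext; simp; have := Fin.lt_def.1 hjk; omega⟩
      have hik : i' ≤ k' := by
        rw [Fin.lt_def, Fin.val_castSucc, Fin.val_succ] at hjk
        rw [Fin.le_def]
        omega
      have hs : s k' = 0 := by
        rw [← map_succAbove_apply i'.castSucc s k', Fin.succAbove_of_le_castSucc _ _ (by simpa),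
          hss, map_succAbove_self]
      obtain ⟨r, rfl⟩ : ∃ r, stdSimplex.map k'.succAbove r = s := by
        change s ∈ Set.range (stdSimplex.map k'.succAbove)
        rw [range_map_succAbove]
        exact hs
      have hfac : i'.castSucc.succAbove ∘ k'.succAbove = k'.succ.succAbove ∘ i'.succAbove := by
        have := SimplexCategory.δ_comp_δ hik
        funext x
        exact (congrArg (fun φ => φ.toOrderHom x) this).symm
      obtain rfl : stdSimplex.map i'.succAbove r = s' := by
        apply map_succAbove_injective k'.succ
        rw [← hss, stdSimplex.map_comp_apply, stdSimplex.map_comp_apply]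
        exact congrArg (fun φ => stdSimplex.map φ r) hfac.symm
      rw [← toMap_δ, ← toMap_δ, ← Category.assoc, ← Category.assoc]
      congr 3
      rw [← cancel_mono i, Category.assoc, Category.assoc, hf, hf]
      exact SSet.stdSimplex.δ_comp_δ hik |>.symm
  obtain ⟨G, hG, hG'⟩ := exists_glue J hJ g fun j hj k hk s s' hss => by
    rcases lt_trichotomy j k with hjk | rfl | hjk
    · exact key j hj k hk hjk s s' hss
    · rw [map_succAbove_injective j hss]
    · exact (key k hk j hj hjk s' s hss.symm).symm
  obtain ⟨H, hH, hH'⟩ := h G (toMap b) hG fun w ⟨j, hj, hw⟩ => by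
    obtain ⟨s, rfl⟩ : w ∈ Set.range (stdSimplex.map (S := ℝ) j.succAbove) := by
      rw [range_map_succAbove]; exact hw
    rw [hG' j hj, hgJ j hj, ← toMap_comp, Category.assoc, sq.w, ← Category.assoc, hf, toMap_δ]
  obtain ⟨l, rfl⟩ := toMap_surjective H
  refine ⟨⟨⟨l, hS _ _ fun j hj => toMap_injective ?_, toMap_injective ?_⟩⟩⟩
  · ext s
    rw [← Category.assoc, hf, toMap_δ, hH' _ ⟨j, hj, map_succAbove_self j s⟩, hG' j hj, hgJ j hj]
  · ext s
    rw [toMap_comp, hH]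
end HigherTits

namespace HigherTits
open Limits unitInterval

/-! ### Retractions of prisms -/

/-- The retraction of `Δ × [0, 1]` onto `Δ × {0} ∪ ∂Δ × [0, 1]`, with components `R` and `S`. The
closed sets `A` and `B` contain the points that go to `∂Δ × [0, 1]` and to `Δ × {0}`. -/
lemma exists_boundary_retraction (n : ℕ) :
    ∃ (R : C(stdSimplex ℝ (Fin (n + 1)) × I, stdSimplex ℝ (Fin (n + 1))))
      (S : C(stdSimplex ℝ (Fin (n + 1)) × I, I)) (A B : Set (stdSimplex ℝ (Fin (n + 1)) × I)),
      IsClosed A ∧ IsClosed B ∧ A ∪ B = Set.univ ∧ (∀ z ∈ A, ∃ j, R z j = 0) ∧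
      (∀ z ∈ B, S z = 0) ∧ (∀ w, R (w, 0) = w ∧ S (w, 0) = 0) ∧
      ∀ w s, (∃ j, w j = 0) → R (w, s) = w ∧ S (w, s) = s ∧ (w, s) ∈ A := by
  let N : ℝ := n + 1
  have hN : 0 < N := by positivity
  -- the least barycentric coordinate
  let m : C(stdSimplex ℝ (Fin (n + 1)), ℝ) :=
    ⟨fun w => Finset.univ.inf' Finset.univ_nonempty fun j => w.1 j,
      Continuous.finset_inf'_apply _ fun j _ => (continuous_apply j).comp continuous_subtype_val⟩
  have hm : ∀ w j, m w ≤ w j := fun w j => Finset.inf'_le _ (Finset.mem_univ j)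
  have hm0 : ∀ w, 0 ≤ m w := fun w => Finset.le_inf' Finset.univ_nonempty _ fun j _ => w.2.1 j
  have hm1 : ∀ w, ∃ j, m w = w j := fun w => by
    obtain ⟨j, -, h⟩ := Finset.exists_mem_eq_inf' Finset.univ_nonempty fun j => w.1 j
    exact ⟨j, h⟩
  -- the amount that is subtracted from all the coordinates
  let μ : C(stdSimplex ℝ (Fin (n + 1)) × I, ℝ) := ⟨fun z => min (m z.1) (z.2 / (2 * N)), by fun_prop⟩
  have hμ0 : ∀ z, 0 ≤ μ z := fun z => le_min (hm0 _) (div_nonneg z.2.2.1 (by positivity))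
  have hμm : ∀ z, μ z ≤ m z.1 := fun z => min_le_left _ _
  have hμs : ∀ z, 2 * N * μ z ≤ z.2 := fun z => by
    have : μ z ≤ z.2 / (2 * N) := min_le_right _ _
    rwa [le_div_iff₀ (by positivity), mul_comm] at this
  have hpos : ∀ z, 0 < 1 - N * μ z := fun z => by
    have h₁ := hμs z
    have h₂ : (z.2 : ℝ) ≤ 1 := z.2.2.2
    nlinarith
  let R : C(stdSimplex ℝ (Fin (n + 1)) × I, stdSimplex ℝ (Fin (n + 1))) :=
    ⟨fun z => ⟨fun j => (z.1.1 j - μ z) / (1 - N * μ z), fun j =>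
        div_nonneg (sub_nonneg.2 ((hμm z).trans (hm z.1 j))) (hpos z).le, by
          rw [← Finset.sum_div, Finset.sum_sub_distrib, z.1.2.2, div_eq_one_iff_eq (hpos z).ne']
          simp [N]⟩,
      Continuous.subtype_mk (continuous_pi fun j => Continuous.div
        (((continuous_apply j).comp (continuous_subtype_val.comp continuous_fst)).sub μ.continuous)
        (by fun_prop) fun z => (hpos z).ne') _⟩
  have hR : ∀ z j, R z j = (z.1 j - μ z) / (1 - N * μ z) := fun z j => rfl
  let S : C(stdSimplex ℝ (Fin (n + 1)) × I, I) :=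
    ⟨fun z => Set.projIcc 0 1 zero_le_one (z.2 - 2 * N * μ z), continuous_projIcc.comp (by fun_prop)⟩
  have hid : ∀ z, μ z = 0 → R z = z.1 ∧ S z = z.2 := fun z hz => by
    constructor
    · ext j
      simp [hR, hz]
    · simp [S, hz]
  refine ⟨R, S, {z | 2 * N * m z.1 ≤ z.2}, {z | z.2 ≤ 2 * N * m z.1},
    isClosed_le (by fun_prop) (by fun_prop), isClosed_le (by fun_prop) (by fun_prop), ?_, ?_, ?_,
    fun w => ?_, ?_⟩
  · ext z
    simpa using le_total _ _
  · intro z (hz : 2 * N * m z.1 ≤ z.2)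
    obtain ⟨j, hj⟩ := hm1 z.1
    have : μ z = m z.1 := min_eq_left (by rwa [le_div_iff₀ (by positivity), mul_comm])
    exact ⟨j, by rw [hR, this, hj, sub_self, zero_div]⟩
  · intro z (hz : z.2 ≤ 2 * N * m z.1)
    have : μ z = z.2 / (2 * N) := min_eq_right (by rwa [div_le_iff₀ (by positivity), mul_comm])
    have h : 2 * N * μ z = z.2 := by rw [this]; field_simp
    simp [S, h]
  · exact hid (w, 0) (by simp [μ, hm0])
  · rintro w s ⟨j, hj⟩
    have h : m w = 0 := le_antisymm ((hm w j).trans hj.le) (hm0 w)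
    have := hid (w, s) (by
      simp only [μ, ContinuousMap.coe_mk, h]
      exact min_eq_left (div_nonneg s.2.1 (by positivity)))
    refine ⟨this.1, this.2, ?_⟩
    change 2 * N * m w ≤ s
    rw [h, mul_zero]
    exact s.2.1

/-- The retraction of `Δ × [0, 1]` onto `Δ × {0, 1} ∪ Λ × [0, 1]`, where `Λ` is the horn opposite to
the vertex `k`, with components `R` and `S`. The closed sets `A`, `B₀` and `B₁` contain the points
that go to `Λ × [0, 1]`, `Δ × {0}` and `Δ × {1}`. -/
lemma exists_horn_retraction (n : ℕ) (k : Fin (n + 2)) :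
    ∃ (R : C(stdSimplex ℝ (Fin (n + 2)) × I, stdSimplex ℝ (Fin (n + 2))))
      (S : C(stdSimplex ℝ (Fin (n + 2)) × I, I))
      (A B₀ B₁ : Set (stdSimplex ℝ (Fin (n + 2)) × I)),
      IsClosed A ∧ IsClosed B₀ ∧ IsClosed B₁ ∧ A ∪ (B₀ ∪ B₁) = Set.univ ∧
      (∀ z ∈ A, ∃ j ≠ k, R z j = 0) ∧ (∀ z ∈ B₀, S z = 0) ∧ (∀ z ∈ B₁, S z = 1) ∧
      (∀ w, (w, 0) ∈ B₀ ∧ R (w, 0) = w) ∧ (∀ w, (w, 1) ∈ B₁ ∧ R (w, 1) = w) ∧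
      (∃ s, ∀ w, (w, s) ∈ A) ∧
      ∀ w s, (∃ j ≠ k, w j = 0) → R (w, s) = w ∧ S (w, s) = s ∧ (w, s) ∈ A := by
  have hne : (Finset.univ.erase k).Nonempty := by
    rw [← Finset.card_pos, Finset.card_erase_of_mem (Finset.mem_univ _)]
    simp
  -- the least barycentric coordinate among those different from the `k`-th one
  let m : C(stdSimplex ℝ (Fin (n + 2)), ℝ) :=
    ⟨fun w => (Finset.univ.erase k).inf' hne fun j => w.1 j,
      Continuous.finset_inf'_apply _ fun j _ => (continuous_apply j).comp continuous_subtype_val⟩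
  have hm : ∀ w, ∀ j ≠ k, m w ≤ w j := fun w j hj => Finset.inf'_le _ (by simp [hj])
  have hm0 : ∀ w, 0 ≤ m w := fun w => Finset.le_inf' hne _ fun j _ => w.2.1 j
  have hm1 : ∀ w, ∃ j ≠ k, m w = w j := fun w => by
    obtain ⟨j, hj, h⟩ := Finset.exists_mem_eq_inf' hne fun j => w.1 j
    exact ⟨j, (Finset.mem_erase.1 hj).1, h⟩
  have hml : ∀ w, m w ≤ 1 := fun w => by
    obtain ⟨j, -, h⟩ := hm1 w
    exact h ▸ stdSimplex.le_one w j
  let τ : C(I, ℝ) := ⟨fun s => 2 * s - 1, by fun_prop⟩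
  have hτ : ∀ s, |τ s| ≤ 1 := fun s => abs_le.2 ⟨by have := s.2.1; simp only [τ, ContinuousMap.coe_mk]; linarith,
    by have := s.2.2; simp only [τ, ContinuousMap.coe_mk]; linarith⟩
  -- the amount that is moved from each of the other coordinates to the `k`-th one
  let μ : C(stdSimplex ℝ (Fin (n + 2)) × I, ℝ) :=
    ⟨fun z => min (m z.1) (2 * (1 - |τ z.2|)), by fun_prop⟩
  have hμ0 : ∀ z, 0 ≤ μ z := fun z => le_min (hm0 _) (by have := hτ z.2; linarith)
  have hμm : ∀ z, μ z ≤ m z.1 := fun z => min_le_left _ _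
  let R' : stdSimplex ℝ (Fin (n + 2)) × I → Fin (n + 2) → ℝ := fun z j =>
    z.1 j + if j = k then (n + 1) * μ z else - μ z
  have hR' : ∀ z, R' z ∈ stdSimplex ℝ (Fin (n + 2)) := by
    refine fun z => ⟨fun j => ?_, ?_⟩
    · by_cases hj : j = k
      · simp only [R', if_pos hj]
        exact add_nonneg (z.1.2.1 j) (mul_nonneg (by positivity) (hμ0 z))
      · simp only [R', if_neg hj]
        have := (hμm z).trans (hm z.1 j hj)
        linarith
    · simp only [R', Finset.sum_add_distrib, stdSimplex.sum_eq_one]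
      rw [Fin.sum_univ_succAbove _ k]
      simp [Fin.succAbove_ne]
  let R : C(stdSimplex ℝ (Fin (n + 2)) × I, stdSimplex ℝ (Fin (n + 2))) :=
    ⟨fun z => ⟨R' z, hR' z⟩, Continuous.subtype_mk (continuous_pi fun j =>
      ((continuous_apply j).comp (continuous_subtype_val.comp continuous_fst)).add
        (by split_ifs <;> fun_prop)) _⟩
  have hR : ∀ z j, R z j = z.1 j + if j = k then (n + 1) * μ z else - μ z := fun z j => rfl
  let ν : C(stdSimplex ℝ (Fin (n + 2)) × I, ℝ) := ⟨fun z => τ z.2 * (1 + m z.1), by fun_prop⟩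
  let S : C(stdSimplex ℝ (Fin (n + 2)) × I, I) :=
    ⟨fun z => Set.projIcc 0 1 zero_le_one ((1 + ν z) / 2), continuous_projIcc.comp (by fun_prop)⟩
  have hid : ∀ z, μ z = 0 → R z = z.1 := fun z hz => by
    ext j
    simp [hR, hz]
  refine ⟨R, S, {z | |ν z| ≤ 1}, {z | ν z ≤ -1}, {z | 1 ≤ ν z},
    isClosed_le (by fun_prop) (by fun_prop), isClosed_le (by fun_prop) (by fun_prop),
    isClosed_le (by fun_prop) (by fun_prop), ?_, ?_, ?_, ?_, fun w => ⟨?_, ?_⟩, fun w => ⟨?_, ?_⟩,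
    ⟨⟨1 / 2, by norm_num, by norm_num⟩, fun w => ?_⟩, ?_⟩
  · ext z
    simp only [Set.mem_union, Set.mem_ofPred_eq, Set.mem_univ, iff_true, abs_le]
    by_contra! h
    exact absurd (h.1 h.2.1.le) (not_lt.2 h.2.2.le)
  · intro z (hz : |ν z| ≤ 1)
    obtain ⟨j, hjk, hj⟩ := hm1 z.1
    have : μ z = m z.1 := by
      refine min_eq_left ?_
      have h₁ : |τ z.2| * (1 + m z.1) ≤ 1 := by
        rwa [← abs_of_nonneg (add_nonneg zero_le_one (hm0 z.1)), ← abs_mul]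
      have h₂ := hm0 z.1
      have h₃ := hml z.1
      rcases le_total |τ z.2| (1 / 2) with h | h <;> nlinarith
    exact ⟨j, hjk, by rw [hR, if_neg hjk, this, hj, add_neg_cancel]⟩
  · intro z (hz : ν z ≤ -1)
    exact Set.projIcc_of_le_left zero_le_one (by linarith)
  · intro z (hz : 1 ≤ ν z)
    exact Set.projIcc_of_right_le zero_le_one (by linarith)
  · have := hm0 w
    simp [ν, τ, this]
  · exact hid _ (by simp [μ, τ, hm0])
  · have := hm0 w
    simp [ν, τ]
    linarith
  · refine hid _ ?_
    have : |τ 1| = 1 := by simp [τ]; norm_num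
    simp [μ, this, hm0]
  · simp [ν, τ]
  · rintro w s ⟨j, hjk, hj⟩
    have h : m w = 0 := le_antisymm ((hm w j hjk).trans hj.le) (hm0 w)
    refine ⟨hid (w, s) ?_, ?_, ?_⟩
    · simp only [μ, ContinuousMap.coe_mk, h]
      exact min_eq_left (by have := hτ s; linarith)
    · have : (1 + ν (w, s)) / 2 = s := by simp [ν, h, τ]
      simp [S, this]
    · simpa [ν, h] using hτ s

lemma continuous_of_closed_cover {Z Y : Type*} [TopologicalSpace Z] [TopologicalSpace Y]
    {F : Z → Y} {A B : Set Z} (hA : IsClosed A) (hB : IsClosed B) (hAB : A ∪ B = Set.univ)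
    (hFA : ContinuousOn F A) (hFB : ContinuousOn F B) : Continuous F := by
  rw [← continuousOn_univ, ← hAB]
  exact hFA.union_of_isClosed hFB hA hB

/-- Evaluation of paths at the starting point. -/
def evalZero (Y : TopCat.{u}) : TopCat.of C(I, Y) ⟶ Y := TopCat.ofHom ⟨fun γ => γ 0, by fun_prop⟩

/-- Evaluation of paths at both end points. -/
def evalEnds (Y : TopCat.{u}) : TopCat.of C(I, Y) ⟶ TopCat.of (Y × Y) :=
  TopCat.ofHom ⟨fun γ => (γ 0, γ 1), by fun_prop⟩

lemma continuousOn_path_comp {Z W Y : Type*} [TopologicalSpace Z] [TopologicalSpace W]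
    [TopologicalSpace Y] {G : W → C(I, Y)} {K : Set W} (hG : ContinuousOn G K) {A : Set Z}
    (R : C(Z, W)) (S : C(Z, I)) (h : ∀ z ∈ A, R z ∈ K) :
    ContinuousOn (fun z => G (R z) (S z)) A :=
  continuous_eval.comp_continuousOn
    ((hG.comp R.continuous.continuousOn h).prodMk S.continuous.continuousOn)

/-- Paths that are given over the boundary of a simplex, and have prescribed starting points over the
whole simplex, extend to the simplex. -/
lemma geometric_lift_evalZero (Y : TopCat.{u}) {n : ℕ}
    (G : stdSimplex ℝ (Fin (n + 1)) → C(I, Y)) (v : C(stdSimplex ℝ (Fin (n + 1)), Y))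
    (hG : ContinuousOn G {w | ∃ j ∈ Set.univ, w j = 0})
    (hv : ∀ w, (∃ j ∈ Set.univ, w j = 0) → G w 0 = v w) :
    ∃ H : C(stdSimplex ℝ (Fin (n + 1)), C(I, Y)), (∀ w, H w 0 = v w) ∧
      ∀ w, (∃ j ∈ Set.univ, w j = 0) → H w = G w := by
  classical
  simp only [Set.mem_univ, true_and] at hG hv ⊢
  obtain ⟨R, S, A, B, hA, hB, hAB, hRA, hSB, h₀, hj⟩ := exists_boundary_retraction n
  let F : stdSimplex ℝ (Fin (n + 1)) × I → Y := fun z =>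
    if z ∈ A then G (R z) (S z) else v (R z)
  have hFA : ∀ z ∈ A, F z = G (R z) (S z) := fun z hz => if_pos hz
  have hFB : ∀ z ∈ B, F z = v (R z) := fun z hz => by
    by_cases h : z ∈ A
    · rw [hFA z h, hSB z hz, hv _ (hRA z h)]
    · exact if_neg h
  have hF : Continuous F := continuous_of_closed_cover hA hB hAB
    ((continuousOn_path_comp hG R S hRA).congr hFA)
    ((v.comp R).continuous.continuousOn.congr hFB)
  refine ⟨(ContinuousMap.mk F hF).curry, fun w => ?_, fun w hw => ?_⟩
  · change F (w, 0) = _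
    rcases (hAB.symm ▸ Set.mem_univ (w, 0) : (w, 0) ∈ A ∪ B) with h | h
    · have := hv _ (hRA _ h)
      rw [(h₀ w).1] at this
      rw [hFA _ h, (h₀ w).1, (h₀ w).2, this]
    · rw [hFB _ h, (h₀ w).1]
  · ext s
    change F (w, s) = _
    obtain ⟨h₁, h₂, h₃⟩ := hj w s hw
    rw [hFA _ h₃, h₁, h₂]

/-- Paths that are given over a horn, and have prescribed end points over the whole simplex, extend to
the simplex. -/
lemma geometric_lift_evalEnds (Y : TopCat.{u}) {n : ℕ} (k : Fin (n + 2))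
    (G : stdSimplex ℝ (Fin (n + 2)) → C(I, Y)) (v : C(stdSimplex ℝ (Fin (n + 2)), Y × Y))
    (hG : ContinuousOn G {w | ∃ j ∈ ({k}ᶜ : Set (Fin (n + 2))), w j = 0})
    (hv : ∀ w, (∃ j ∈ ({k}ᶜ : Set (Fin (n + 2))), w j = 0) → (G w 0, G w 1) = v w) :
    ∃ H : C(stdSimplex ℝ (Fin (n + 2)), C(I, Y)), (∀ w, (H w 0, H w 1) = v w) ∧
      ∀ w, (∃ j ∈ ({k}ᶜ : Set (Fin (n + 2))), w j = 0) → H w = G w := by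
  classical
  simp only [Set.mem_compl_iff, Set.mem_singleton_iff] at hG hv ⊢
  obtain ⟨R, S, A, B₀, B₁, hA, hB₀, hB₁, hAB, hRA, hSB₀, hSB₁, h₀, h₁, -, hj⟩ :=
    exists_horn_retraction n k
  let F : stdSimplex ℝ (Fin (n + 2)) × I → Y := fun z =>
    if z ∈ A then G (R z) (S z) else if z ∈ B₀ then (v (R z)).1 else (v (R z)).2
  have hFA : ∀ z ∈ A, F z = G (R z) (S z) := fun z hz => if_pos hz
  have hFB₀ : ∀ z ∈ B₀, F z = (v (R z)).1 := fun z hz => by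
    by_cases h : z ∈ A
    · rw [hFA z h, hSB₀ z hz, ← hv _ (hRA z h)]
    · simp only [F, if_neg h, if_pos hz]
  have hFB₁ : ∀ z ∈ B₁, F z = (v (R z)).2 := fun z hz => by
    by_cases h : z ∈ A
    · rw [hFA z h, hSB₁ z hz, ← hv _ (hRA z h)]
    · have h' : z ∉ B₀ := fun h' => by simpa [hSB₀ z h'] using hSB₁ z hz
      simp only [F, if_neg h, if_neg h']
  have hF : Continuous F := by
    refine continuous_of_closed_cover hA (hB₀.union hB₁) hAB
      ((continuousOn_path_comp hG R S hRA).congr hFA) (ContinuousOn.union_of_isClosed ?_ ?_ hB₀ hB₁)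
    · exact (continuous_fst.comp (v.comp R).continuous).continuousOn.congr hFB₀
    · exact (continuous_snd.comp (v.comp R).continuous).continuousOn.congr hFB₁
  refine ⟨(ContinuousMap.mk F hF).curry, fun w => ?_, fun w hw => ?_⟩
  · change (F (w, 0), F (w, 1)) = _
    rw [hFB₀ _ (h₀ w).1, (h₀ w).2, hFB₁ _ (h₁ w).1, (h₁ w).2]
  · ext s
    change F (w, s) = _
    obtain ⟨h₁, h₂, h₃⟩ := hj w s hw
    rw [hFA _ h₃, h₁, h₂]

/-- Continuous maps on a horn extend to the simplex. -/
lemma geometric_lift_toPt (Y : TopCat.{u}) {n : ℕ} (k : Fin (n + 2))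
    (G : stdSimplex ℝ (Fin (n + 2)) → Y)
    (hG : ContinuousOn G {w | ∃ j ∈ ({k}ᶜ : Set (Fin (n + 2))), w j = 0}) :
    ∃ H : C(stdSimplex ℝ (Fin (n + 2)), Y),
      ∀ w, (∃ j ∈ ({k}ᶜ : Set (Fin (n + 2))), w j = 0) → H w = G w := by
  simp only [Set.mem_compl_iff, Set.mem_singleton_iff] at hG ⊢
  obtain ⟨R, S, A, -, -, -, -, -, -, hRA, -, -, -, -, ⟨s, hs⟩, hj⟩ := exists_horn_retraction n k
  refine ⟨⟨fun w => G (R (w, s)), hG.comp_continuous (by fun_prop) fun w => hRA _ (hs w)⟩,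
    fun w hw => ?_⟩
  exact congrArg G (hj w s hw).1

open Simplicial

lemma hasLiftingProperty_boundary (Y : TopCat.{u}) (n : ℕ) :
    HasLiftingProperty ∂Δ[n].ι (TopCat.toSSet.map (evalZero Y)) := by
  obtain _ | n := n
  · refine ⟨fun {t b} sq => ?_⟩
    obtain ⟨l, hl⟩ := toMap_surjective (E := TopCat.of C(I, Y))
      (⟨fun w => .const _ (toMap b w), by fun_prop⟩ : C(stdSimplex ℝ (Fin 1), C(I, Y)))
    exact ⟨⟨l, SSet.boundary.hom_ext₀, toMap_injective (by ext s; rw [toMap_comp, hl]; rfl)⟩⟩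
  · exact hasLiftingProperty_of_facets (evalZero Y) _ Set.univ Set.univ_nonempty
      (fun j _ => SSet.boundary.ι j) (fun j _ => SSet.boundary.ι_ι j)
      (fun g g' h => SSet.boundary.hom_ext fun j => h j trivial)
      fun G v hG hv => geometric_lift_evalZero Y G v hG hv

/-- To lift a horn against the singular simplicial set of `p`, it suffices to solve the lifting problem
for the topological horn. -/
lemma hasLiftingProperty_horn {E B : TopCat.{u}} (p : E ⟶ B) {n : ℕ} (k : Fin (n + 2))
    (h : ∀ (G : stdSimplex ℝ (Fin (n + 2)) → E) (v : C(stdSimplex ℝ (Fin (n + 2)), B)),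
      ContinuousOn G {w | ∃ j ∈ ({k}ᶜ : Set (Fin (n + 2))), w j = 0} →
      (∀ w, (∃ j ∈ ({k}ᶜ : Set (Fin (n + 2))), w j = 0) → p (G w) = v w) →
      ∃ H : C(stdSimplex ℝ (Fin (n + 2)), E), (∀ w, p (H w) = v w) ∧
        ∀ w, (∃ j ∈ ({k}ᶜ : Set (Fin (n + 2))), w j = 0) → H w = G w) :
    HasLiftingProperty (Λ[n + 1, k]).ι (TopCat.toSSet.map p) := by
  obtain ⟨j, hj⟩ := exists_ne k
  exact hasLiftingProperty_of_facets p _ {k}ᶜ ⟨j, hj⟩ (fun j hj => SSet.horn.ι k j hj)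
    (fun j hj => SSet.horn.ι_ι k j hj)
    (fun g g' h => SSet.horn.hom_ext' fun j hj => h j hj) h

/-! ### Realizations of monomorphisms and of anodyne extensions -/

/-- The realization of a monomorphism of simplicial sets has the homotopy extension property: it has
the left lifting property with respect to the evaluation maps of path spaces. -/
lemma hasHEP_toTop {A B : SSet.{u}} (i : A ⟶ B) [Mono i] : HasHEP (SSet.toTop.map i) := by
  intro Y f h hf
  have h₁ : (MorphismProperty.monomorphisms SSet.{u}).rlp (TopCat.toSSet.map (evalZero Y)) := by
    rw [SSet.rlp_monomorphisms]
    intro _ _ j hj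
    obtain ⟨n⟩ := hj
    exact hasLiftingProperty_boundary _ n
  have h₂ : HasLiftingProperty (SSet.toTop.map i) (evalZero Y) :=
    (sSetTopAdj.hasLiftingProperty_iff i (evalZero Y)).2 (h₁ i (.infer_property i))
  have sq : CommSq (TopCat.ofHom h : _ ⟶ TopCat.of C(I, Y)) (SSet.toTop.map i) (evalZero Y)
    (TopCat.ofHom f) := ⟨by ext a; exact hf a⟩
  exact ⟨sq.lift.hom, fun x => congr_app sq.fac_right x, fun a => congr_app sq.fac_left a⟩

lemma hasLiftingProperty_toTop_of_anodyne {A B : SSet.{u}} {i : A ⟶ B}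
    (hi : SSet.anodyneExtensions i) {E Y : TopCat.{u}} (p : E ⟶ Y)
    (hp : ∀ (n : ℕ) (k : Fin (n + 2)), HasLiftingProperty (Λ[n + 1, k]).ι (TopCat.toSSet.map p)) :
    HasLiftingProperty (SSet.toTop.map i) p := by
  refine (sSetTopAdj.hasLiftingProperty_iff i p).2 (hi _ ?_)
  rw [SSet.modelCategoryQuillen.fibrations_eq]
  intro _ _ j hj
  simp only [SSet.modelCategoryQuillen.J, MorphismProperty.iSup_iff] at hj
  obtain ⟨n, ⟨k⟩⟩ := hj
  exact hp n k

/-- The realization of an anodyne extension is a homotopy equivalence: lifting against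
`|A| → pt` gives a retraction, and lifting against the evaluation of paths at both end points gives
a homotopy from the retraction to the identity. -/
lemma htpyEquiv_of_anodyne {A B : SSet.{u}} {i : A ⟶ B} (hi : SSet.anodyneExtensions i) :
    HtpyEquiv (SSet.toTop.obj A) (SSet.toTop.obj B) := by
  let j := SSet.toTop.map i
  have := hasLiftingProperty_toTop_of_anodyne hi (toPt (SSet.toTop.obj A)) fun n k =>
    hasLiftingProperty_horn _ k fun G v hG hv => by
      obtain ⟨H, hH⟩ := geometric_lift_toPt _ k G hG
      exact ⟨H, fun w => rfl, hH⟩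
  have := hasLiftingProperty_toTop_of_anodyne hi (evalEnds (SSet.toTop.obj B)) fun n k =>
    hasLiftingProperty_horn _ k fun G v hG hv => geometric_lift_evalEnds _ k G v hG hv
  have sq : CommSq (𝟙 (SSet.toTop.obj A)) j (toPt _) (toPt _) := ⟨rfl⟩
  let r := sq.lift
  have hr : ∀ a, r (j a) = a := fun a => congr_app sq.fac_left a
  have sq' : CommSq
    (TopCat.ofHom ⟨fun a => .const I (j a), by fun_prop⟩ : _ ⟶ TopCat.of C(I, SSet.toTop.obj B)) j
    (evalEnds _) (TopCat.ofHom ⟨fun b => (b, j (r b)), by fun_prop⟩) := ⟨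
      TopCat.hom_ext (ContinuousMap.ext fun a =>
        congrArg (fun x => (j a, j x)) (hr a).symm)⟩
  have hl : ∀ b, (sq'.lift b 0, sq'.lift b 1) = (b, j (r b)) := fun b => congr_app sq'.fac_right b
  exact (htpyEquiv_of_pathFamilies r.hom j.hom sq'.lift.hom (fun b => congrArg Prod.fst (hl b))
    (fun b => congrArg Prod.snd (hl b)) (ContinuousMap.mk (fun a => .const I a) (by fun_prop))
    (fun a => rfl) fun a => (hr a).symm).symm
end HigherTits

namespace HigherTits
open Limits unitInterval Simplicial

/-! ### Ordered simplicial complexes -/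

section OrderedComplex

variable {V : Type u} [PartialOrder V] {K L : PreAbstractSimplicialComplex V}

/-- The set of vertices of a simplex of an ordered simplicial complex. -/
noncomputable def vertexSet {n : SimplexCategoryᵒᵖ} (x : (orderedSSet K).obj n) : Finset V :=
  (Set.finite_range x.1).toFinset

lemma mem_vertexSet {n : SimplexCategoryᵒᵖ} {x : (orderedSSet K).obj n} {y : V} :
    y ∈ vertexSet x ↔ ∃ i, x.1 i = y := by
  simp [vertexSet]

lemma vertexSet_map_subset {n m : SimplexCategoryᵒᵖ} (f : n ⟶ m) (x : (orderedSSet K).obj n) :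
    vertexSet ((orderedSSet K).map f x) ⊆ vertexSet x := by
  intro y hy
  obtain ⟨i, rfl⟩ := mem_vertexSet.1 hy
  exact mem_vertexSet.2 ⟨f.unop.toOrderHom i, rfl⟩

lemma vertexSet_nonempty {n : SimplexCategoryᵒᵖ} (x : (orderedSSet K).obj n) :
    (vertexSet x).Nonempty :=
  ⟨x.1 0, mem_vertexSet.2 ⟨0, rfl⟩⟩

omit [PartialOrder V] in
lemma mem_of_subset {s t : Finset V} (hs : s ∈ K) (hts : t ⊆ s) (ht : t.Nonempty) : t ∈ K :=
  (K.isRelLowerSet_faces hs).2 hts ht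

variable (K L) in
/-- The simplices of `orderedSSet K` whose vertices span a simplex of `L`. -/
def subOrdered : (orderedSSet K).Subcomplex where
  obj _ := {x | vertexSet x ∈ L}
  map f x hx := mem_of_subset hx (vertexSet_map_subset f x) (vertexSet_nonempty _)

/-- The inclusion of a subcomplex. -/
def inclOrdered (h : L ≤ K) : orderedSSet L ⟶ orderedSSet K where
  app n := ↾fun x => ⟨x.1, h x.2⟩

instance (h : L ≤ K) : Mono (inclOrdered h) := by
  rw [NatTrans.mono_iff_mono_app]
  intro n
  rw [mono_iff_injective]
  intro x y hxy
  exact Subtype.ext (congrArg Subtype.val hxy :)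

/-- The subcomplex of `orderedSSet K` determined by `L ≤ K` is `orderedSSet L`. -/
def subOrderedIso (h : L ≤ K) : (subOrdered K L : SSet) ≅ orderedSSet L where
  hom := { app n := ↾fun x => ⟨x.1.1, x.2⟩ }
  inv := { app n := ↾fun x => ⟨⟨x.1, h x.2⟩, x.2⟩ }

variable (K) in
/-- The map to the nerve of the poset of vertices. -/
def toNerve : orderedSSet K ⟶ nerve V where
  app n := ↾fun x => x.1.monotone.functor

instance : Mono (toNerve K) := by
  rw [NatTrans.mono_iff_mono_app]
  intro n
  rw [mono_iff_injective]
  intro x y hxy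
  exact Subtype.ext (OrderHom.ext _ _ (funext fun i => Functor.congr_obj hxy i))

instance : (orderedSSet K).Nonsingular := .of_mono (toNerve K)

lemma mem_nonDegenerate_iff_strictMono {n : ℕ} (x : (orderedSSet K) _⦋n⦌) :
    x ∈ (orderedSSet K).nonDegenerate n ↔ StrictMono x.1 := by
  rw [← SSet.nonDegenerate_iff_of_mono (toNerve K),
    PartialOrder.mem_nerve_nonDegenerate_iff_strictMono]
  rfl

lemma card_vertexSet {n : ℕ} {x : (orderedSSet K) _⦋n⦌}
    (hx : x ∈ (orderedSSet K).nonDegenerate n) : (vertexSet x).card = n + 1 := by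
  classical
  have : vertexSet x = Finset.univ.image x.1 := by
    ext y
    simp [mem_vertexSet]
  rw [this, Finset.card_image_of_injective _
    ((mem_nonDegenerate_iff_strictMono x).1 hx).injective]
  simp

lemma sMk_eq_of_vertexSet_eq {n m : ℕ} {x : (orderedSSet K) _⦋n⦌} {y : (orderedSSet K) _⦋m⦌}
    (hx : x ∈ (orderedSSet K).nonDegenerate n) (hy : y ∈ (orderedSSet K).nonDegenerate m)
    (h : vertexSet x = vertexSet y) : SSet.S.mk x = SSet.S.mk y := by
  obtain rfl : n = m := by
    have := congrArg Finset.card h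
    rwa [card_vertexSet hx, card_vertexSet hy, add_left_inj] at this
  congr 1
  refine Subtype.ext (OrderHom.ext _ _ ?_)
  rw [mem_nonDegenerate_iff_strictMono] at hx hy
  rw [← StrictMono.range_inj hx hy]
  ext v
  simpa [mem_vertexSet] using congrArg (v ∈ ·) h

lemma vertexSet_eq_of_sMk_eq {n m : ℕ} {x : (orderedSSet K) _⦋n⦌} {y : (orderedSSet K) _⦋m⦌}
    (h : SSet.S.mk x = SSet.S.mk y) : vertexSet x = vertexSet y :=
  congrArg (fun s : (orderedSSet K).S => vertexSet s.simplex) h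

lemma exists_nonDegenerate {s : Finset V} (hs : s ∈ K) (hc : IsChain (· ≤ ·) (s : Set V)) {n : ℕ}
    (hn : s.card = n + 1) :
    ∃ x : (orderedSSet K) _⦋n⦌, x ∈ (orderedSSet K).nonDegenerate n ∧ vertexSet x = s := by
  classical
  let _ := hc.linearOrder
  have hcard : Fintype.card (s : Set V) = n + 1 := by simpa using hn
  let e := Fintype.orderIsoFinOfCardEq (s : Set V) hcard
  let x : Fin (n + 1) →o V := ⟨fun i => (e i).1, fun i j hij => e.monotone hij⟩
  have hx : (Set.finite_range x).toFinset = s := by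
    ext y
    simp only [Set.Finite.mem_toFinset, Set.mem_range]
    constructor
    · rintro ⟨i, rfl⟩
      exact (e i).2
    · intro hy
      exact ⟨e.symm ⟨y, hy⟩, congrArg Subtype.val (e.apply_symm_apply _)⟩
  exact ⟨⟨x, hx ▸ hs⟩, (mem_nonDegenerate_iff_strictMono (K := K) _).2
    fun i j hij => e.strictMono hij, hx⟩

lemma vertexSet_δ [DecidableEq V] {n : ℕ} {x : (orderedSSet K) _⦋n + 1⦌}
    (hx : x ∈ (orderedSSet K).nonDegenerate (n + 1)) (i : Fin (n + 2)) :
    vertexSet ((orderedSSet K).δ i x) = (vertexSet x).erase (x.1 i) := by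
  have hinj := ((mem_nonDegenerate_iff_strictMono x).1 hx).injective
  have hδ : ∀ j, ((orderedSSet K).δ i x).1 j = x.1 (i.succAbove j) := fun j => rfl
  ext y
  rw [Finset.mem_erase, mem_vertexSet, mem_vertexSet]
  constructor
  · rintro ⟨j, rfl⟩
    exact ⟨fun h => Fin.succAbove_ne i j (hinj h), _, rfl⟩
  · rintro ⟨hy, j, rfl⟩
    obtain ⟨k, rfl⟩ := Fin.exists_succAbove_eq fun h : j = i => hy (h ▸ rfl)
    exact ⟨k, rfl⟩

/-! ### Discrete Morse matchings -/

/-- A matching without critical simplices of the simplices of `K` outside `L`, by adding or removing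
the vertex `e s`. It is acyclic because of the function `rank`. -/
structure Matching [DecidableEq V] (L K : PreAbstractSimplicialComplex V) (α : Type*)
    [PartialOrder α] where
  le : L ≤ K
  isChain : ∀ s ∈ K, IsChain (· ≤ ·) (s : Set V)
  /-- the vertex that is added or removed -/
  e : Finset V → V
  insert_mem : ∀ s ∈ K, s ∉ L → e s ∉ s → insert (e s) s ∈ K
  e_insert : ∀ s ∈ K, s ∉ L → e s ∉ s → e (insert (e s) s) = e s
  erase_nonempty : ∀ s ∈ K, s ∉ L → e s ∈ s → (s.erase (e s)).Nonempty
  erase_notMem : ∀ s ∈ K, s ∉ L → e s ∈ s → s.erase (e s) ∉ L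
  e_erase : ∀ s ∈ K, s ∉ L → e s ∈ s → e (s.erase (e s)) = e s
  /-- the rank function -/
  rank : Finset V → α
  rank_lt : ∀ s ∈ K, s ∉ L → e s ∉ s → ∀ t ∈ K, t ∉ L → e t ∉ t → s ≠ t → s.card = t.card →
    s ⊆ insert (e t) t → rank s < rank t

namespace Matching

variable [DecidableEq V] {α : Type*} [PartialOrder α] (m : Matching L K α)

/-- The simplices to which a vertex is added. -/
def Index : Type u := {s : Finset V // s ∈ K ∧ s ∉ L ∧ m.e s ∉ s}

variable {m} in
lemma Index.card (s : m.Index) : s.1.card = s.1.card - 1 + 1 :=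
  (Nat.sub_add_cancel (Finset.card_pos.2 (K.isRelLowerSet_faces s.2.1).1)).symm

variable {m} in
lemma Index.exists_simplex (s : m.Index) : ∃ x : (orderedSSet K) _⦋s.1.card - 1 + 1⦌,
    x ∈ (orderedSSet K).nonDegenerate _ ∧ vertexSet x = insert (m.e s.1) s.1 := by
  have h := m.insert_mem s.1 s.2.1 s.2.2.1 s.2.2.2
  exact exists_nonDegenerate h (m.isChain _ h)
    (by rw [Finset.card_insert_of_notMem s.2.2.2, ← s.card])

variable {m} in
/-- The simplex that is obtained from `s` by adding a vertex. -/
noncomputable def Index.simplex (s : m.Index) : (orderedSSet K) _⦋s.1.card - 1 + 1⦌ :=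
  s.exists_simplex.choose

variable {m} in
lemma Index.nonDegenerate_simplex (s : m.Index) :
    s.simplex ∈ (orderedSSet K).nonDegenerate _ :=
  s.exists_simplex.choose_spec.1

variable {m} in
lemma Index.vertexSet_simplex (s : m.Index) : vertexSet s.simplex = insert (m.e s.1) s.1 :=
  s.exists_simplex.choose_spec.2

variable {m} in
lemma Index.exists_index (s : m.Index) : ∃ i, s.simplex.1 i = m.e s.1 :=
  mem_vertexSet.1 (s.vertexSet_simplex ▸ Finset.mem_insert_self _ _)

variable {m} in
/-- The position of the vertex that is added. -/
noncomputable def Index.index (s : m.Index) : Fin (s.1.card - 1 + 2) :=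
  s.exists_index.choose

variable {m} in
lemma Index.vertexSet_δ (s : m.Index) :
    vertexSet ((orderedSSet K).δ s.index s.simplex) = s.1 := by
  rw [HigherTits.vertexSet_δ s.nonDegenerate_simplex, s.vertexSet_simplex,
    show s.simplex.1 s.index = m.e s.1 from s.exists_index.choose_spec,
    Finset.erase_insert s.2.2.2]

/-- The pairing of the nondegenerate simplices outside `L` that is given by a matching. -/
noncomputable def pairingCore : (subOrdered K L).PairingCore where
  ι := m.Index
  dim s := s.1.card - 1
  simplex s := s.simplex
  index s := s.index
  nonDegenerate₁ s := s.nonDegenerate_simplex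
  nonDegenerate₂ s := SSet.nonDegenerate_δ s.nonDegenerate_simplex _
  notMem₁ s h := by
    change vertexSet s.simplex ∈ L at h
    rw [s.vertexSet_simplex] at h
    exact s.2.2.1 (mem_of_subset h (Finset.subset_insert _ _) (K.isRelLowerSet_faces s.2.1).1)
  notMem₂ s h := by
    change vertexSet _ ∈ L at h
    rw [s.vertexSet_δ] at h
    exact s.2.2.1 h
  injective_type₁' {s t} h := by
    have h := vertexSet_eq_of_sMk_eq h
    rw [s.vertexSet_simplex, t.vertexSet_simplex] at h
    have he := congrArg m.e h
    rw [m.e_insert _ s.2.1 s.2.2.1 s.2.2.2, m.e_insert _ t.2.1 t.2.2.1 t.2.2.2] at he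
    have := congrArg (Finset.erase · (m.e s.1)) h
    simp only [Finset.erase_insert s.2.2.2] at this
    rw [he, Finset.erase_insert t.2.2.2] at this
    exact Subtype.ext this
  injective_type₂' {s t} h := by
    have h := vertexSet_eq_of_sMk_eq h
    rw [s.vertexSet_δ, t.vertexSet_δ] at h
    exact Subtype.ext h
  type₁_ne_type₂' s t h := by
    have h := vertexSet_eq_of_sMk_eq h
    rw [s.vertexSet_simplex, t.vertexSet_δ] at h
    have he := congrArg m.e h
    rw [m.e_insert _ s.2.1 s.2.2.1 s.2.2.2] at he
    exact t.2.2.2 (he ▸ h ▸ Finset.mem_insert_self _ _)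
  surjective' x := by
    have hK : vertexSet x.simplex ∈ K := x.simplex.2
    have hL : vertexSet x.simplex ∉ L := x.notMem
    have hx : x.toS = SSet.S.mk x.simplex := rfl
    rw [hx]
    by_cases h : m.e (vertexSet x.simplex) ∈ vertexSet x.simplex
    · have he := m.e_erase _ hK hL h
      let s : m.Index := ⟨(vertexSet x.simplex).erase (m.e (vertexSet x.simplex)),
        mem_of_subset hK (Finset.erase_subset _ _) (m.erase_nonempty _ hK hL h),
        m.erase_notMem _ hK hL h, he.symm ▸ Finset.notMem_erase _ _⟩
      have hs : vertexSet s.simplex = vertexSet x.simplex :=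
        s.vertexSet_simplex.trans
          ((congrArg (insert · s.1) he).trans (Finset.insert_erase h))
      exact ⟨s, Or.inl (sMk_eq_of_vertexSet_eq x.nonDegenerate s.nonDegenerate_simplex hs.symm)⟩
    · let s : m.Index := ⟨vertexSet x.simplex, hK, hL, h⟩
      exact ⟨s, Or.inr (sMk_eq_of_vertexSet_eq x.nonDegenerate
        (SSet.nonDegenerate_δ s.nonDegenerate_simplex _) s.vertexSet_δ.symm)⟩

/-- The matched pairs can be attached in the order of their ranks, each one by filling a horn: a facet
of the larger simplex of a pair that is the smaller simplex of another pair has lower rank. -/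
lemma anodyneExtensions (m : Matching L K α) [WellFoundedLT α] :
    SSet.anodyneExtensions (subOrdered K L).ι := by
  let f : m.pairingCore.WeakRankFunction α :=
    { rank := fun s => m.rank s.1
      lt := by
        intro s t h hd
        refine m.rank_lt _ s.2.1 s.2.2.1 s.2.2.2 _ t.2.1 t.2.2.1 t.2.2.2
          (fun h' => h.1 (Subtype.ext h')) ?_ ?_
        · rw [Index.card s, Index.card t]
          exact congrArg (· + 1) hd
        · obtain ⟨φ, hφ⟩ := SSet.S.le_iff.1 h.2.le
          rw [← Index.vertexSet_δ s, ← Index.vertexSet_simplex t]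
          exact (congrArg vertexSet hφ).symm.subset.trans (vertexSet_map_subset φ.op _) }
  have := f.isRegular
  exact m.pairingCore.pairing.anodyneExtensions

/-- The subcomplex of an acyclic matching is homotopy equivalent to the whole complex. -/
theorem htpyEquiv (m : Matching L K α) [WellFoundedLT α] :
    HtpyEquiv (SSet.toTop.obj (orderedSSet L)) (SSet.toTop.obj (orderedSSet K)) :=
  (HtpyEquiv.of_iso (SSet.toTop.mapIso (subOrderedIso m.le).symm)).trans
    (htpyEquiv_of_anodyne m.anodyneExtensions)

end Matching

end OrderedComplex
end HigherTits

namespace HigherTits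
open Limits unitInterval Simplicial

/-! ### Unions, quotients and cones of ordered complexes -/

section OrderedComplex

variable {V : Type u} [PartialOrder V] {K L : PreAbstractSimplicialComplex V}

/-- The realization of an ordered simplicial complex. -/
noncomputable abbrev realize (K : PreAbstractSimplicialComplex V) : TopCat.{u} :=
  SSet.toTop.obj (orderedSSet K)

lemma isPushout_sup (K L : PreAbstractSimplicialComplex V) :
    IsPushout (inclOrdered (inf_le_left : K ⊓ L ≤ K)) (inclOrdered (inf_le_right : K ⊓ L ≤ L))
      (inclOrdered (le_sup_left : K ≤ K ⊔ L)) (inclOrdered (le_sup_right : L ≤ K ⊔ L)) := by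
  have sq : SSet.Subcomplex.BicartSq (subOrdered (K ⊔ L) (K ⊓ L)) (subOrdered (K ⊔ L) K)
      (subOrdered (K ⊔ L) L) (subOrdered (K ⊔ L) (K ⊔ L)) :=
    { sup_eq := by ext n x; rfl
      inf_eq := by ext n x; rfl }
  exact sq.isPushout.of_iso (subOrderedIso (inf_le_left.trans le_sup_left))
    (subOrderedIso le_sup_left) (subOrderedIso le_sup_right) (subOrderedIso le_rfl)
    rfl rfl rfl rfl

/-- If `K` and `L` are contractible, then `K ∪ L` is the suspension of `K ∩ L`. -/
lemma htpyEquiv_suspension_of_sup (K L : PreAbstractSimplicialComplex V)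
    [ContractibleSpace (realize K)] [ContractibleSpace (realize L)] :
    HtpyEquiv (realize (K ⊔ L)) (suspension (realize (K ⊓ L))) :=
  htpyEquiv_suspension_of_isPushout ((isPushout_sup K L).map SSet.toTop) (hasHEP_toTop _)

/-- If `L` and `K ∪ L` are contractible, then the suspensions of `K` and of `K ∩ L` are equivalent:
the former is `(K ∪ L) / K = L / (K ∩ L)`. -/
lemma htpyEquiv_suspension_inf (K L : PreAbstractSimplicialComplex V)
    [ContractibleSpace (realize (K ⊔ L))] [ContractibleSpace (realize L)] :
    HtpyEquiv (suspension (realize K)) (suspension (realize (K ⊓ L))) := by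
  let i := SSet.toTop.map (inclOrdered (le_sup_left : K ≤ K ⊔ L))
  have sq : IsPushout i (toPt _) (pushout.inl i (toPt _)) (pushout.inr i (toPt _)) :=
    IsPushout.of_hasPushout _ _
  have sq' := (((isPushout_sup K L).map SSet.toTop).paste_horiz sq.flip).flip
  exact (htpyEquiv_suspension_of_isPushout sq (hasHEP_toTop _)).symm.trans
    (htpyEquiv_suspension_of_isPushout sq' (hasHEP_toTop _))

/-- The complex that consists of the single vertex `v`. -/
def singleVertex (v : V) : PreAbstractSimplicialComplex V where
  faces := {{v}}
  isRelLowerSet_faces := by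
    rintro _ rfl
    exact ⟨Finset.singleton_nonempty v, fun t ht hne => (Finset.subset_singleton_iff.1 ht).resolve_left
      hne.ne_empty⟩

omit [PartialOrder V] in
lemma mem_singleVertex {v : V} {s : Finset V} : s ∈ singleVertex v ↔ s = {v} := Iff.rfl

instance (v : V) : ContractibleSpace (realize (singleVertex v)) := by
  have h : ∀ n, ∀ x : (orderedSSet (singleVertex v)).obj n, ∀ i, x.1 i = v := fun n x i => by
    have h₁ : vertexSet x = {v} := x.2
    have h₂ : x.1 i ∈ vertexSet x := mem_vertexSet.2 ⟨i, rfl⟩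
    simpa [h₁] using h₂
  let t : IsTerminal (orderedSSet (singleVertex v)) := IsTerminal.ofUniqueHom
    (fun Y => { app := fun n => ↾fun _ => ⟨OrderHom.const _ v, by
        rw [mem_singleVertex]; ext y; simp [eq_comm]⟩ })
    fun Y f => by
      ext n y
      exact Subtype.ext (OrderHom.ext _ _ (funext fun i => h _ _ i))
  let e := SSet.stdSimplex.isTerminalObj₀.uniqueUpToIso t
  exact (HtpyEquiv.of_iso (SSet.toTop.mapIso e).symm).contractibleSpace

/-- Cones are contractible. -/
lemma contractibleSpace_of_cone [DecidableEq V] (v : V) (hv : {v} ∈ K)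
    (h : ∀ s ∈ K, insert v s ∈ K) (hc : ∀ s ∈ K, IsChain (· ≤ ·) (s : Set V)) :
    ContractibleSpace (realize K) := by
  let m : Matching (singleVertex v) K ℕ :=
    { le := by rintro _ rfl; exact hv
      isChain := hc
      e := fun _ => v
      insert_mem := fun s hs _ _ => h s hs
      e_insert := fun _ _ _ _ => rfl
      erase_nonempty := fun s hs hs' hvs => by
        rw [Finset.nonempty_iff_ne_empty, ne_eq, Finset.erase_eq_empty_iff]
        rintro (rfl | rfl)
        · simp at hvs
        · exact hs' rfl
      erase_notMem := fun s _ _ _ h => by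
        have := Finset.notMem_erase v s
        rw [mem_singleVertex.1 h] at this
        simp at this
      e_erase := fun _ _ _ _ => rfl
      rank := fun _ => 0
      rank_lt := fun s _ _ hvs t _ _ _ hne hcard hst =>
        (hne (Finset.eq_of_subset_of_card_le ((Finset.subset_insert_iff_of_notMem hvs).1 hst)
          hcard.ge)).elim }
  exact m.htpyEquiv.symm.contractibleSpace

end OrderedComplex
end HigherTits

namespace HigherTits
open Limits unitInterval Simplicial

section Product

variable {ι : Type} {P : ι → Type u} [∀ i, PartialOrder (P i)] [∀ i, BoundedOrder (P i)]

lemma complex_ext {V : Type u} {K L : PreAbstractSimplicialComplex V} (h : ∀ s, s ∈ K ↔ s ∈ L) :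
    K = L := SetLike.ext h

/-! ### Complexes of chains in a product of bounded posets -/

/-- A complex of chains in a product of bounded posets that is closed under inserting a comparable
element all of whose coordinates are extreme or are coordinates of members of the chain. -/
structure IsAdmissible [DecidableEq (∀ i, P i)] (K : PreAbstractSimplicialComplex (∀ i, P i)) : Prop where
  isChain : ∀ s ∈ K, IsChain (· ≤ ·) (s : Set (∀ i, P i))
  insert_mem : ∀ s : Finset (∀ i, P i), s = ∅ ∨ s ∈ K → ∀ e, (∀ y ∈ s, y ≤ e ∨ e ≤ y) →
    (∀ i, e i = ⊥ ∨ e i = ⊤ ∨ ∃ y ∈ s, e i = y i) → insert e s ∈ K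

variable [LinearOrder ι]

variable (P) in
/-- The element with coordinates `⊤` up to `q`, inclusively, and `⊥` after `q`. -/
def corner (q : ι) : ∀ i, P i := fun i => if i ≤ q then ⊤ else ⊥

lemma corner_of_le {i q : ι} (h : i ≤ q) : corner P q i = ⊤ := if_pos h

lemma corner_of_lt {i q : ι} (h : q < i) : corner P q i = ⊥ := if_neg (not_le.2 h)

lemma corner_mono {p q : ι} (h : p ≤ q) : corner P p ≤ corner P q := fun i => by
  rcases le_or_gt i p with hi | hi
  · rw [corner_of_le hi, corner_of_le (hi.trans h)]
  · rw [corner_of_lt hi]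
    exact bot_le

lemma corner_ne_bot [∀ i, Nontrivial (P i)] (q : ι) : corner P q ≠ ⊥ := fun h => by
  have := congrFun h q
  rw [corner_of_le le_rfl] at this
  exact top_ne_bot this

lemma corner_injective [∀ i, Nontrivial (P i)] : Function.Injective (corner P) := by
  have key : ∀ p q : ι, p < q → corner P p ≠ corner P q := fun p q h heq => by
    have := congrFun heq q
    rw [corner_of_le le_rfl, corner_of_lt h] at this
    exact bot_ne_top this
  intro p q h
  rcases lt_trichotomy p q with hpq | hpq | hpq
  · exact (key p q hpq h).elim
  · exact hpq
  · exact (key q p hpq h.symm).elim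

variable [Fintype ι] [DecidableEq (∀ i, P i)]

variable (P) in
/-- The extreme elements that are `⊤` on an initial segment and `⊥` on the complement. They form a
maximal chain of extreme elements. -/
def corners : Finset (∀ i, P i) := insert ⊥ (Finset.univ.image (corner P))

lemma mem_corners {x : ∀ i, P i} : x ∈ corners P ↔ x = ⊥ ∨ ∃ q, corner P q = x := by
  simp [corners]

lemma card_corners [∀ i, Nontrivial (P i)] : (corners P).card = Fintype.card ι + 1 := by
  rw [corners, Finset.card_insert_of_notMem, Finset.card_image_of_injective _ corner_injective,
    Finset.card_univ]
  simp only [Finset.mem_image, Finset.mem_univ, true_and, not_exists]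
  exact corner_ne_bot

lemma bot_mem_corners : (⊥ : ∀ i, P i) ∈ corners P := Finset.mem_insert_self _ _

lemma top_mem_corners : (⊤ : ∀ i, P i) ∈ corners P := by
  rw [mem_corners]
  rcases isEmpty_or_nonempty ι with h | h
  · exact Or.inl (funext fun i => h.elim i)
  · exact Or.inr ⟨Finset.univ.max' Finset.univ_nonempty, funext fun i =>
      corner_of_le (Finset.le_max' _ _ (Finset.mem_univ i))⟩

lemma corners_comparable {x y : ∀ i, P i} (hx : x ∈ corners P) (hy : y ∈ corners P) :
    x ≤ y ∨ y ≤ x := by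
  rcases mem_corners.1 hx with rfl | ⟨p, rfl⟩
  · exact Or.inl bot_le
  rcases mem_corners.1 hy with rfl | ⟨q, rfl⟩
  · exact Or.inr bot_le
  · exact (le_total p q).imp corner_mono corner_mono

lemma corners_extreme {x : ∀ i, P i} (hx : x ∈ corners P) (i : ι) : x i = ⊥ ∨ x i = ⊤ := by
  rcases mem_corners.1 hx with rfl | ⟨q, rfl⟩
  · exact Or.inl rfl
  · exact (lt_or_ge q i).imp corner_of_lt corner_of_le

/-- The chains that do not contain all the elements of `S`. -/
def notContaining (K : PreAbstractSimplicialComplex (∀ i, P i)) (S : Finset (∀ i, P i)) :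
    PreAbstractSimplicialComplex (∀ i, P i) where
  faces := {s | s ∈ K ∧ ¬ S ⊆ s}
  isRelLowerSet_faces := fun _ hs => ⟨(K.isRelLowerSet_faces hs.1).1, fun _ hts ht =>
    ⟨mem_of_subset hs.1 hts ht, fun h => hs.2 (h.trans hts)⟩⟩

/-- The chains whose union with the set of corners is in `K`, and that contain only corners that are
elements of `S`. -/
def star (K : PreAbstractSimplicialComplex (∀ i, P i)) (S : Finset (∀ i, P i)) :
    PreAbstractSimplicialComplex (∀ i, P i) where
  faces := {s | s.Nonempty ∧ s ∪ corners P ∈ K ∧ s ∩ corners P ⊆ S}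
  isRelLowerSet_faces := fun _ hs => ⟨hs.1, fun _ hts ht =>
    ⟨ht, mem_of_subset hs.2.1 (Finset.union_subset_union_left hts) (ht.mono Finset.subset_union_left),
      (Finset.inter_subset_inter_right hts).trans hs.2.2⟩⟩

namespace IsAdmissible

variable {K : PreAbstractSimplicialComplex (∀ i, P i)} (hK : IsAdmissible K)

include hK

lemma corners_mem : corners P ∈ K := by
  have : ∀ S ⊆ corners P, S = ∅ ∨ S ∈ K := by
    intro S
    induction S using Finset.induction_on with
    | empty => exact fun _ => Or.inl rfl
    | insert x S _ ih =>
      intro h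
      exact Or.inr (hK.insert_mem S (ih ((Finset.subset_insert _ _).trans h)) x
        (fun y hy => corners_comparable (h (Finset.mem_insert_of_mem hy))
          (h (Finset.mem_insert_self _ _)))
        fun i => (corners_extreme (h (Finset.mem_insert_self _ _)) i).imp_right Or.inl)
  exact (this _ subset_rfl).resolve_left (Finset.ne_empty_of_mem bot_mem_corners)

omit [LinearOrder ι] [Fintype ι] in
lemma contractibleSpace : ContractibleSpace (realize K) :=
  contractibleSpace_of_cone ⊥
    (hK.insert_mem ∅ (Or.inl rfl) ⊥ (fun _ h => absurd h (Finset.notMem_empty _))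
      fun _ => Or.inl rfl)
    (fun s hs => hK.insert_mem s (Or.inr hs) ⊥ (fun _ _ => Or.inr bot_le) fun _ => Or.inl rfl)
    hK.isChain

lemma isChain_star {S : Finset (∀ i, P i)} {s : Finset (∀ i, P i)} (hs : s ∈ star K S) :
    IsChain (· ≤ ·) (s : Set (∀ i, P i)) :=
  (hK.isChain _ hs.2.1).mono (Finset.coe_subset.2 Finset.subset_union_left)

lemma singleton_mem_star {S : Finset (∀ i, P i)} {c : ∀ i, P i} (hc : c ∈ corners P)
    (hcS : c ∈ S) : {c} ∈ star K S := by
  refine ⟨Finset.singleton_nonempty c, ?_, Finset.inter_subset_left.trans (by simpa using hcS)⟩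
  rw [Finset.union_eq_right.2 (by simpa using hc)]
  exact hK.corners_mem

omit hK in
lemma insert_mem_star {S : Finset (∀ i, P i)} {c : ∀ i, P i} (hc : c ∈ corners P) (hcS : c ∈ S)
    {s : Finset (∀ i, P i)} (hs : s ∈ star K S) : insert c s ∈ star K S := by
  refine ⟨Finset.insert_nonempty _ _, ?_, ?_⟩
  · rw [Finset.insert_union, Finset.insert_eq_of_mem (Finset.mem_union_right _ hc)]
    exact hs.2.1
  · rw [Finset.insert_inter_of_mem hc]
    exact Finset.insert_subset hcS hs.2.2

lemma contractibleSpace_star {S : Finset (∀ i, P i)} (hS : S ⊆ corners P) (hne : S.Nonempty) :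
    ContractibleSpace (realize (star K S)) := by
  obtain ⟨c, hc⟩ := hne
  exact contractibleSpace_of_cone c (hK.singleton_mem_star (hS hc) hc)
    (fun s hs => insert_mem_star (hS hc) hc hs) fun s hs => hK.isChain_star hs

/-- Adding one more corner amounts to a suspension: the chains that miss one of the corners `c ∪ S`
are the union of the chains that miss `c` and of the chains that miss one of the corners `S`. The
former are a cone with apex any element of `S`, the latter a cone with apex `c`. -/
lemma htpyEquiv_suspension_insert {S : Finset (∀ i, P i)} {c : ∀ i, P i} (hcS : c ∉ S)
    (hS : insert c S ⊆ corners P) (hne : S.Nonempty) :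
    HtpyEquiv (realize (notContaining (star K (insert c S)) (insert c S)))
      (suspension (realize (notContaining (star K S) S))) := by
  have hc := hS (Finset.mem_insert_self _ _)
  have := hK.contractibleSpace_star ((Finset.subset_insert _ _).trans hS) hne
  have : ContractibleSpace (realize (notContaining (star K (insert c S)) S)) := by
    refine contractibleSpace_of_cone c
      ⟨hK.singleton_mem_star hc (Finset.mem_insert_self _ _), fun h => ?_⟩
      (fun s hs => ⟨insert_mem_star hc (Finset.mem_insert_self _ _) hs.1, fun h => ?_⟩)
      fun s hs => hK.isChain_star hs.1
    · obtain ⟨x, hx⟩ := hne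
      obtain rfl := Finset.mem_singleton.1 (h hx)
      exact hcS hx
    · exact hs.2 ((Finset.subset_insert_iff_of_notMem hcS).1 h)
  have h₁ : notContaining (star K (insert c S)) (insert c S) =
      star K S ⊔ notContaining (star K (insert c S)) S := by
    refine complex_ext fun s => ⟨fun hs => ?_, ?_⟩
    · by_cases hcs : c ∈ s
      · exact Or.inr ⟨hs.1, fun h => hs.2 (Finset.insert_subset hcs h)⟩
      · refine Or.inl ⟨hs.1.1, hs.1.2.1, fun x hx => ?_⟩
        refine (Finset.mem_insert.1 (hs.1.2.2 hx)).resolve_left ?_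
        rintro rfl
        exact hcs (Finset.mem_of_mem_inter_left hx)
    · rintro (hs | hs)
      · refine ⟨⟨hs.1, hs.2.1, hs.2.2.trans (Finset.subset_insert _ _)⟩, fun h => ?_⟩
        exact hcS (hs.2.2 (Finset.mem_inter.2 ⟨h (Finset.mem_insert_self _ _), hc⟩))
      · exact ⟨hs.1, fun h => hs.2 ((Finset.subset_insert _ _).trans h)⟩
  have h₂ : notContaining (star K S) S = star K S ⊓ notContaining (star K (insert c S)) S :=
    complex_ext fun s => ⟨fun hs => ⟨hs.1, ⟨hs.1.1, hs.1.2.1,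
      hs.1.2.2.trans (Finset.subset_insert _ _)⟩, hs.2⟩, fun hs => ⟨hs.1, hs.2.2⟩⟩
  rw [h₁, h₂]
  exact htpyEquiv_suspension_of_sup _ _

/-- The number of suspensions is `S.card - 1`, since missing the only element of a one-element set `S`
means containing no corner at all. -/
lemma htpyEquiv_suspension_iterate {S : Finset (∀ i, P i)} (hS : S ⊆ corners P)
    (hne : S.Nonempty) :
    HtpyEquiv (realize (notContaining (star K S) S))
      (suspension^[S.card - 1] (realize (star K ∅))) := by
  induction hne using Finset.Nonempty.cons_induction with
  | singleton c =>
    have : notContaining (star K {c}) {c} = star K ∅ := by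
      refine complex_ext fun s => ⟨fun hs => ⟨hs.1.1, hs.1.2.1, fun x hx => ?_⟩, fun hs =>
        ⟨⟨hs.1, hs.2.1, hs.2.2.trans (Finset.empty_subset _)⟩, fun h => ?_⟩⟩
      · obtain rfl := Finset.mem_singleton.1 (hs.1.2.2 hx)
        exact (hs.2 (Finset.singleton_subset_iff.2 (Finset.mem_of_mem_inter_left hx))).elim
      · exact absurd (hs.2.2 (Finset.mem_inter.2 ⟨h (Finset.mem_singleton_self c),
          hS (Finset.mem_singleton_self c)⟩)) (Finset.notMem_empty _)
    rw [this]
    exact HtpyEquiv.refl _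
  | cons c S hcS hne ih =>
    rw [Finset.cons_eq_insert] at hS ⊢
    refine (hK.htpyEquiv_suspension_insert hcS hS hne).trans ?_
    have := (ih ((Finset.subset_insert _ _).trans hS)).suspension
    rwa [← Function.iterate_succ_apply' suspension, Nat.succ_eq_add_one,
      Nat.sub_add_cancel (Finset.card_pos.2 hne),
      show S.card = (insert c S).card - 1 by rw [Finset.card_insert_of_notMem hcS]; rfl] at this

/-- The chains that miss one of the corners, together with the contractible complex of the chains that
are compatible with all the corners, form the contractible complex `K`. Hence the suspension of the
former is that of the intersection. -/
lemma htpyEquiv_suspension_notContaining_corners [∀ i, Nontrivial (P i)] :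
    HtpyEquiv (suspension (realize (notContaining K (corners P))))
      (suspension^[Fintype.card ι + 1] (realize (star K ∅))) := by
  have hne : (corners P).Nonempty := ⟨⊥, bot_mem_corners⟩
  have h₁ : notContaining K (corners P) ⊔ star K (corners P) = K := by
    refine complex_ext fun s => ⟨?_, fun hs => ?_⟩
    · rintro (hs | hs)
      · exact hs.1
      · exact mem_of_subset hs.2.1 Finset.subset_union_left hs.1
    · by_cases h : corners P ⊆ s
      · refine Or.inr ⟨(K.isRelLowerSet_faces hs).1, ?_, Finset.inter_subset_right⟩
        rwa [Finset.union_eq_left.2 h]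
      · exact Or.inl ⟨hs, h⟩
  have h₂ : notContaining K (corners P) ⊓ star K (corners P) =
      notContaining (star K (corners P)) (corners P) :=
    complex_ext fun s => ⟨fun hs => ⟨hs.2, hs.1.2⟩, fun hs =>
      ⟨⟨mem_of_subset hs.1.2.1 Finset.subset_union_left hs.1.1, hs.2⟩, hs.1⟩⟩
  have : ContractibleSpace (realize (notContaining K (corners P) ⊔ star K (corners P))) := by
    rw [h₁]
    exact hK.contractibleSpace
  have := hK.contractibleSpace_star subset_rfl hne
  have h := htpyEquiv_suspension_inf (notContaining K (corners P)) (star K (corners P))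
  rw [h₂] at h
  refine h.trans ?_
  rw [Function.iterate_succ_apply', ← Nat.add_sub_cancel (Fintype.card ι) 1,
    ← card_corners (P := P)]
  exact (hK.htpyEquiv_suspension_iterate subset_rfl hne).suspension

end IsAdmissible

end Product
end HigherTits

namespace HigherTits
open Limits unitInterval Simplicial

section Pivot

variable {ι : Type} {P : ι → Type u} [∀ i, PartialOrder (P i)] [∀ i, BoundedOrder (P i)]
  [LinearOrder ι]

/-! ### The matching that removes the chains missing a corner -/

/-- In a chain `s` that contains `⊥` and `⊤`, but not all the corners, `q` is the first missing
corner, `a` is the last member below it, and `b` is the first member whose coordinate `q` is larger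
than that of `a`. -/
structure IsPivot (s : Finset (∀ i, P i)) (q : ι) (a b : ∀ i, P i) : Prop where
  corner_mem : ∀ i < q, corner P i ∈ s
  corner_notMem : corner P q ∉ s
  isGreatest : IsGreatest {y | y ∈ s ∧ y ≤ corner P q} a
  isLeast : IsLeast {y | y ∈ s ∧ ¬ y q ≤ a q} b

/-- The element with the coordinates of `a` up to `q`, inclusively, and those of `b` after `q`. -/
def splice (q : ι) (a b : ∀ i, P i) : ∀ i, P i := fun i => if i ≤ q then a i else b i

omit [∀ i, PartialOrder (P i)] [∀ i, BoundedOrder (P i)] in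
lemma splice_of_le {q i : ι} (h : i ≤ q) (a b : ∀ i, P i) : splice q a b i = a i := if_pos h

omit [∀ i, PartialOrder (P i)] [∀ i, BoundedOrder (P i)] in
lemma splice_of_lt {q i : ι} (h : q < i) (a b : ∀ i, P i) : splice q a b i = b i :=
  if_neg (not_le.2 h)

omit [∀ i, PartialOrder (P i)] [∀ i, BoundedOrder (P i)] in
lemma splice_apply_self (q : ι) (a b : ∀ i, P i) : splice q a b q = a q :=
  splice_of_le le_rfl _ _

lemma exists_isPivot [Fintype ι] [DecidableEq (∀ i, P i)] {s : Finset (∀ i, P i)}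
    (hs : IsChain (· ≤ ·) (s : Set (∀ i, P i))) (hbot : ⊥ ∈ s) (htop : ⊤ ∈ s)
    (hc : ¬ corners P ⊆ s) : ∃ q a b, IsPivot s q a b := by
  classical
  have hne : {q | corner P q ∉ s}.Nonempty := by
    by_contra h
    rw [Set.not_nonempty_iff_eq_empty, Set.eq_empty_iff_forall_notMem] at h
    refine hc fun x hx => ?_
    rcases mem_corners.1 hx with rfl | ⟨q, rfl⟩
    · exact hbot
    · exact not_not.1 (h q)
  obtain ⟨q, hq, hmin⟩ := WellFounded.has_min (wellFounded_lt (α := ι)) _ hne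
  have hgreatest : ∃ a, IsGreatest {y | y ∈ s ∧ y ≤ corner P q} a := by
    obtain ⟨a, ha, hmax⟩ := Finset.exists_maximal (s := s.filter (· ≤ corner P q))
      ⟨⊥, Finset.mem_filter.2 ⟨hbot, bot_le⟩⟩
    refine ⟨a, Finset.mem_filter.1 ha, fun y hy => ?_⟩
    rcases hs.total hy.1 (Finset.mem_filter.1 ha).1 with h | h
    · exact h
    · exact hmax (Finset.mem_filter.2 hy) h
  obtain ⟨a, ha⟩ := hgreatest
  have haq : ∀ i < q, a i = ⊤ := fun i hi => top_le_iff.1 (by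
    rw [← corner_of_le (P := P) (le_refl i)]
    exact ha.2 ⟨not_not.1 fun h => hmin i h hi, corner_mono hi.le⟩ i)
  have hatop : a q ≠ ⊤ := fun h => hq (by
    have : a = corner P q := le_antisymm ha.1.2 fun i => by
      rcases lt_trichotomy i q with hi | rfl | hi
      · rw [haq i hi]; exact le_top
      · rw [h]; exact le_top
      · rw [corner_of_lt hi]; exact bot_le
    exact this ▸ ha.1.1)
  obtain ⟨b, hb, hmin'⟩ := Finset.exists_minimal (s := s.filter fun y => ¬ y q ≤ a q)
    ⟨⊤, Finset.mem_filter.2 ⟨htop, fun h => hatop (top_le_iff.1 h)⟩⟩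
  refine ⟨q, a, b, fun i hi => not_not.1 fun h => hmin i h hi, hq, ha, Finset.mem_filter.1 hb,
    fun y hy => ?_⟩
  rcases hs.total (Finset.mem_filter.1 hb).1 hy.1 with h | h
  · exact h
  · exact hmin' (Finset.mem_filter.2 hy) h

namespace IsPivot

variable {s t : Finset (∀ i, P i)} {q q' : ι} {a b a' b' : ∀ i, P i}

lemma unique (h : IsPivot s q a b) (h' : IsPivot s q' a' b') : q = q' ∧ a = a' ∧ b = b' := by
  have hq : q = q' := by
    rcases lt_trichotomy q q' with hlt | heq | hlt
    · exact (h.corner_notMem (h'.corner_mem _ hlt)).elim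
    · exact heq
    · exact (h'.corner_notMem (h.corner_mem _ hlt)).elim
  subst hq
  have ha := h.isGreatest.unique h'.isGreatest
  subst ha
  exact ⟨rfl, rfl, h.isLeast.unique h'.isLeast⟩

variable (h : IsPivot s q a b)

include h

lemma left_eq_top {i : ι} (hi : i < q) : a i = ⊤ := top_le_iff.1 (by
  rw [← corner_of_le (P := P) (le_refl i)]
  exact h.isGreatest.2 ⟨h.corner_mem i hi, corner_mono hi.le⟩ i)

lemma left_ne_top : a q ≠ ⊤ := fun hq => h.corner_notMem (by
  have : a = corner P q := le_antisymm h.isGreatest.1.2 fun i => by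
    rcases lt_trichotomy i q with hi | rfl | hi
    · rw [h.left_eq_top hi]; exact le_top
    · rw [hq]; exact le_top
    · rw [corner_of_lt hi]; exact bot_le
  exact this ▸ h.isGreatest.1.1)

lemma left_le_right (hs : IsChain (· ≤ ·) (s : Set (∀ i, P i))) : a ≤ b :=
  (hs.total h.isGreatest.1.1 h.isLeast.1.1).resolve_right fun hba => h.isLeast.1.2 (hba q)

lemma not_splice_le : ¬ splice q a b ≤ corner P q := by
  intro hle
  refine h.isLeast.1.2 (h.isGreatest.2 ⟨h.isLeast.1.1, fun i => ?_⟩ q)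
  rcases le_or_gt i q with hi | hi
  · rw [corner_of_le hi]
    exact le_top
  · rw [← splice_of_lt hi a b]
    exact hle i

lemma splice_notMem_corners [Fintype ι] [DecidableEq (∀ i, P i)] : splice q a b ∉ corners P := by
  intro hc
  have hnle := h.not_splice_le
  rcases mem_corners.1 hc with hc | ⟨p, hc⟩
  · rw [hc] at hnle
    exact hnle bot_le
  · rcases le_or_gt q p with hp | hp
    · have := congrFun hc q
      rw [corner_of_le hp, splice_apply_self] at this
      exact h.left_ne_top this.symm
    · rw [← hc] at hnle
      exact hnle (corner_mono hp.le)

lemma left_le_splice (hs : IsChain (· ≤ ·) (s : Set (∀ i, P i))) : a ≤ splice q a b := fun i => by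
  rcases le_or_gt i q with hi | hi
  · rw [splice_of_le hi]
  · rw [splice_of_lt hi]
    exact h.left_le_right hs i

lemma splice_le_right (hs : IsChain (· ≤ ·) (s : Set (∀ i, P i))) : splice q a b ≤ b := fun i => by
  rcases le_or_gt i q with hi | hi
  · rw [splice_of_le hi]
    exact h.left_le_right hs i
  · rw [splice_of_lt hi]

lemma comparable (hs : IsChain (· ≤ ·) (s : Set (∀ i, P i))) {y : ∀ i, P i} (hy : y ∈ s) :
    y ≤ splice q a b ∨ splice q a b ≤ y := by
  by_cases hyq : y ≤ corner P q
  · exact Or.inl ((h.isGreatest.2 ⟨hy, hyq⟩).trans (h.left_le_splice hs))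
  · have hay : a ≤ y := (hs.total h.isGreatest.1.1 hy).resolve_right fun hya =>
      hyq (hya.trans h.isGreatest.1.2)
    by_cases hyaq : y q ≤ a q
    · have hyb : y ≤ b := (hs.total hy h.isLeast.1.1).resolve_right fun hby =>
        h.isLeast.1.2 ((hby q).trans hyaq)
      refine Or.inl fun i => ?_
      rcases lt_trichotomy i q with hi | rfl | hi
      · rw [splice_of_le hi.le, h.left_eq_top hi]
        exact le_top
      · rw [splice_apply_self]
        exact hyaq
      · rw [splice_of_lt hi]
        exact hyb i
    · exact Or.inr ((h.splice_le_right hs).trans (h.isLeast.2 ⟨hy, hyaq⟩))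

/-- The pivot only depends on the members different from `splice q a b`. -/
lemma of_mem_iff [Fintype ι] [DecidableEq (∀ i, P i)]
    (hst : ∀ x ≠ splice q a b, x ∈ t ↔ x ∈ s) : IsPivot t q a b := by
  have hcorner : ∀ i, corner P i ≠ splice q a b := fun i hi =>
    h.splice_notMem_corners (hi ▸ mem_corners.2 (Or.inr ⟨i, rfl⟩))
  have h₁ : {y | y ∈ t ∧ y ≤ corner P q} = {y | y ∈ s ∧ y ≤ corner P q} := Set.ext fun y =>
    and_congr_left fun hy => hst y (by rintro rfl; exact h.not_splice_le hy)
  have h₂ : {y | y ∈ t ∧ ¬ y q ≤ a q} = {y | y ∈ s ∧ ¬ y q ≤ a q} := Set.ext fun y =>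
    and_congr_left fun hy => hst y (by rintro rfl; exact hy (splice_apply_self _ _ _).le)
  exact
    { corner_mem := fun i hi => (hst _ (hcorner i)).2 (h.corner_mem i hi)
      corner_notMem := fun hc => h.corner_notMem ((hst _ (hcorner q)).1 hc)
      isGreatest := h₁ ▸ h.isGreatest
      isLeast := h₂ ▸ h.isLeast }

end IsPivot

open scoped Classical in
/-- The vertex `splice q a b` given by the pivot of a chain, if there is one. -/
noncomputable def pivotVertex (s : Finset (∀ i, P i)) : ∀ i, P i :=
  if h : ∃ p : ι × (∀ i, P i) × (∀ i, P i), IsPivot s p.1 p.2.1 p.2.2 then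
    splice h.choose.1 h.choose.2.1 h.choose.2.2 else ⊥

open scoped Classical in
/-- The position of the pivot, together with the numbers of members of the chain among which the
pivot elements are the extreme ones. -/
noncomputable def pivotRank [Fintype ι] (s : Finset (∀ i, P i)) : ℕ ×ₗ ℕ ×ₗ ℕ :=
  if h : ∃ p : ι × (∀ i, P i) × (∀ i, P i), IsPivot s p.1 p.2.1 p.2.2 then
    toLex ((Finset.univ.filter (· < h.choose.1)).card,
      toLex ((s.filter (· ≤ corner P h.choose.1)).card,
        (s.filter fun y => ¬ y h.choose.1 ≤ h.choose.2.1 h.choose.1).card)) else 0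

lemma IsPivot.pivotVertex_eq {s : Finset (∀ i, P i)} {q : ι} {a b : ∀ i, P i}
    (h : IsPivot s q a b) : pivotVertex s = splice q a b := by
  have h' : ∃ p : ι × (∀ i, P i) × (∀ i, P i), IsPivot s p.1 p.2.1 p.2.2 := ⟨(q, a, b), h⟩
  obtain ⟨h₁, h₂, h₃⟩ := h'.choose_spec.unique h
  rw [pivotVertex, dif_pos h', h₁, h₂, h₃]

open scoped Classical in
lemma IsPivot.pivotRank_eq [Fintype ι] {s : Finset (∀ i, P i)} {q : ι} {a b : ∀ i, P i}
    (h : IsPivot s q a b) : pivotRank s =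
      toLex ((Finset.univ.filter (· < q)).card, toLex ((s.filter (· ≤ corner P q)).card,
        (s.filter fun y => ¬ y q ≤ a q).card)) := by
  have h' : ∃ p : ι × (∀ i, P i) × (∀ i, P i), IsPivot s p.1 p.2.1 p.2.2 := ⟨(q, a, b), h⟩
  obtain ⟨h₁, h₂, h₃⟩ := h'.choose_spec.unique h
  have heq : h'.choose = (q, a, b) := Prod.ext h₁ (Prod.ext h₂ h₃)
  rw [pivotRank, dif_pos h', heq]

variable [Fintype ι] [DecidableEq (∀ i, P i)]

/-- If `s` and `t` have the same number of elements, and `s` arises from `t` by adding the vertex of `t`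
and removing another element, then one of the following happens: the removed element is a corner
before the first missing one, which therefore moves down; it is below the first missing corner, and
the number of these members decreases; or its coordinate `q` is larger than that of `a`, and the
number of these members decreases. Otherwise the pivot, and so the vertex, would not change, which is
impossible as `s` does not contain its vertex. -/
lemma IsPivot.pivotRank_lt {s t : Finset (∀ i, P i)} {q p : ι} {a b c d : ∀ i, P i}
    (hs : IsPivot s q a b) (ht : IsPivot t p c d)
    (hes : splice q a b ∉ s) (hne : s ≠ t) (hcard : s.card = t.card)
    (hst : s ⊆ insert (splice p c d) t) : pivotRank s < pivotRank t := by
  classical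
  have hpc : ∀ i, corner P i ∈ s → corner P i ∈ t := fun i hi =>
    Finset.mem_of_mem_insert_of_ne (hst hi) fun h =>
      ht.splice_notMem_corners (h ▸ mem_corners.2 (Or.inr ⟨i, rfl⟩))
  have hmem : splice p c d ∈ s := by
    by_contra h
    exact hne (Finset.eq_of_subset_of_card_le ((Finset.subset_insert_iff_of_notMem h).1 hst)
      hcard.ge)
  rw [hs.pivotRank_eq, ht.pivotRank_eq, Prod.Lex.toLex_lt_toLex]
  rcases lt_trichotomy q p with hqp | rfl | hqp
  · refine Or.inl (Finset.card_lt_card ⟨fun i hi => ?_, fun h => ?_⟩)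
    · simp only [Finset.mem_filter, Finset.mem_univ, true_and] at hi ⊢
      exact hi.trans hqp
    · exact lt_irrefl q (Finset.mem_filter.1 (h (by simpa using hqp))).2
  · refine Or.inr ⟨rfl, ?_⟩
    have h₁ : s.filter (· ≤ corner P q) ⊆ t.filter (· ≤ corner P q) := fun y hy => by
      rw [Finset.mem_filter] at hy ⊢
      refine ⟨Finset.mem_of_mem_insert_of_ne (hst hy.1) ?_, hy.2⟩
      rintro rfl
      exact ht.not_splice_le hy.2
    rw [Prod.Lex.toLex_lt_toLex]
    rcases h₁.eq_or_ssubset with heq | hlt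
    · have hac : a = c := by
        refine hs.isGreatest.unique ?_
        have : {y | y ∈ s ∧ y ≤ corner P q} = {y | y ∈ t ∧ y ≤ corner P q} := Set.ext fun y => by
          simpa using congrArg (y ∈ ·) heq
        rw [this]
        exact ht.isGreatest
      subst hac
      refine Or.inr ⟨congrArg Finset.card heq, Finset.card_lt_card (lt_of_le_of_ne (fun y hy => ?_) ?_)⟩
      · rw [Finset.mem_filter] at hy ⊢
        refine ⟨Finset.mem_of_mem_insert_of_ne (hst hy.1) ?_, hy.2⟩
        rintro rfl
        exact hy.2 (splice_apply_self _ _ _).le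
      · intro heq'
        have hbd : b = d := by
          refine hs.isLeast.unique ?_
          have : {y | y ∈ s ∧ ¬ y q ≤ a q} = {y | y ∈ t ∧ ¬ y q ≤ a q} := Set.ext fun y => by
            simpa using congrArg (y ∈ ·) heq'
          rw [this]
          exact ht.isLeast
        exact hes (hbd ▸ hmem)
    · exact Or.inl (Finset.card_lt_card hlt)
  · exact (ht.corner_notMem (hpc p (hs.corner_mem p hqp))).elim

variable {K : PreAbstractSimplicialComplex (∀ i, P i)}

namespace IsAdmissible

variable (hK : IsAdmissible K)

include hK

lemma exists_isPivot {s : Finset (∀ i, P i)} (hs : s ∈ notContaining K (corners P))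
    (hs' : s ∉ notContaining K {⊥, ⊤}) : (⊥ ∈ s ∧ ⊤ ∈ s) ∧ ∃ q a b, IsPivot s q a b := by
  have h : {⊥, ⊤} ⊆ s := not_not.1 fun h => hs' ⟨hs.1, h⟩
  have hbot := h (Finset.mem_insert_self _ _)
  have htop := h (Finset.mem_insert_of_mem (Finset.mem_singleton_self _))
  exact ⟨⟨hbot, htop⟩, HigherTits.exists_isPivot (hK.isChain _ hs.1) hbot htop hs.2⟩

/-- A chain that contains `⊥` and `⊤` but not all the corners is matched by adding or removing the
vertex `splice q a b` given by its pivot. The splice lies between `a` and `b`, is comparable with all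
the members of the chain, and is not a corner. -/
noncomputable def pivotMatching :
    Matching (notContaining K {⊥, ⊤}) (notContaining K (corners P)) (ℕ ×ₗ ℕ ×ₗ ℕ) where
  le s hs := ⟨hs.1, fun h => hs.2 (Finset.insert_subset (h bot_mem_corners)
    (Finset.singleton_subset_iff.2 (h top_mem_corners)))⟩
  isChain s hs := hK.isChain s hs.1
  e := pivotVertex
  insert_mem s hs hs' _ := by
    obtain ⟨-, q, a, b, h⟩ := hK.exists_isPivot hs hs'
    have hc := hK.isChain s hs.1
    rw [h.pivotVertex_eq]
    refine ⟨hK.insert_mem s (Or.inr hs.1) _ (fun y hy => h.comparable hc hy) fun i => ?_, fun h' =>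
      hs.2 ((Finset.subset_insert_iff_of_notMem (h.splice_notMem_corners)).1 h')⟩
    refine Or.inr (Or.inr ?_)
    rcases le_or_gt i q with hi | hi
    · exact ⟨a, h.isGreatest.1.1, splice_of_le hi _ _⟩
    · exact ⟨b, h.isLeast.1.1, splice_of_lt hi _ _⟩
  e_insert s hs hs' _ := by
    obtain ⟨-, q, a, b, h⟩ := hK.exists_isPivot hs hs'
    rw [h.pivotVertex_eq]
    refine (h.of_mem_iff fun x hx => ?_).pivotVertex_eq
    simp [hx]
  erase_nonempty s hs hs' _ := by
    obtain ⟨hb, q, a, b, h⟩ := hK.exists_isPivot hs hs'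
    rw [h.pivotVertex_eq]
    refine ⟨⊥, Finset.mem_erase.2 ⟨fun h' => ?_, hb.1⟩⟩
    exact h.splice_notMem_corners (h' ▸ bot_mem_corners)
  erase_notMem s hs hs' _ := by
    obtain ⟨hb, q, a, b, h⟩ := hK.exists_isPivot hs hs'
    have hc := h.splice_notMem_corners
    rw [h.pivotVertex_eq]
    refine fun h' => h'.2 (Finset.insert_subset (Finset.mem_erase.2 ⟨fun h' => ?_, hb.1⟩)
      (Finset.singleton_subset_iff.2 (Finset.mem_erase.2 ⟨fun h' => ?_, hb.2⟩)))
    · exact hc (h' ▸ bot_mem_corners)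
    · exact hc (h' ▸ top_mem_corners)
  e_erase s hs hs' _ := by
    obtain ⟨-, q, a, b, h⟩ := hK.exists_isPivot hs hs'
    rw [h.pivotVertex_eq]
    refine (h.of_mem_iff fun x hx => ?_).pivotVertex_eq
    simp [hx]
  rank := pivotRank
  rank_lt s hs hs' hes t ht ht' _ hne hcard hst := by
    obtain ⟨-, q, a, b, h⟩ := hK.exists_isPivot hs hs'
    obtain ⟨-, p, c, d, h'⟩ := hK.exists_isPivot ht ht'
    rw [h.pivotVertex_eq] at hes
    rw [h'.pivotVertex_eq] at hst
    exact h.pivotRank_lt h' hes hne hcard hst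

/-- The suspension of the complex of the chains that do not contain both `⊥` and `⊤` is an iterated
suspension of the complex of the chains that are compatible with the corners, but contain none. -/
theorem htpyEquiv_suspension_notContaining_extremes [∀ i, Nontrivial (P i)] :
    HtpyEquiv (suspension (realize (notContaining K {⊥, ⊤})))
      (suspension^[Fintype.card ι + 1] (realize (star K ∅))) :=
  (hK.pivotMatching.htpyEquiv.suspension).trans hK.htpyEquiv_suspension_notContaining_corners

end IsAdmissible

end Pivot
end HigherTits

namespace HigherTits
open Limits unitInterval

section Splittings

variable {R : Type v} {M : Type u} [CommRing R] [AddCommGroup M] [Module R M]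

/-! ### Splittings as chains of complementary pairs -/

variable (R M) in
/-- The pairs of complementary submodules, where `(P, Q) ≤ (P', Q')` if `P ⊆ P'` and `Q' ⊆ Q`. -/
abbrev SplitPart : Type u :=
  {x : Submodule R M × (Submodule R M)ᵒᵈ // IsCompl x.1 (OrderDual.ofDual x.2)}

instance : BoundedOrder (SplitPart R M) where
  bot := ⟨(⊥, OrderDual.toDual ⊤), isCompl_bot_top⟩
  top := ⟨(⊤, OrderDual.toDual ⊥), isCompl_top_bot⟩
  bot_le x := ⟨bot_le, (le_top : OrderDual.ofDual x.1.2 ≤ ⊤)⟩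
  le_top x := ⟨le_top, (bot_le : ⊥ ≤ OrderDual.ofDual x.1.2)⟩

namespace SplitPart

/-- The first summand. -/
def fst (x : SplitPart R M) : Submodule R M := x.1.1

/-- The second summand. -/
def snd (x : SplitPart R M) : Submodule R M := OrderDual.ofDual x.1.2

lemma isCompl (x : SplitPart R M) : IsCompl x.fst x.snd := x.2

lemma ext {x y : SplitPart R M} (h₁ : x.fst = y.fst) (h₂ : x.snd = y.snd) : x = y :=
  Subtype.ext (Prod.ext h₁ h₂)

lemma fst_mono {x y : SplitPart R M} (h : x ≤ y) : x.fst ≤ y.fst := h.1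

lemma snd_anti {x y : SplitPart R M} (h : x ≤ y) : y.snd ≤ x.snd := h.2

/-- A pair of complementary submodules. -/
def mk (P Q : Submodule R M) (h : IsCompl P Q) : SplitPart R M := ⟨(P, OrderDual.toDual Q), h⟩

lemma eq_bot_iff {x : SplitPart R M} : x = ⊥ ↔ x.fst = ⊥ := by
  refine ⟨fun h => h ▸ rfl, fun h => ext h ?_⟩
  have := x.isCompl.sup_eq_top
  rwa [h, bot_sup_eq] at this

lemma eq_top_iff {x : SplitPart R M} : x = ⊤ ↔ x.snd = ⊥ := by
  refine ⟨fun h => h ▸ rfl, fun h => ext ?_ h⟩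
  have := x.isCompl.sup_eq_top
  rwa [h, sup_bot_eq] at this

end SplitPart

/-- The sum of the members of a family with indices in a set. -/
def partialSum {ι : Type*} (N : ι → Submodule R M) (A : Set ι) : Submodule R M := ⨆ i ∈ A, N i

section PartialSum

variable {ι : Type*} {N : ι → Submodule R M}

lemma le_partialSum {A : Set ι} {i : ι} (hi : i ∈ A) : N i ≤ partialSum N A :=
  le_iSup₂_of_le i hi le_rfl

lemma partialSum_mono {A B : Set ι} (h : A ⊆ B) : partialSum N A ≤ partialSum N B :=
  biSup_mono h

lemma partialSum_union (A B : Set ι) :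
    partialSum N (A ∪ B) = partialSum N A ⊔ partialSum N B := iSup_union

lemma partialSum_insert (i : ι) (A : Set ι) :
    partialSum N (insert i A) = N i ⊔ partialSum N A := iSup_insert

lemma partialSum_singleton (i : ι) : partialSum N {i} = N i := iSup_singleton

lemma partialSum_empty : partialSum N ∅ = ⊥ := iSup_emptyset

lemma partialSum_univ : partialSum N Set.univ = ⨆ i, N i := iSup_univ

lemma partialSum_fibreSum {κ : Type*} (φ : ι → κ) (A : Set κ) :
    partialSum (fibreSum φ N) A = partialSum N (φ ⁻¹' A) := by
  apply le_antisymm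
  · refine iSup₂_le fun j hj => iSup₂_le fun i hi => ?_
    exact le_partialSum (show φ i ∈ A from hi.symm ▸ hj)
  · refine iSup₂_le fun i hi => ?_
    exact (le_iSup₂_of_le (f := fun i' (_ : φ i' = φ i) => N i') i rfl le_rfl).trans
      (le_partialSum (N := fibreSum φ N) (show φ i ∈ A from hi))

lemma disjoint_partialSum (h : iSupIndep N) {A B : Set ι} (hAB : Disjoint A B) :
    Disjoint (partialSum N A) (partialSum N B) :=
  h.disjoint_biSup_biSup hAB

lemma partialSum_inf (h : iSupIndep N) (A B : Set ι) :
    partialSum N A ⊓ partialSum N B = partialSum N (A ∩ B) := by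
  rw [← Set.inter_union_sdiff A B, partialSum_union, Set.inter_union_sdiff,
    sup_inf_assoc_of_le _ (partialSum_mono Set.inter_subset_right),
    (disjoint_partialSum h Set.disjoint_sdiff_left).eq_bot, sup_bot_eq]

end PartialSum

variable {n : ℕ}

/-- The pair `(M_0 ⊕ ⋯ ⊕ M_k, M_{k+1} ⊕ ⋯ ⊕ M_{n+1})` of a splitting `(M_0, …, M_{n+1})`. -/
def cut (N : Fin (n + 2) → Submodule R M) (h : DirectSum.IsInternal N) (k : Fin (n + 1)) :
    SplitPart R M :=
  .mk (partialSum N {i | i ≤ k.castSucc}) (partialSum N {i | k.castSucc < i}) (by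
    rw [DirectSum.isInternal_submodule_iff_iSupIndep_and_iSup_eq_top] at h
    refine ⟨disjoint_partialSum h.1 (Set.disjoint_left.2 fun i (hi : i ≤ k.castSucc) (hi' : k.castSucc < i) => not_lt.2 hi hi'),
      codisjoint_iff.2 ?_⟩
    rw [← partialSum_union, ← h.2, ← partialSum_univ]
    congr 1
    ext i
    simpa using le_or_gt i k.castSucc)

/-- The summand with index `l` of the splitting that corresponds to a chain of pairs. -/
def gap (x : Fin (n + 1) → SplitPart R M) (l : Fin (n + 2)) : Submodule R M :=
  (⨅ (k : Fin (n + 1)) (_ : l ≤ k.castSucc), (x k).fst) ⊓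
    ⨅ (k : Fin (n + 1)) (_ : k.castSucc < l), (x k).snd

lemma cut_mono (N : Fin (n + 2) → Submodule R M) (h : DirectSum.IsInternal N) :
    Monotone (cut N h) := fun _ _ hkl =>
  ⟨partialSum_mono fun _ hi => le_trans hi (Fin.castSucc_le_castSucc_iff.2 hkl),
    partialSum_mono fun _ hi => lt_of_le_of_lt (Fin.castSucc_le_castSucc_iff.2 hkl) hi⟩

/-- A splitting is determined by its chain of pairs. -/
lemma gap_cut (N : Fin (n + 2) → Submodule R M) (h : DirectSum.IsInternal N) :
    gap (cut N h) = N := by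
  funext l
  have hi := (DirectSum.isInternal_submodule_iff_iSupIndep_and_iSup_eq_top N).1 h
  refine le_antisymm ?_ (le_inf (le_iInf₂ fun k hk => le_partialSum hk)
    (le_iInf₂ fun k hk => le_partialSum hk))
  have h₁ : (⨅ (k : Fin (n + 1)) (_ : l ≤ k.castSucc), (cut N h k).fst) ≤
      partialSum N {i | i ≤ l} := by
    rcases l.eq_castSucc_or_eq_last with ⟨k, rfl⟩ | rfl
    · exact iInf₂_le k le_rfl
    · refine le_top.trans (hi.2.symm.le.trans (partialSum_univ.symm.le.trans
        (partialSum_mono fun i _ => Fin.le_last i)))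
  have h₂ : (⨅ (k : Fin (n + 1)) (_ : k.castSucc < l), (cut N h k).snd) ≤
      partialSum N {i | l ≤ i} := by
    rcases l.eq_zero_or_eq_succ with rfl | ⟨k, rfl⟩
    · refine le_top.trans (hi.2.symm.le.trans (partialSum_univ.symm.le.trans
        (partialSum_mono fun i _ => Fin.zero_le i)))
    · exact (iInf₂_le k Fin.castSucc_lt_succ).trans
        (partialSum_mono fun i hi => Fin.castSucc_lt_iff_succ_le.1 hi)
  refine (inf_le_inf h₁ h₂).trans ?_
  rw [partialSum_inf hi.1, ← partialSum_singleton (N := N) l]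
  exact partialSum_mono fun i hi => le_antisymm hi.1 hi.2

section Gap

variable {x : Fin (n + 1) → SplitPart R M} (hx : Monotone x)

include hx

lemma gap_zero : gap x 0 = (x 0).fst := by
  refine le_antisymm (inf_le_left.trans (iInf₂_le 0 (Fin.zero_le _))) (le_inf ?_ ?_)
  · exact le_iInf₂ fun k _ => SplitPart.fst_mono (hx (Fin.zero_le k))
  · exact le_iInf₂ fun k hk => absurd hk (Fin.not_lt_zero _)

lemma gap_last : gap x (Fin.last _) = (x (Fin.last _)).snd := by
  refine le_antisymm (inf_le_right.trans (iInf₂_le (Fin.last n) (Fin.castSucc_lt_last (Fin.last n)))) (le_inf ?_ ?_)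
  · exact le_iInf₂ fun k hk => absurd (Fin.castSucc_lt_last k) (not_lt.2 hk)
  · exact le_iInf₂ fun k _ => SplitPart.snd_anti (hx (Fin.le_last k))

lemma gap_succ_castSucc (k : Fin n) :
    gap x k.castSucc.succ = (x k.succ).fst ⊓ (x k.castSucc).snd := by
  refine le_antisymm (inf_le_inf (iInf₂_le k.succ (Fin.succ_castSucc k).le)
    (iInf₂_le k.castSucc Fin.castSucc_lt_succ)) (inf_le_inf ?_ ?_)
  · refine le_iInf₂ fun j hj => SplitPart.fst_mono (hx ?_)
    rwa [Fin.succ_castSucc, Fin.castSucc_le_castSucc_iff] at hj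
  · refine le_iInf₂ fun j hj => SplitPart.snd_anti (hx ?_)
    rwa [Fin.castSucc_lt_succ_iff] at hj

/-- By the modular law, the gaps up to `k` add up to the first summand of the pair `x k`. -/
lemma partialSum_gap_le (k : Fin (n + 1)) :
    partialSum (gap x) {i | i ≤ k.castSucc} = (x k).fst := by
  induction k using Fin.induction with
  | zero =>
    rw [show {i : Fin (n + 2) | i ≤ (0 : Fin (n + 1)).castSucc} = {0} by ext; simp,
      partialSum_singleton, gap_zero hx]
  | succ k ih =>
    have : {i | i ≤ k.succ.castSucc} = insert k.castSucc.succ {i | i ≤ k.castSucc.castSucc} := by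
      ext i
      simp only [Set.mem_ofPred_eq, Set.mem_insert_iff, Fin.ext_iff, Fin.le_iff_val_le_val,
        Fin.val_castSucc, Fin.val_succ]
      lia
    rw [this, partialSum_insert, ih, gap_succ_castSucc hx, inf_comm, sup_comm,
      ← sup_inf_assoc_of_le _ (SplitPart.fst_mono (hx k.castSucc_le_succ)),
      (x k.castSucc).isCompl.sup_eq_top, top_inf_eq]

lemma partialSum_gap_lt (k : Fin (n + 1)) :
    partialSum (gap x) {i | k.castSucc < i} = (x k).snd := by
  induction k using Fin.reverseInduction with
  | last =>
    rw [show {i : Fin (n + 2) | (Fin.last n).castSucc < i} = {Fin.last _} by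
      ext i
      simp only [Set.mem_ofPred_eq, Set.mem_singleton_iff, Fin.ext_iff, Fin.lt_def,
        Fin.val_castSucc, Fin.val_last]
      lia,
      partialSum_singleton, gap_last hx]
  | cast k ih =>
    have : {i | k.castSucc.castSucc < i} = insert k.castSucc.succ {i | k.succ.castSucc < i} := by
      ext i
      simp only [Set.mem_ofPred_eq, Set.mem_insert_iff, Fin.ext_iff, Fin.lt_def,
        Fin.val_castSucc, Fin.val_succ]
      lia
    rw [this, partialSum_insert, ih, gap_succ_castSucc hx, sup_comm,
      ← sup_inf_assoc_of_le _ (SplitPart.snd_anti (hx k.castSucc_le_succ)), sup_comm,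
      (x k.succ).isCompl.sup_eq_top, top_inf_eq]

lemma gap_isInternal : DirectSum.IsInternal (gap x) := by
  rw [DirectSum.isInternal_submodule_iff_iSupIndep_and_iSup_eq_top]
  constructor
  · intro l
    have h₁ : Disjoint (partialSum (gap x) {i | i ≤ l}) (partialSum (gap x) {i | l < i}) := by
      rcases l.eq_castSucc_or_eq_last with ⟨k, rfl⟩ | rfl
      · rw [partialSum_gap_le hx, partialSum_gap_lt hx]
        exact (x k).isCompl.disjoint
      · rw [show {i : Fin (n + 2) | Fin.last _ < i} = ∅ from
          Set.eq_empty_of_forall_notMem fun i hi => not_lt.2 (Fin.le_last i) hi, partialSum_empty]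
        exact disjoint_bot_right
    have h₂ : Disjoint (partialSum (gap x) {i | i < l}) (partialSum (gap x) {i | l ≤ i}) := by
      rcases l.eq_zero_or_eq_succ with rfl | ⟨k, rfl⟩
      · rw [show {i : Fin (n + 2) | i < 0} = ∅ from
          Set.eq_empty_of_forall_notMem fun i hi => Fin.not_lt_zero i hi, partialSum_empty]
        exact disjoint_bot_left
      · rw [show {i : Fin (n + 2) | i < k.succ} = {i | i ≤ k.castSucc} from
          Set.ext fun i => Fin.le_castSucc_iff.symm,
          show {i : Fin (n + 2) | k.succ ≤ i} = {i | k.castSucc < i} from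
          Set.ext fun i => Fin.castSucc_lt_iff_succ_le.symm,
          partialSum_gap_le hx, partialSum_gap_lt hx]
        exact (x k).isCompl.disjoint
    have h₃ : gap x l ⊔ partialSum (gap x) {i | i < l} ≤ partialSum (gap x) {i | i ≤ l} :=
      sup_le (le_partialSum (le_refl l)) (partialSum_mono fun i (hi : i < l) => hi.le)
    have h₄ : gap x l ≤ partialSum (gap x) {i | l ≤ i} := le_partialSum (le_refl l)
    have h₅ : Disjoint (gap x l) (partialSum (gap x) {i | i < l}) := (h₂.mono_right h₄).symm
    refine (h₅.disjoint_sup_right_of_disjoint_sup_left (h₁.mono_left h₃)).mono_right ?_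
    rw [← partialSum_union]
    exact iSup₂_le fun j hj => le_partialSum (lt_or_gt_of_ne hj)
  · rw [eq_top_iff, ← (x 0).isCompl.sup_eq_top, ← partialSum_gap_le hx, ← partialSum_gap_lt hx]
    exact sup_le (iSup₂_le fun i _ => le_iSup _ i) (iSup₂_le fun i _ => le_iSup _ i)

/-- Every chain of pairs comes from a splitting. -/
lemma cut_gap : cut (gap x) (gap_isInternal hx) = x :=
  funext fun k => SplitPart.ext (partialSum_gap_le hx k) (partialSum_gap_lt hx k)

end Gap

lemma cut_zero_eq_bot_iff {N : Fin (n + 2) → Submodule R M} (h : DirectSum.IsInternal N) :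
    cut N h 0 = ⊥ ↔ N 0 = ⊥ := by
  rw [SplitPart.eq_bot_iff, ← gap_zero (cut_mono N h), gap_cut]

lemma cut_last_eq_top_iff {N : Fin (n + 2) → Submodule R M} (h : DirectSum.IsInternal N) :
    cut N h (Fin.last n) = ⊤ ↔ N (Fin.last _) = ⊥ := by
  rw [SplitPart.eq_top_iff, ← gap_last (cut_mono N h), gap_cut]

/-- The monotone map on cut positions and the map on summands that it induces are adjoint. -/
lemma map'_le_castSucc_iff {m : ℕ} (f : Fin (n + 1) →o Fin (m + 1)) (i : Fin (m + 2))
    (k : Fin (n + 1)) :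
    SimplexCategory.II.map' f i ≤ k.castSucc ↔ i ≤ (f k).castSucc := by
  constructor
  · intro h
    obtain ⟨j, hj⟩ := Fin.eq_castSucc_of_ne_last (h.trans_lt (Fin.castSucc_lt_last k)).ne
    rw [← hj, Fin.castSucc_le_castSucc_iff] at h
    exact ((SimplexCategory.II.map'_eq_castSucc_iff f i j).1 hj.symm).1.trans
      (Fin.castSucc_le_castSucc_iff.2 (f.monotone h))
  · intro h
    exact Finset.min'_le _ _ ((SimplexCategory.II.castSucc_mem_finset_iff f i k).2 h)

/-- Cutting is compatible with the simplicial operators. -/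
lemma cut_fibreSum {m : ℕ} (f : Fin (n + 1) →o Fin (m + 1)) (N : Fin (m + 2) → Submodule R M)
    (h : DirectSum.IsInternal N) (k : Fin (n + 1)) :
    cut (fibreSum (SimplexCategory.II.map' f) N) (fibreSum_isInternal _ h) k = cut N h (f k) := by
  refine SplitPart.ext ?_ ?_
  · refine (partialSum_fibreSum _ _).trans (congrArg (partialSum N) (Set.ext fun i => ?_))
    exact map'_le_castSucc_iff f i k
  · refine (partialSum_fibreSum _ _).trans (congrArg (partialSum N) (Set.ext fun i => ?_))
    exact not_le.symm.trans ((map'_le_castSucc_iff f i k).not.trans not_le)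

/-! ### The common basis property -/

/-- A basis that is adapted to some submodules is adapted to their intersections. -/
lemma HasCommonBasis.of_infs {S S' : Set (Submodule R M)} (h : HasCommonBasis S)
    (hS : ∀ U ∈ S', ∃ A ⊆ S, U = sInf A) : HasCommonBasis S' := by
  obtain ⟨b, hb⟩ := h
  choose! t ht using hb
  refine ⟨b, fun U hU => ?_⟩
  obtain ⟨A, hA, rfl⟩ := hS U hU
  refine ⟨⋂ V ∈ A, t V, ?_⟩
  ext m
  rw [Submodule.mem_sInf, b.mem_span_image, Set.subset_iInter₂_iff]
  refine forall₂_congr fun V hV => ?_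
  conv_lhs => rw [ht V (hA hV), b.mem_span_image]

lemma HasCommonBasis.insert_extremes {S S' : Set (Submodule R M)} (h : HasCommonBasis S)
    (hS : ∀ U ∈ S', U = ⊥ ∨ U = ⊤ ∨ U ∈ S) : HasCommonBasis S' := by
  obtain ⟨b, hb⟩ := h
  refine ⟨b, fun U hU => ?_⟩
  rcases hS U hU with rfl | rfl | hU
  · exact ⟨∅, by simp⟩
  · exact ⟨Set.univ, by simp⟩
  · exact hb U hU

lemma hasCommonBasis_empty [StrongRankCondition R] [Module.Free R M] [Module.Finite R M] :
    HasCommonBasis (∅ : Set (Submodule R M)) :=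
  ⟨Module.finBasis R M, fun _ h => h.elim⟩

end Splittings
end HigherTits

namespace HigherTits
open Limits unitInterval

section FrameComplex

variable {R : Type v} {M : Type u} [CommRing R] [AddCommGroup M] [Module R M]

/-! ### The complex of chains of flags and splittings with a common basis -/

variable (R M) in
/-- The poset of summands of `M` or, if the argument is `true`, that of complementary pairs. -/
def Part : Bool → Type u
  | false => Complementeds (Submodule R M)
  | true => SplitPart R M

instance : ∀ c, PartialOrder (Part R M c)
  | false => inferInstanceAs (PartialOrder (Complementeds (Submodule R M)))
  | true => inferInstanceAs (PartialOrder (SplitPart R M))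

instance : ∀ c, BoundedOrder (Part R M c)
  | false => inferInstanceAs (BoundedOrder (Complementeds (Submodule R M)))
  | true => inferInstanceAs (BoundedOrder (SplitPart R M))

instance [Nontrivial M] : ∀ c, Nontrivial (Part R M c)
  | false => ⟨⊥, ⊤, fun h => bot_ne_top (congrArg Subtype.val h : (⊥ : Submodule R M) = ⊤)⟩
  | true => ⟨⊥, ⊤, fun h => bot_ne_top (congrArg SplitPart.fst h : (⊥ : Submodule R M) = ⊤)⟩

/-- The submodules that occur in an element of `Part R M c`. -/
def Part.submodules : ∀ {c}, Part R M c → Set (Submodule R M)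
  | false, V => {V.1}
  | true, x => {SplitPart.fst x, SplitPart.snd x}

lemma Part.submodules_bot {c : Bool} {U : Submodule R M}
    (h : U ∈ (⊥ : Part R M c).submodules) : U = ⊥ ∨ U = ⊤ := by
  cases c
  · exact Or.inl h
  · exact h

lemma Part.submodules_top {c : Bool} {U : Submodule R M}
    (h : U ∈ (⊤ : Part R M c).submodules) : U = ⊥ ∨ U = ⊤ := by
  cases c
  · exact Or.inr h
  · exact h.symm

variable (R M) in
/-- The poset that corresponds to a factor of the join: the first `a` factors consist of flags,
the others of splittings. -/
abbrev FactorPart {a b : ℕ} (i : Fin a ⊕ₗ Fin b) : Type u := Part R M (ofLex i).isRight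

/-- The submodules that occur in the coordinates of the elements of a set. -/
def coordSubmodules {a b : ℕ} (s : Set (∀ i : Fin a ⊕ₗ Fin b, FactorPart R M i)) :
    Set (Submodule R M) :=
  ⋃ y ∈ s, ⋃ i, (y i).submodules

lemma mem_coordSubmodules {a b : ℕ} {s : Set (∀ i : Fin a ⊕ₗ Fin b, FactorPart R M i)}
    {U : Submodule R M} : U ∈ coordSubmodules s ↔ ∃ y ∈ s, ∃ i, U ∈ (y i).submodules := by
  simp [coordSubmodules]

variable (R M) in
/-- The chains in the product of the posets of summands and complementary pairs such that the
submodules that occur have a common basis. -/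
def frameComplex (a b : ℕ) :
    PreAbstractSimplicialComplex (∀ i : Fin a ⊕ₗ Fin b, FactorPart R M i) where
  faces := {s | s.Nonempty ∧ IsChain (· ≤ ·) (s : Set (∀ i : Fin a ⊕ₗ Fin b, FactorPart R M i)) ∧
    HasCommonBasis (coordSubmodules (s : Set (∀ i : Fin a ⊕ₗ Fin b, FactorPart R M i)))}
  isRelLowerSet_faces := fun _ hs => ⟨hs.1, fun _ hts ht =>
    ⟨ht, hs.2.1.mono (Finset.coe_subset.2 hts),
      hs.2.2.mono (Set.biUnion_subset_biUnion_left (Finset.coe_subset.2 hts))⟩⟩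

lemma isAdmissible_frameComplex [StrongRankCondition R] [Module.Free R M] [Module.Finite R M]
    (a b : ℕ) [DecidableEq (∀ i : Fin a ⊕ₗ Fin b, FactorPart R M i)] :
    IsAdmissible (frameComplex R M a b) where
  isChain s hs := hs.2.1
  insert_mem s hs e hcomp hcoord := by
    have hs' : IsChain (· ≤ ·) (s : Set (∀ i : Fin a ⊕ₗ Fin b, FactorPart R M i)) ∧
        HasCommonBasis (coordSubmodules (s : Set (∀ i : Fin a ⊕ₗ Fin b, FactorPart R M i))) := by
      rcases hs with rfl | hs
      · refine ⟨by simp, ?_⟩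
        exact hasCommonBasis_empty.mono (by simp [coordSubmodules])
      · exact hs.2
    refine ⟨Finset.insert_nonempty _ _, ?_, hs'.2.insert_extremes fun U hU => ?_⟩
    · rw [Finset.coe_insert]
      exact hs'.1.insert fun y hy _ => (hcomp y hy).symm
    · obtain ⟨y, hy, i, hUy⟩ := mem_coordSubmodules.1 hU
      rcases Finset.mem_insert.1 hy with rfl | hy
      · rcases hcoord i with h | h | ⟨z, hz, h⟩
        · rw [h] at hUy
          exact (Part.submodules_bot hUy).imp_right Or.inl
        · rw [h] at hUy
          exact (Part.submodules_top hUy).imp_right Or.inl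
        · rw [h] at hUy
          exact Or.inr (Or.inr (mem_coordSubmodules.2 ⟨z, hz, i, hUy⟩))
      · exact Or.inr (Or.inr (mem_coordSubmodules.2 ⟨y, hy, i, hUy⟩))

/-! ### The diagonal of the multisimplicial set of flags and splittings -/

section Diagonal

variable {a b : ℕ}

variable (R M) in
/-- The value of the diagonal of the product at `n`. -/
abbrev DiagSimplex (a b : ℕ) (n : SimplexCategoryᵒᵖ) : Type u :=
  (diagonal (productMulti R M a b)).obj n

/-- The chain in the product of posets that corresponds to some flags and splittings. -/
def toChain {n : SimplexCategoryᵒᵖ} (x : DiagSimplex R M a b n) :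
    Fin (n.unop.len + 1) →o ∀ i : Fin a ⊕ₗ Fin b, FactorPart R M i where
  toFun k i := match i with
    | Sum.inl i => (⟨(x.1 i).1 k, (x.1 i).2 k⟩ : Complementeds (Submodule R M))
    | Sum.inr j => cut (x.2 j).1 (x.2 j).2 k
  monotone' := fun _ _ hkl i => match i with
    | Sum.inl i => (x.1 i).1.monotone hkl
    | Sum.inr j => cut_mono (x.2 j).1 (x.2 j).2 hkl

lemma toChain_injective {n : SimplexCategoryᵒᵖ} :
    Function.Injective (toChain : DiagSimplex R M a b n → _) := by
  intro x y h
  refine Prod.ext (funext fun i => ?_) (funext fun j => ?_)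
  · refine Subtype.ext (OrderHom.ext _ _ (funext fun k => ?_))
    have := congrFun (DFunLike.congr_fun h k) (Sum.inlₗ i)
    exact congrArg (Subtype.val : Complementeds (Submodule R M) → Submodule R M) this
  · refine Subtype.ext ?_
    have : cut (x.2 j).1 (x.2 j).2 = cut (y.2 j).1 (y.2 j).2 := funext fun k =>
      congrFun (DFunLike.congr_fun h k) (Sum.inrₗ j)
    rw [← gap_cut (x.2 j).1 (x.2 j).2, this, gap_cut]

lemma toChain_surjective {n : SimplexCategoryᵒᵖ} :
    Function.Surjective (toChain : DiagSimplex R M a b n → _) := by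
  intro c
  have hc : ∀ j : Fin b, Monotone fun k => (c k (Sum.inrₗ j) : SplitPart R M) :=
    fun j k l hkl => c.monotone hkl (Sum.inrₗ j)
  let x : DiagSimplex R M a b n :=
    (fun i => ⟨⟨fun k => (c k (Sum.inlₗ i) : Complementeds (Submodule R M)).1,
        fun k l hkl => c.monotone hkl (Sum.inlₗ i)⟩,
        fun k => (c k (Sum.inlₗ i) : Complementeds (Submodule R M)).2⟩,
      fun j => ⟨gap fun k => (c k (Sum.inrₗ j) : SplitPart R M), gap_isInternal (hc j)⟩)
  refine ⟨x, OrderHom.ext _ _ (funext fun k => funext fun i => ?_)⟩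
  match i with
  | Sum.inl i => rfl
  | Sum.inr j => exact congrFun (cut_gap (hc j)) k

lemma toChain_map {n m : SimplexCategoryᵒᵖ} (f : n ⟶ m) (x : DiagSimplex R M a b n) :
    toChain ((diagonal (productMulti R M a b)).map f x) =
      (toChain x).comp f.unop.toOrderHom := by
  refine OrderHom.ext _ _ (funext fun k => funext fun i => ?_)
  match i with
  | Sum.inl i => rfl
  | Sum.inr j => exact cut_fibreSum f.unop.toOrderHom (x.2 j).1 (x.2 j).2 k

lemma hasCommonBasis_toChain {n : SimplexCategoryᵒᵖ} (x : DiagSimplex R M a b n) :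
    HasCommonBasis (coordSubmodules (Set.range (toChain x))) ↔
      HasCommonBasis (submodulesOfMulti x) := by
  constructor
  · refine fun h => h.of_infs ?_
    rintro U (⟨i, k, rfl⟩ | ⟨j, l, rfl⟩)
    · exact ⟨{(x.1 i).1 k}, Set.singleton_subset_iff.2
        (mem_coordSubmodules.2 ⟨_, ⟨k, rfl⟩, Sum.inlₗ i, rfl⟩), sInf_singleton.symm⟩
    · refine ⟨{U | ∃ k, l ≤ k.castSucc ∧ U = (cut (x.2 j).1 (x.2 j).2 k).fst} ∪
        {U | ∃ k, k.castSucc < l ∧ U = (cut (x.2 j).1 (x.2 j).2 k).snd}, ?_, ?_⟩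
      · rintro _ (⟨k, -, rfl⟩ | ⟨k, -, rfl⟩)
        · exact mem_coordSubmodules.2 ⟨_, ⟨k, rfl⟩, Sum.inrₗ j, Or.inl rfl⟩
        · exact mem_coordSubmodules.2 ⟨_, ⟨k, rfl⟩, Sum.inrₗ j, Or.inr rfl⟩
      · rw [sInf_union]
        refine (congrFun (gap_cut (x.2 j).1 (x.2 j).2) l).symm.trans (congrArg₂ (· ⊓ ·) ?_ ?_)
        · exact le_antisymm (le_sInf (by rintro _ ⟨k, hk, rfl⟩; exact iInf₂_le k hk))
            (le_iInf₂ fun k hk => sInf_le ⟨k, hk, rfl⟩)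
        · exact le_antisymm (le_sInf (by rintro _ ⟨k, hk, rfl⟩; exact iInf₂_le k hk))
            (le_iInf₂ fun k hk => sInf_le ⟨k, hk, rfl⟩)
  · refine fun h => h.of_sums fun U hU => ?_
    obtain ⟨_, ⟨k, rfl⟩, i, hU⟩ := mem_coordSubmodules.1 hU
    match i with
    | Sum.inl i =>
      refine ⟨{(x.1 i).1 k}, Set.singleton_subset_iff.2 (Or.inl ⟨i, k, rfl⟩), ?_⟩
      rw [sSup_singleton]
      exact hU
    | Sum.inr j =>
      rcases hU with rfl | rfl
      · exact ⟨(x.2 j).1 '' {i | i ≤ k.castSucc},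
          by rintro _ ⟨l, -, rfl⟩; exact Or.inr ⟨j, l, rfl⟩, sSup_image.symm⟩
      · exact ⟨(x.2 j).1 '' {i | k.castSucc < i},
          by rintro _ ⟨l, -, rfl⟩; exact Or.inr ⟨j, l, rfl⟩, sSup_image.symm⟩

lemma mem_frameComplex_toChain {n : SimplexCategoryᵒᵖ} (x : DiagSimplex R M a b n) :
    (Set.finite_range (toChain x)).toFinset ∈ frameComplex R M a b ↔
      HasCommonBasis (submodulesOfMulti x) := by
  rw [← hasCommonBasis_toChain]
  constructor
  · intro h
    have := h.2.2
    rwa [Set.Finite.coe_toFinset] at this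
  · intro h
    refine ⟨⟨toChain x 0, by simp⟩, ?_, by rwa [Set.Finite.coe_toFinset]⟩
    rw [Set.Finite.coe_toFinset]
    exact (toChain x).monotone.isChain_range

/-- A tuple of flags and splittings is full if and only if the chain starts at `⊥` and ends
at `⊤`. -/
lemma full_iff {n : SimplexCategoryᵒᵖ} (x : DiagSimplex R M a b n) :
    ((∃ i : Fin a, FlagNotFull (x.1 i)) ∨ ∃ j : Fin b, SplitNotFull (x.2 j)) ↔
      ¬ (toChain x 0 = ⊥ ∧ toChain x (Fin.last _) = ⊤) := by
  have h₀ : ∀ j : Fin b, (toChain x 0 (Sum.inrₗ j) : SplitPart R M) = ⊥ ↔ (x.2 j).1 0 = ⊥ :=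
    fun j => cut_zero_eq_bot_iff (x.2 j).2
  have h₁ : ∀ j : Fin b, (toChain x (Fin.last _) (Sum.inrₗ j) : SplitPart R M) = ⊤ ↔
      (x.2 j).1 (Fin.last _) = ⊥ := fun j => cut_last_eq_top_iff (x.2 j).2
  constructor
  · rintro (⟨i, hi⟩ | ⟨j, hj⟩) ⟨hb, ht⟩
    · rcases hi with hi | hi
      · exact hi (congrArg Subtype.val (congrFun hb (Sum.inlₗ i) : _ = (⊥ : Complementeds _)))
      · exact hi (congrArg Subtype.val (congrFun ht (Sum.inlₗ i) : _ = (⊤ : Complementeds _)))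
    · rcases hj with hj | hj
      · exact hj ((h₀ j).1 (congrFun hb (Sum.inrₗ j)))
      · exact hj ((h₁ j).1 (congrFun ht (Sum.inrₗ j)))
  · contrapose!
    rintro ⟨hF, hS⟩
    simp only [FlagNotFull, SplitNotFull, not_or, not_not] at hF hS
    refine ⟨funext fun i => ?_, funext fun i => ?_⟩
    · match i with
      | Sum.inl i =>
        exact Subtype.ext (p := IsComplemented) (a1 := toChain x 0 (Sum.inlₗ i))
          (a2 := (⊥ : Complementeds (Submodule R M))) (hF i).1
      | Sum.inr j => exact (h₀ j).2 (hS j).1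
    · match i with
      | Sum.inl i =>
        exact Subtype.ext (p := IsComplemented) (a1 := toChain x (Fin.last _) (Sum.inlₗ i))
          (a2 := (⊤ : Complementeds (Submodule R M))) (hF i).2
      | Sum.inr j => exact (h₁ j).2 (hS j).2

end Diagonal

end FrameComplex
end HigherTits

namespace HigherTits
open Limits unitInterval

section Step

/-! ### Chains compatible with the corners -/

variable {ι : Type} [LinearOrder ι] {P : ι → Type u} [∀ i, PartialOrder (P i)]
  [∀ i, BoundedOrder (P i)]

/-- The element with coordinate `v` at `i`, coordinate `⊤` before `i` and `⊥` after `i`. -/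
def step (i : ι) (v : P i) : ∀ j, P j :=
  Function.update (fun j => if j < i then ⊤ else ⊥) i v

lemma step_self (i : ι) (v : P i) : step i v i = v := Function.update_self _ _ _

lemma step_of_lt {i j : ι} (h : j < i) (v : P i) : step i v j = ⊤ :=
  (Function.update_of_ne h.ne _ _).trans (if_pos h)

lemma step_of_gt {i j : ι} (h : i < j) (v : P i) : step i v j = ⊥ :=
  (Function.update_of_ne h.ne' _ _).trans (if_neg (not_lt.2 h.le))

lemma step_le_step_of_lt {i j : ι} (h : i < j) (v : P i) (w : P j) : step i v ≤ step j w :=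
  fun k => by
    rcases lt_or_ge k j with hk | hk
    · rw [step_of_lt hk]
      exact le_top
    · rw [step_of_gt (h.trans_le hk)]
      exact bot_le

lemma not_step_le_step_of_lt {i j : ι} (h : i < j) {v : P i} (hv : v ≠ ⊤) (w : P j) :
    ¬ step j w ≤ step i v := fun hle => by
  have := hle i
  rw [step_of_lt h, step_self] at this
  exact hv (top_le_iff.1 this)

lemma step_le_step_iff {i : ι} {v w : P i} : step i v ≤ step i w ↔ v ≤ w := by
  refine ⟨fun h => ?_, fun h k => ?_⟩
  · simpa only [step_self] using h i
  · rcases lt_trichotomy k i with hk | rfl | hk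
    · rw [step_of_lt hk, step_of_lt hk]
    · rwa [step_self, step_self]
    · rw [step_of_gt hk, step_of_gt hk]

lemma step_comparable_corner (i q : ι) (v : P i) :
    step i v ≤ corner P q ∨ corner P q ≤ step i v := by
  rcases lt_or_ge q i with h | h
  · refine Or.inr fun k => ?_
    rcases lt_or_ge k i with hk | hk
    · rw [step_of_lt hk]
      exact le_top
    · rw [corner_of_lt (h.trans_le hk)]
      exact bot_le
  · refine Or.inl fun k => ?_
    rcases le_or_gt k i with hk | hk
    · rw [corner_of_le (hk.trans h)]
      exact le_top
    · rw [step_of_gt hk]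
      exact bot_le

variable [Fintype ι] [DecidableEq (∀ i, P i)]

lemma step_comparable_corners {x : ∀ i, P i} (hx : x ∈ corners P) (i : ι) (v : P i) :
    step i v ≤ x ∨ x ≤ step i v := by
  rcases mem_corners.1 hx with rfl | ⟨q, rfl⟩
  · exact Or.inr bot_le
  · exact step_comparable_corner i q v

lemma step_notMem_corners {i : ι} {v : P i} (h₀ : v ≠ ⊥) (h₁ : v ≠ ⊤) : step i v ∉ corners P :=
  fun h => by
    have := corners_extreme h i
    rw [step_self] at this
    exact this.elim h₀ h₁

/-- An element that is comparable with all the corners, but is not a corner, lies between two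
consecutive corners, which differ in one coordinate only. -/
lemma exists_eq_step {y : ∀ i, P i} (hy : y ∉ corners P)
    (hc : ∀ x ∈ corners P, y ≤ x ∨ x ≤ y) : ∃ i, ∃ v : P i, v ≠ ⊥ ∧ v ≠ ⊤ ∧ y = step i v := by
  have hne : {q | ¬ corner P q ≤ y}.Nonempty := by
    by_contra h
    rw [Set.not_nonempty_iff_eq_empty, Set.eq_empty_iff_forall_notMem] at h
    have : y = ⊤ := top_le_iff.1 fun i => by
      have := not_not.1 (h i) i
      rwa [corner_of_le le_rfl] at this
    exact hy (this ▸ top_mem_corners)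
  obtain ⟨q, hq, hmin⟩ := WellFounded.has_min (wellFounded_lt (α := ι)) _ hne
  have hgt : ∀ i, q < i → y i = ⊥ := fun i hi => by
    have := (hc _ (mem_corners.2 (Or.inr ⟨q, rfl⟩))).resolve_right hq i
    rw [corner_of_lt hi] at this
    exact le_bot_iff.1 this
  have hlt : ∀ i, i < q → y i = ⊤ := fun i hi => by
    have := not_not.1 (fun h => hmin i h hi) i
    rw [corner_of_le le_rfl] at this
    exact top_le_iff.1 this
  refine ⟨q, y q, fun h => ?_, fun h => ?_, funext fun i => ?_⟩
  · -- `y` is the corner that belongs to the predecessor of `q`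
    refine hy (mem_corners.2 ?_)
    rcases (Finset.univ.filter (· < q)).eq_empty_or_nonempty with he | hne
    · refine Or.inl (funext fun i => ?_)
      have hi : ¬ i < q := fun hi => Finset.notMem_empty i (he ▸ Finset.mem_filter.2
        ⟨Finset.mem_univ i, hi⟩)
      rcases (not_lt.1 hi).eq_or_lt with rfl | hi
      · exact h
      · exact hgt i hi
    · obtain ⟨p, hp, hmax⟩ := Finset.exists_maximal hne
      have hpq := (Finset.mem_filter.1 hp).2
      refine Or.inr ⟨p, funext fun i => ?_⟩
      rcases le_or_gt i p with hi | hi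
      · rw [corner_of_le hi, hlt i (hi.trans_lt hpq)]
      · rw [corner_of_lt hi]
        rcases lt_trichotomy i q with hiq | rfl | hiq
        · exact absurd (hmax (Finset.mem_filter.2 ⟨Finset.mem_univ i, hiq⟩) hi.le) (not_le.2 hi)
        · exact h.symm
        · exact (hgt i hiq).symm
  · refine hq fun i => ?_
    rcases lt_trichotomy i q with hi | rfl | hi
    · rw [hlt i hi]
      exact le_top
    · rw [h]
      exact le_top
    · rw [corner_of_lt hi]
      exact bot_le
  · rcases lt_trichotomy i q with hi | rfl | hi
    · rw [hlt i hi, step_of_lt hi]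
    · rw [step_self]
    · rw [hgt i hi, step_of_gt hi]

end Step

/-- An order embedding of the vertices that identifies the simplices is an isomorphism of
complexes. -/
lemma nonempty_orderedSSet_iso {V W : Type u} [PartialOrder V] [PartialOrder W] (ψ : V ↪o W)
    {T : PreAbstractSimplicialComplex V} {E : PreAbstractSimplicialComplex W}
    (h : ∀ s, s ∈ T ↔ s.map ψ.toEmbedding ∈ E) (hr : ∀ s ∈ E, ∀ y ∈ s, ∃ x, ψ x = y) :
    Nonempty (orderedSSet T ≅ orderedSSet E) := by
  have key : ∀ {n : SimplexCategoryᵒᵖ} (x : Fin (n.unop.len + 1) →o V),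
      (Set.finite_range (ψ.toOrderHom.comp x)).toFinset =
        (Set.finite_range x).toFinset.map ψ.toEmbedding := fun x => by
    ext y
    simp
  let f : orderedSSet T ⟶ orderedSSet E :=
    { app := fun n => ↾fun x => ⟨ψ.toOrderHom.comp x.1, by
        rw [key]
        exact (h _).1 x.2⟩ }
  have : IsIso f := by
    refine @NatIso.isIso_of_isIso_app _ _ _ _ _ _ f fun n => (isIso_iff_bijective _).2 ⟨?_, ?_⟩
    · intro x y hxy
      refine Subtype.ext (OrderHom.ext _ _ (funext fun i => ψ.injective ?_))
      exact DFunLike.congr_fun (congrArg Subtype.val hxy) i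
    · intro y
      have hy : ∀ i, ∃ x, ψ x = y.1 i := fun i => hr _ y.2 _ (by simp)
      choose x hx using hy
      let x' : Fin (n.unop.len + 1) →o V :=
        ⟨x, fun i j hij => ψ.le_iff_le.1 (by rw [hx, hx]; exact y.1.monotone hij)⟩
      have hx' : ψ.toOrderHom.comp x' = y.1 := OrderHom.ext _ _ (funext hx)
      refine ⟨⟨x', (h _).2 ?_⟩, Subtype.ext hx'⟩
      rw [← key (n := n), hx']
      exact y.2
  exact ⟨asIso f⟩

section Buildings

variable {R : Type v} {M : Type u} [CommRing R] [AddCommGroup M] [Module R M] {a b : ℕ}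

/-! ### The higher Tits building as a complex of chains -/

/-- A proper nonzero summand as an element of the poset of all summands. -/
def titsPart (b : ℕ) (i : Fin a) (V : TitsVertex R M) :
    FactorPart R M (Sum.inlₗ i : Fin a ⊕ₗ Fin b) :=
  (⟨V.1, V.2.2.2⟩ : Complementeds (Submodule R M))

/-- A proper splitting as an element of the poset of all complementary pairs. -/
def splitPart (a : ℕ) (j : Fin b) (W : SplitTitsVertex R M) :
    FactorPart R M (Sum.inrₗ j : Fin a ⊕ₗ Fin b) :=
  SplitPart.mk W.P W.Q W.isCompl

lemma titsPart_ne_bot (b : ℕ) (i : Fin a) (V : TitsVertex R M) : titsPart b i V ≠ ⊥ := fun h =>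
  V.2.1 (congrArg Subtype.val (h : _ = (⊥ : Complementeds (Submodule R M))))

lemma titsPart_ne_top (b : ℕ) (i : Fin a) (V : TitsVertex R M) : titsPart b i V ≠ ⊤ := fun h =>
  V.2.2.1 (congrArg Subtype.val (h : _ = (⊤ : Complementeds (Submodule R M))))

lemma splitPart_ne_bot (a : ℕ) (j : Fin b) (W : SplitTitsVertex R M) : splitPart a j W ≠ ⊥ :=
  fun h => W.P_ne_bot (SplitPart.eq_bot_iff.1 h)

lemma splitPart_ne_top (a : ℕ) (j : Fin b) (W : SplitTitsVertex R M) : splitPart a j W ≠ ⊤ :=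
  fun h => W.Q_ne_bot (SplitPart.eq_top_iff.1 h)

/-- The element of the product of posets that corresponds to a vertex of the join. -/
def joinVertexMap (x : JoinVertex R M a b) : ∀ i : Fin a ⊕ₗ Fin b, FactorPart R M i :=
  match x with
  | Sum.inl (i, V) => step (P := FactorPart R M) (Sum.inlₗ i) (titsPart b i V)
  | Sum.inr (j, W) => step (P := FactorPart R M) (Sum.inrₗ j) (splitPart a j W)

lemma joinVertexMap_titsVertex (i : Fin a) (V : TitsVertex R M) :
    joinVertexMap (titsVertex i V : JoinVertex R M a b) =
      step (P := FactorPart R M) (Sum.inlₗ i) (titsPart b i V) := rfl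

lemma joinVertexMap_splitVertex (j : Fin b) (W : SplitTitsVertex R M) :
    joinVertexMap (splitVertex j W : JoinVertex R M a b) =
      step (P := FactorPart R M) (Sum.inrₗ j) (splitPart a j W) := rfl

lemma joinVertex_cases {p : JoinVertex R M a b → Prop} (hT : ∀ i V, p (titsVertex i V))
    (hS : ∀ j W, p (splitVertex j W)) (x : JoinVertex R M a b) : p x :=
  match x with
  | Sum.inl (i, V) => hT i V
  | Sum.inr (j, W) => hS j W

lemma titsVertex_le_titsVertex {i i' : Fin a} {V V' : TitsVertex R M} :
    (titsVertex i V : JoinVertex R M a b) ≤ titsVertex i' V' ↔ i < i' ∨ i = i' ∧ V ≤ V' :=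
  Sum.Lex.inl_le_inl_iff.trans Prod.Lex.toLex_le_toLex

lemma splitVertex_le_splitVertex {j j' : Fin b} {W W' : SplitTitsVertex R M} :
    (splitVertex j W : JoinVertex R M a b) ≤ splitVertex j' W' ↔ j < j' ∨ j = j' ∧ W ≤ W' :=
  Sum.Lex.inr_le_inr_iff.trans Prod.Lex.toLex_le_toLex

lemma joinVertexMap_le_iff (x y : JoinVertex R M a b) :
    joinVertexMap x ≤ joinVertexMap y ↔ x ≤ y := by
  induction x using joinVertex_cases with
  | hT i V =>
    induction y using joinVertex_cases with
    | hT i' V' =>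
      rw [titsVertex_le_titsVertex, joinVertexMap_titsVertex, joinVertexMap_titsVertex]
      rcases lt_trichotomy i i' with h | rfl | h
      · exact iff_of_true (step_le_step_of_lt (Sum.Lex.inl_lt_inl_iff.2 h) _ _) (Or.inl h)
      · rw [step_le_step_iff]
        simp only [lt_irrefl, true_and, false_or]
        rfl
      · exact iff_of_false
          (not_step_le_step_of_lt (Sum.Lex.inl_lt_inl_iff.2 h) (titsPart_ne_top _ _ V') _)
          (by rintro (h' | ⟨rfl, -⟩); exacts [h.asymm h', h.false])
    | hS j W =>
      exact iff_of_true (step_le_step_of_lt (Sum.Lex.inl_lt_inr _ _) _ _) (Sum.Lex.inl_le_inr _ _)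
  | hS j W =>
    induction y using joinVertex_cases with
    | hT i V =>
      exact iff_of_false (not_step_le_step_of_lt (Sum.Lex.inl_lt_inr _ _) (titsPart_ne_top _ _ V) _)
        Sum.Lex.not_inr_le_inl
    | hS j' W' =>
      rw [splitVertex_le_splitVertex, joinVertexMap_splitVertex, joinVertexMap_splitVertex]
      rcases lt_trichotomy j j' with h | rfl | h
      · exact iff_of_true (step_le_step_of_lt (Sum.Lex.inr_lt_inr_iff.2 h) _ _) (Or.inl h)
      · rw [step_le_step_iff]
        simp only [lt_irrefl, true_and, false_or]
        rfl
      · exact iff_of_false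
          (not_step_le_step_of_lt (Sum.Lex.inr_lt_inr_iff.2 h) (splitPart_ne_top _ _ W') _)
          (by rintro (h' | ⟨rfl, -⟩); exacts [h.asymm h', h.false])

variable (R M a b) in
/-- The poset of vertices of the join as a part of the product of posets. -/
def joinVertexEmbedding : JoinVertex R M a b ↪o ∀ i : Fin a ⊕ₗ Fin b, FactorPart R M i :=
  OrderEmbedding.ofMapLEIff joinVertexMap joinVertexMap_le_iff

lemma exists_eq_joinVertexMap {i : Fin a ⊕ₗ Fin b} {v : FactorPart R M i} (h₀ : v ≠ ⊥)
    (h₁ : v ≠ ⊤) : ∃ x : JoinVertex R M a b, joinVertexMap x = step i v := by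
  match i, v, h₀, h₁ with
  | Sum.inl i, v, h₀, h₁ =>
    exact ⟨titsVertex i ⟨(show Complementeds (Submodule R M) from v).1,
      fun h => h₀ (Subtype.ext (p := IsComplemented) h),
      fun h => h₁ (Subtype.ext (p := IsComplemented) h),
      (show Complementeds (Submodule R M) from v).2⟩, rfl⟩
  | Sum.inr j, v, h₀, h₁ =>
    exact ⟨splitVertex j ⟨SplitPart.fst v, SplitPart.snd v, SplitPart.isCompl v,
      fun h => h₀ (SplitPart.eq_bot_iff.2 h), fun h => h₁ (SplitPart.eq_top_iff.2 h)⟩, rfl⟩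

lemma coordSubmodules_joinVertexMap {s : Set (JoinVertex R M a b)} {x : JoinVertex R M a b}
    (hx : x ∈ s) (i : Fin a ⊕ₗ Fin b) {U : Submodule R M}
    (hU : U ∈ (joinVertexMap x i).submodules) : U = ⊥ ∨ U = ⊤ ∨ U ∈ submodulesOf s := by
  revert hx hU
  induction x using joinVertex_cases with
  | hT j V =>
    intro hx hU
    rw [joinVertexMap_titsVertex] at hU
    rcases lt_trichotomy i (Sum.inlₗ j) with h | rfl | h
    · rw [step_of_lt h] at hU
      exact (Part.submodules_top hU).imp_right Or.inl
    · rw [step_self] at hU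
      exact Or.inr (Or.inr (Or.inl ⟨j, V, hx, hU⟩))
    · rw [step_of_gt h] at hU
      exact (Part.submodules_bot hU).imp_right Or.inl
  | hS j W =>
    intro hx hU
    rw [joinVertexMap_splitVertex] at hU
    rcases lt_trichotomy i (Sum.inrₗ j) with h | rfl | h
    · rw [step_of_lt h] at hU
      exact (Part.submodules_top hU).imp_right Or.inl
    · rw [step_self] at hU
      exact Or.inr (Or.inr (Or.inr ⟨j, W, hx, hU⟩))
    · rw [step_of_gt h] at hU
      exact (Part.submodules_bot hU).imp_right Or.inl

lemma submodulesOf_subset_coordSubmodules (s : Set (JoinVertex R M a b)) :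
    submodulesOf s ⊆ coordSubmodules (joinVertexMap '' s) := by
  rintro U (⟨i, V, hV, rfl⟩ | ⟨j, W, hW, hU⟩)
  · refine mem_coordSubmodules.2 ⟨_, ⟨_, hV, rfl⟩, Sum.inlₗ i, ?_⟩
    rw [joinVertexMap_titsVertex, step_self]
    rfl
  · refine mem_coordSubmodules.2 ⟨_, ⟨_, hW, rfl⟩, Sum.inrₗ j, ?_⟩
    rw [joinVertexMap_splitVertex, step_self]
    exact hU

variable [DecidableEq (∀ i : Fin a ⊕ₗ Fin b, FactorPart R M i)]

lemma joinVertexMap_comparable {y : ∀ i : Fin a ⊕ₗ Fin b, FactorPart R M i}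
    (hy : y ∈ corners (FactorPart R M)) (x : JoinVertex R M a b) :
    joinVertexMap x ≤ y ∨ y ≤ joinVertexMap x := by
  induction x using joinVertex_cases with
  | hT i V => exact step_comparable_corners hy _ _
  | hS j W => exact step_comparable_corners hy _ _

lemma joinVertexMap_notMem_corners (x : JoinVertex R M a b) :
    joinVertexMap x ∉ corners (FactorPart R M (a := a) (b := b)) := by
  induction x using joinVertex_cases with
  | hT i V => exact step_notMem_corners (titsPart_ne_bot _ _ V) (titsPart_ne_top _ _ V)
  | hS j W => exact step_notMem_corners (splitPart_ne_bot _ _ W) (splitPart_ne_top _ _ W)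

lemma mem_higherTits_iff (s : Finset (JoinVertex R M a b)) :
    s ∈ higherTits R M a b ↔
      s.map (joinVertexEmbedding R M a b).toEmbedding ∈ star (frameComplex R M a b) ∅ := by
  have hcoe : ((s.map (joinVertexEmbedding R M a b).toEmbedding : Finset _) : Set _) =
      joinVertexMap '' (s : Set (JoinVertex R M a b)) := Finset.coe_map _ _
  constructor
  · intro hs
    have hne := (higherTits R M a b).isRelLowerSet_faces hs
    have hc := isChain_of_mem_titsJoin hs.1
    refine ⟨hne.1.map, ⟨(hne.1.map).mono Finset.subset_union_left, ?_, ?_⟩, ?_⟩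
    · rw [Finset.coe_union, hcoe]
      rintro _ (⟨x, hx, rfl⟩ | hx) y (⟨y, hy, rfl⟩ | hy) -
      · exact (hc.total hx hy).imp (joinVertexMap_le_iff x y).2 (joinVertexMap_le_iff y x).2
      · exact joinVertexMap_comparable hy x
      · exact (joinVertexMap_comparable hx y).symm
      · exact corners_comparable hx hy
    · refine hs.2.insert_extremes fun U hU => ?_
      obtain ⟨y, hy, i, hU⟩ := mem_coordSubmodules.1 hU
      rw [Finset.coe_union, hcoe] at hy
      rcases hy with ⟨x, hx, rfl⟩ | hy
      · exact coordSubmodules_joinVertexMap hx i hU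
      · rcases corners_extreme hy i with h | h
        · rw [h] at hU
          exact (Part.submodules_bot hU).imp_right Or.inl
        · rw [h] at hU
          exact (Part.submodules_top hU).imp_right Or.inl
    · intro y hy
      obtain ⟨hy, hy'⟩ := Finset.mem_inter.1 hy
      obtain ⟨x, -, rfl⟩ := Finset.mem_map.1 hy
      exact (joinVertexMap_notMem_corners x hy').elim
  · rintro ⟨hne, ⟨-, hc, hb⟩, -⟩
    rw [Finset.coe_union, hcoe] at hc hb
    have hc' : ∀ x ∈ s, ∀ y ∈ s, x ≤ y ∨ y ≤ x := fun x hx y hy =>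
      (hc.total (Or.inl ⟨x, hx, rfl⟩) (Or.inl ⟨y, hy, rfl⟩)).imp (joinVertexMap_le_iff x y).1
        (joinVertexMap_le_iff y x).1
    refine ⟨⟨Finset.map_nonempty.1 hne, fun i V hV V' hV' _ => ?_, fun j W hW W' hW' _ => ?_⟩,
      hb.mono ((submodulesOf_subset_coordSubmodules _).trans
        (Set.biUnion_subset_biUnion_left Set.subset_union_left))⟩
    · exact (hc' _ hV _ hV').imp
        (fun h => ((titsVertex_le_titsVertex.1 h).resolve_left (lt_irrefl _)).2)
        (fun h => ((titsVertex_le_titsVertex.1 h).resolve_left (lt_irrefl _)).2)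
    · exact (hc' _ hW _ hW').imp
        (fun h => ((splitVertex_le_splitVertex.1 h).resolve_left (lt_irrefl _)).2)
        (fun h => ((splitVertex_le_splitVertex.1 h).resolve_left (lt_irrefl _)).2)

variable (R M a b) in
/-- The higher Tits building is the complex of the chains that are compatible with the corners and
contain none of them: such chains consist of elements with exactly one coordinate that is not
extreme, preceded by coordinates `⊤` and followed by coordinates `⊥`. -/
lemma nonempty_higherTits_iso :
    Nonempty (orderedSSet (higherTits R M a b) ≅ orderedSSet (star (frameComplex R M a b) ∅)) := by
  refine nonempty_orderedSSet_iso (joinVertexEmbedding R M a b) mem_higherTits_iff fun s hs y hy => ?_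
  have hyc : y ∉ corners (FactorPart R M (a := a) (b := b)) := fun h =>
    Finset.notMem_empty _ (hs.2.2 (Finset.mem_inter.2 ⟨hy, h⟩))
  obtain ⟨i, v, h₀, h₁, rfl⟩ := exists_eq_step hyc fun x hx =>
    hs.2.1.2.1.total (Finset.mem_coe.2 (Finset.mem_union_left _ hy))
      (Finset.mem_coe.2 (Finset.mem_union_right _ hx))
  exact exists_eq_joinVertexMap h₀ h₁

end Buildings
end HigherTits

namespace HigherTits
open Limits unitInterval

section Quotient

variable (R : Type v) (M : Type u) [CommRing R] [AddCommGroup M] [Module R M] (a b : ℕ)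

/-! ### The quotient as a suspension -/

lemma isIso_of_bijective {X Y : SSet.{u}} (f : X ⟶ Y) (h : ∀ n, Function.Bijective (f.app n)) :
    IsIso f :=
  @NatIso.isIso_of_isIso_app _ _ _ _ _ _ f fun n => (isIso_iff_bijective _).2 (h n)

/-- The diagonal of `L^{a,b}(M)` is the complex of chains of flags and splittings. -/
lemma nonempty_diagonal_latticeMulti_iso :
    Nonempty (diagonal (latticeMulti R M a b).toFunctor ≅
      orderedSSet (frameComplex R M a b)) := by
  let f : diagonal (latticeMulti R M a b).toFunctor ⟶ orderedSSet (frameComplex R M a b) :=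
    { app := fun n => ↾fun x => ⟨toChain x.1, (mem_frameComplex_toChain x.1).2 x.2⟩
      naturality := fun n m g => by
        ext x
        exact Subtype.ext (toChain_map g x.1) }
  have := isIso_of_bijective f fun n => by
    refine ⟨fun x y h => Subtype.ext (toChain_injective (congrArg Subtype.val h)), fun y => ?_⟩
    obtain ⟨x, hx⟩ := toChain_surjective y.1
    exact ⟨⟨x, (mem_frameComplex_toChain x).1 (hx ▸ y.2)⟩, Subtype.ext hx⟩
  exact ⟨asIso f⟩

variable {R M a b} in
open scoped Classical in
lemma extremes_subset_iff {n : SimplexCategoryᵒᵖ}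
    (c : Fin (n.unop.len + 1) →o ∀ i : Fin a ⊕ₗ Fin b, FactorPart R M i) :
    {⊥, ⊤} ⊆ (Set.finite_range c).toFinset ↔ c 0 = ⊥ ∧ c (Fin.last _) = ⊤ := by
  rw [Finset.insert_subset_iff, Finset.singleton_subset_iff]
  simp only [Set.Finite.mem_toFinset, Set.mem_range]
  constructor
  · rintro ⟨⟨k, hk⟩, l, hl⟩
    exact ⟨le_bot_iff.1 (hk ▸ c.monotone (Fin.zero_le k)),
      top_le_iff.1 (hl ▸ c.monotone (Fin.le_last l))⟩
  · exact fun h => ⟨⟨_, h.1⟩, _, h.2⟩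

open scoped Classical in
/-- The diagonal of the simplicial subset of the elements that are not full is the complex of those
chains that do not contain both `⊥` and `⊤`. -/
lemma nonempty_diagonal_notFullMulti_iso :
    Nonempty (diagonal (notFullMulti R M a b).toFunctor ≅
      orderedSSet (notContaining (frameComplex R M a b) {⊥, ⊤})) := by
  let f : diagonal (notFullMulti R M a b).toFunctor ⟶
      orderedSSet (notContaining (frameComplex R M a b) {⊥, ⊤}) :=
    { app := fun n => ↾fun x => ⟨toChain x.1.1, (mem_frameComplex_toChain x.1.1).2 x.1.2,
        fun h => (full_iff x.1.1).1 x.2 ((extremes_subset_iff _).1 h)⟩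
      naturality := fun n m g => by
        ext x
        exact Subtype.ext (toChain_map g x.1.1) }
  have := isIso_of_bijective f fun n => by
    refine ⟨fun x y h => Subtype.ext (Subtype.ext (toChain_injective (congrArg Subtype.val h))),
      fun y => ?_⟩
    obtain ⟨x, hx⟩ := toChain_surjective y.1
    exact ⟨⟨⟨x, (mem_frameComplex_toChain x).1 (hx ▸ y.2.1)⟩, (full_iff x).2 fun h =>
      y.2.2 (hx ▸ (extremes_subset_iff _).2 h)⟩, Subtype.ext hx⟩
  exact ⟨asIso f⟩

/-- The diagonal as a functor. -/
abbrev diagonalFunctor : (MultiIndex a b ⥤ Type u) ⥤ SSet.{u} :=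
  (Functor.whiskeringLeft _ _ _).obj (Functor.pi' fun _ : Fin a ⊕ Fin b => 𝟭 SimplexCategoryᵒᵖ)

instance : ContractibleSpace (SSet.toTop.obj ((diagonalFunctor a b).obj
    ((Functor.const _).obj PUnit.{u + 1}))) := by
  let t : IsTerminal ((diagonalFunctor a b).obj ((Functor.const _).obj PUnit.{u + 1})) :=
    IsTerminal.ofUniqueHom (fun Y => { app := fun n => ↾fun _ => PUnit.unit }) fun Y f => by
      ext n y
      rfl
  exact (HtpyEquiv.of_iso (SSet.toTop.mapIso
    (SSet.stdSimplex.isTerminalObj₀.uniqueUpToIso t).symm)).contractibleSpace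

/-- The quotient of the contractible diagonal of `L^{a,b}(M)` by the diagonal of its not full part is
the suspension of the latter. Realization and the diagonal preserve the pushout square that defines
the quotient. -/
lemma htpyEquiv_higherBuilding
    [ContractibleSpace (SSet.toTop.obj (diagonal (latticeMulti R M a b).toFunctor))] :
    HtpyEquiv (SSet.toTop.obj (diagonal (higherBuilding R M a b)))
      (suspension (SSet.toTop.obj (diagonal (notFullMulti R M a b).toFunctor))) := by
  have sq := ((IsPushout.of_hasPushout (notFullMulti R M a b).ι
    ({ app := fun _ => ↾fun _ => PUnit.unit } : (notFullMulti R M a b).toFunctor ⟶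
      (Functor.const _).obj PUnit.{u + 1})).map (diagonalFunctor a b)).map SSet.toTop
  have : Mono ((diagonalFunctor a b).map (notFullMulti R M a b).ι) := by
    rw [NatTrans.mono_iff_mono_app]
    intro n
    rw [mono_iff_injective]
    exact Subtype.val_injective
  have : ContractibleSpace (SSet.toTop.obj ((diagonalFunctor a b).obj
    (latticeMulti R M a b).toFunctor)) := ‹_›
  exact htpyEquiv_suspension_of_isPushout sq (hasHEP_toTop _)

/-- One suspension comes from the quotient, and the `a + b + 1` corners account for the other
`a + b`. -/
theorem htpyEquiv_higherBuilding_suspension [StrongRankCondition R] [Module.Free R M]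
    [Module.Finite R M] [Nontrivial M] :
    HtpyEquiv (SSet.toTop.obj (diagonal (higherBuilding R M a b)))
      (suspension^[a + b + 1] (SSet.toTop.obj (orderedSSet (higherTits R M a b)))) := by
  classical
  have hK := isAdmissible_frameComplex (R := R) (M := M) a b
  obtain ⟨e₁⟩ := nonempty_diagonal_latticeMulti_iso R M a b
  obtain ⟨e₂⟩ := nonempty_diagonal_notFullMulti_iso R M a b
  obtain ⟨e₃⟩ := nonempty_higherTits_iso R M a b
  have := hK.contractibleSpace
  have := (HtpyEquiv.of_iso (SSet.toTop.mapIso e₁)).contractibleSpace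
  have h₁ := (HtpyEquiv.of_iso (SSet.toTop.mapIso e₂)).suspension
  have h₂ := hK.htpyEquiv_suspension_notContaining_extremes
  rw [show Fintype.card (Fin a ⊕ₗ Fin b) = a + b from
    Fintype.card_sum.trans (by rw [Fintype.card_fin, Fintype.card_fin])] at h₂
  have h₃ := (HtpyEquiv.of_iso (SSet.toTop.mapIso e₃)).symm.suspension_iterate (a + b + 1)
  exact (((htpyEquiv_higherBuilding R M a b).trans h₁).trans h₂).trans h₃

end Quotient
end HigherTits

theorem mainTheorem7 {R : Type v} [CommRing R] [IsDomain R] [IsPrincipalIdealRing R]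
    {M : Type u} [AddCommGroup M] [Module R M] [Module.Free R M] [Module.Finite R M]
    [Nontrivial M] (a b : ℕ) :
    Nonempty (ContinuousMap.HomotopyEquiv
      (SSet.toTop.obj (HigherTits.diagonal (HigherTits.higherBuilding R M a b)))
      (HigherTits.suspension^[a + b + 1]
        (SSet.toTop.obj (HigherTits.orderedSSet (HigherTits.higherTits R M a b))))) :=
  HigherTits.htpyEquiv_higherBuilding_suspension R M a b
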